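/- **Proposition 9.3.** Let $\alpha>0$ and let $V\in C^3(\mathbb R)$ be a bistable potential, i.e. there are $a,b>0$ with $uV'(u)\ge au^2-b$ for all $u\in\mathbb R$; $V(0)=V'(0)=0$, $V''(0)>0$; $V(1)<0$, $V'(1)=0$, $V''(1)>0$; and $\{u\in\mathbb R : V'(u)=0,\ V(u)\le 0\}=\{0,1\}$. Put $m=\min(V''(0),V''(1))>0$ and $$\mu_\alpha=\frac1{2\alpha}\bigl(-1+\mathrm{Re}\sqrt{1-4\alpha m}\bigr).$$ Let $c>0$ and let $h:\mathbb R\to(0,1)$ be a travelling front, i.e. a $C^2$ solution of $h''+ch'-V'(h)=0$ on $\mathbb R$ with $h(-\infty)=1$, $h(+\infty)=0$, and set $g(y)=V''(h(y))$. For complex-valued $u\in L^2_{\mathrm{loc}}(\mathbb R)$ let $\|u\|_{L^2_{\mathrm{ul}}}=\sup_{\xi\in\mathbb R}\|u\|_{L^2([\xi,\xi+1])}$; let $L^2_{\mathrm{ul}}(\mathbb R)$ be the space of those $u$ with $\|u\|_{L^2_{\mathrm{ul}}}<\infty$ and $\|u(\cdot-\xi)-u\|_{L^2_{\mathrm{ul}}}\to0$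 as $\xi\to0$, and let $H^k_{\mathrm{ul}}(\mathbb R)$ be the space of functions whose weak derivatives of order $0,\dots,k$ all belong to $L^2_{\mathrm{ul}}(\mathbb R)$, with norm $\bigl(\sum_{j\le k}\|\partial^ju\|_{L^2_{\mathrm{ul}}}^2\bigr)^{1/2}$. In $X=H^1_{\mathrm{ul}}(\mathbb R)\times L^2_{\mathrm{ul}}(\mathbb R)$ consider the operator $\mathcal A$ with domain $Y=H^2_{\mathrm{ul}}(\mathbb R)\times H^1_{\mathrm{ul}}(\mathbb R)$, $$\mathcal A(u,v)=\Bigl(v,\ \tfrac1\alpha\bigl(u''+cu'-gu-v+2\alpha c\,v'\bigr)\Bigr),$$ which is the generator of the evolution equation $\alpha u_{tt}+u_t-2\alpha c\,u_{yt}=u_{yy}+cu_y-g(y)u$ obtained by linearizing the damped wave equation $\alpha u_{tt}+u_t=u_{xx}-V'(u)$ at the front, in the moving frame. Then the spectrum of $\mathcal A$ in the half-plane $\{z\in\mathbb C : \mathrm{Re}\,z>\mu_\alpha\}$ is exactly a finite set of real numbers $$0=\lambda_0>\lambda_1>\dots>\lambda_k>\mu_\alpha\qquad(k\in\mathbb N,\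 k\ge 0),$$ and each $\lambda_i$ is an (algebraically) simple eigenvalue of $\mathcal A$, i.e. $\ker(\mathcal A-\lambda_i)$ is one-dimensional and $X=\ker(\mathcal A-\lambda_i)\oplus\mathrm{range}(\mathcal A-\lambda_i)$. The number $k$ and the values $\lambda_i$ depend only on $\alpha$ and $V$. -/

import Mathlib

open MeasureTheory Filter Topology
open scoped ENNReal NNReal ContDiff

namespace DampedWave

noncomputable section

/-! ### The potential and the front -/

/-- The standing assumptions on the bistable potential `V`. -/
structure IsBistable (V : ℝ → ℝ) : Prop where
  contDiff : ContDiff ℝ 3 V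
  coercive : ∃ a b : ℝ, 0 < a ∧ 0 < b ∧ ∀ u : ℝ, a * u ^ 2 - b ≤ u * deriv V u
  val_zero : V 0 = 0
  deriv_zero : deriv V 0 = 0
  deriv2_zero : 0 < deriv (deriv V) 0
  val_one : V 1 < 0
  deriv_one : deriv V 1 = 0
  deriv2_one : 0 < deriv (deriv V) 1
  critical : {u : ℝ | deriv V u = 0 ∧ V u ≤ 0} = {0, 1}

/-- `h` is the profile of a travelling front with parabolic speed `c`:
a solution `h : ℝ → (0,1)` of `h'' + c h' - V'(h) = 0`, `h(-∞) = 1`, `h(+∞) = 0`. -/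
structure IsFront (V : ℝ → ℝ) (c : ℝ) (h : ℝ → ℝ) : Prop where
  speed_pos : 0 < c
  contDiff : ContDiff ℝ 2 h
  mem_Ioo : ∀ y : ℝ, h y ∈ Set.Ioo (0 : ℝ) 1
  ode : ∀ y : ℝ, deriv (deriv h) y + c * deriv h y - deriv V (h y) = 0
  tendsto_atBot : Tendsto h atBot (𝓝 1)
  tendsto_atTop : Tendsto h atTop (𝓝 0)

/-- `m = min (V''(0), V''(1))`. -/
def mConst (V : ℝ → ℝ) : ℝ := min (deriv (deriv V) 0) (deriv (deriv V) 1)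

/-- `μ_α = (1 / (2α)) (-1 + Re √(1 - 4 α m))`, with the principal complex square root. -/
def muConst (α : ℝ) (V : ℝ → ℝ) : ℝ :=
  1 / (2 * α) * (-1 + (((1 - 4 * α * mConst V : ℝ) : ℂ) ^ (1 / 2 : ℂ)).re)

/-- Bounded uniformly continuous real coefficients. -/
structure IsBUC (g : ℝ → ℝ) : Prop where
  bounded : ∃ C : ℝ, ∀ x, |g x| ≤ C
  uniformContinuous : UniformContinuous g

/-- A continuous function on `ℝ` with finite limits at both ends is uniformly continuous. -/
theorem uniformContinuous_of_limits {f : ℝ → ℝ} {a b : ℝ} (hf : Continuous f)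
    (hb : Tendsto f atBot (𝓝 b)) (ha : Tendsto f atTop (𝓝 a)) : UniformContinuous f := by
  set s : ℝ → ℝ := fun x => max 0 (min 1 x) with hs
  have hsL : UniformContinuous s := by
    have : LipschitzWith 1 s := (LipschitzWith.id.const_min 1).const_max 0
    exact this.uniformContinuous
  have h1 : UniformContinuous (fun x => b + (a - b) * s x) := by
    have h2 : UniformContinuous (fun t : ℝ => b + (a - b) * t) := by
      have : UniformContinuous (fun t : ℝ => (a - b) • t) := uniformContinuous_const_smul _
      exact uniformContinuous_const.add this
    exact h2.comp hsL
  have h3 : UniformContinuous (fun x => f x - (b + (a - b) * s x)) := by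
    refine Continuous.uniformContinuous_of_tendsto_cocompact (x := 0)
      (hf.sub h1.continuous) ?_
    rw [cocompact_eq_atBot_atTop, tendsto_sup]
    constructor
    · have : Tendsto (fun x => f x - b) atBot (𝓝 0) := by
        simpa using hb.sub_const b
      refine this.congr' ?_
      filter_upwards [eventually_le_atBot (0 : ℝ)] with x hx
      have : s x = 0 := by simp [hs, hx]
      simp [this]
    · have : Tendsto (fun x => f x - a) atTop (𝓝 0) := by
        simpa using ha.sub_const a
      refine this.congr' ?_
      filter_upwards [eventually_ge_atTop (1 : ℝ)] with x hx
      have : s x = 1 := by simp [hs, hx]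
      simp [this]
  have := h3.add h1
  simpa using this

/-- The coefficient `g(y) = V''(h(y))` of the linearization is bounded and uniformly
continuous. -/
theorem isBUC_linearized {V h : ℝ → ℝ} {c : ℝ} (hV : IsBistable V) (hh : IsFront V c h) :
    IsBUC (fun y => deriv (deriv V) (h y)) := by
  have hV2 : Continuous (deriv (deriv V)) := by
    have h1 : ContDiff ℝ 2 (deriv V) := by
      have : ContDiff ℝ (2 + 1) V := by simpa [show (2 : WithTop ℕ∞) + 1 = 3 by norm_num]
        using hV.contDiff
      exact (contDiff_succ_iff_deriv.1 this).2.2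
    exact h1.continuous_deriv (by norm_num)
  constructor
  · obtain ⟨C, hC⟩ := (isCompact_Icc (a := (0 : ℝ)) (b := 1)).exists_bound_of_continuousOn
      hV2.continuousOn
    exact ⟨C, fun x => hC _ ⟨(hh.mem_Ioo x).1.le, (hh.mem_Ioo x).2.le⟩⟩
  · exact uniformContinuous_of_limits (hV2.comp hh.contDiff.continuous)
      ((hV2.tendsto 1).comp hh.tendsto_atBot) ((hV2.tendsto 0).comp hh.tendsto_atTop)

/-! ### Uniformly local spaces of complex-valued functions -/

/-- Measurable functions `ℝ → ℂ` modulo equality almost everywhere, as a complex vector space. -/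
def Fn : Type := ℝ →ₘ[volume] ℂ

instance : CoeFun Fn fun _ => ℝ → ℂ := ⟨fun u => AEEqFun.cast u⟩

instance : AddCommGroup Fn := inferInstanceAs (AddCommGroup (ℝ →ₘ[volume] ℂ))

instance : Module ℂ Fn :=
  letI : Module ℂ (ℝ →ₘ[volume] ℂ) := inferInstance
  { smul := this.smul
    one_smul := this.one_smul
    mul_smul := this.mul_smul
    smul_zero := this.smul_zero
    smul_add := this.smul_add
    add_smul := this.add_smul
    zero_smul := this.zero_smul }

/-- The class of an a.e. strongly measurable function. -/
def Fn.mk (f : ℝ → ℂ) (hf : AEStronglyMeasurable f volume) : Fn := AEEqFun.mk f hf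

theorem Fn.coeFn_mk (f : ℝ → ℂ) (hf : AEStronglyMeasurable f volume) :
    (Fn.mk f hf : ℝ → ℂ) =ᵐ[volume] f := AEEqFun.coeFn_mk f hf

theorem Fn.aesm (u : Fn) : AEStronglyMeasurable u volume := AEEqFun.aestronglyMeasurable u

theorem Fn.ext {u v : Fn} (h : (u : ℝ → ℂ) =ᵐ[volume] v) : u = v := AEEqFun.ext h

theorem Fn.coeFn_add (u v : Fn) : ((u + v : Fn) : ℝ → ℂ) =ᵐ[volume] fun x => u x + v x :=
  AEEqFun.coeFn_add (γ := ℂ) u v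

theorem Fn.coeFn_smul (a : ℂ) (u : Fn) :
    ((a • u : Fn) : ℝ → ℂ) =ᵐ[volume] fun x => a • u x :=
  AEEqFun.coeFn_smul (γ := ℂ) a u

theorem Fn.coeFn_zero : ((0 : Fn) : ℝ → ℂ) =ᵐ[volume] fun _ => 0 :=
  AEEqFun.coeFn_zero (α := ℝ) (β := ℂ) (μ := volume)

/-- `‖u‖_{L²_ul} = sup_ξ ‖u‖_{L²([ξ,ξ+1])}`, with values in `[0,∞]`. -/
def ulNorm (u : ℝ → ℂ) : ℝ≥0∞ :=
  ⨆ ξ : ℝ, eLpNorm u 2 (volume.restrict (Set.Icc ξ (ξ + 1)))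

theorem ulNorm_congr {u v : ℝ → ℂ} (h : u =ᵐ[volume] v) : ulNorm u = ulNorm v :=
  iSup_congr fun _ => eLpNorm_congr_ae (ae_restrict_of_ae h)

theorem ulNorm_add_le {u v : ℝ → ℂ} (hu : AEStronglyMeasurable u volume)
    (hv : AEStronglyMeasurable v volume) :
    ulNorm (fun x => u x + v x) ≤ ulNorm u + ulNorm v := by
  refine iSup_le fun ξ => ?_
  refine (eLpNorm_add_le hu.restrict hv.restrict (by norm_num)).trans ?_
  exact add_le_add (le_iSup (fun ξ : ℝ => eLpNorm u 2 (volume.restrict (Set.Icc ξ (ξ + 1)))) ξ)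
    (le_iSup (fun ξ : ℝ => eLpNorm v 2 (volume.restrict (Set.Icc ξ (ξ + 1)))) ξ)

theorem ulNorm_mul_le {g : ℝ → ℝ} {C : ℝ} (hg : ∀ x, |g x| ≤ C) (u : ℝ → ℂ) :
    ulNorm (fun x => (g x : ℂ) * u x) ≤ ENNReal.ofReal C * ulNorm u := by
  refine iSup_le fun ξ => ?_
  refine (eLpNorm_le_mul_eLpNorm_of_ae_le_mul (c := C) (g := u) ?_ 2).trans ?_
  · refine Eventually.of_forall fun x => ?_
    rw [norm_mul, Complex.norm_real, Real.norm_eq_abs]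
    exact mul_le_mul_of_nonneg_right (hg x) (norm_nonneg _)
  · exact mul_le_mul_right
      (le_iSup (fun ξ : ℝ => eLpNorm u 2 (volume.restrict (Set.Icc ξ (ξ + 1)))) ξ) _

theorem ulNorm_const_smul (a : ℂ) (u : ℝ → ℂ) :
    ulNorm (fun x => a • u x) = ‖a‖ₑ * ulNorm u := by
  unfold ulNorm
  rw [ENNReal.mul_iSup]
  exact iSup_congr fun ξ => eLpNorm_const_smul a u 2 _

theorem ae_translate {u v : ℝ → ℂ} (h : u =ᵐ[volume] v) (ξ : ℝ) :
    (fun x => u (x - ξ)) =ᵐ[volume] (fun x => v (x - ξ)) :=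
  (measurePreserving_sub_right volume ξ).quasiMeasurePreserving.ae_eq_comp h

theorem aesm_translate {u : ℝ → ℂ} (h : AEStronglyMeasurable u volume) (ξ : ℝ) :
    AEStronglyMeasurable (fun x => u (x - ξ)) volume :=
  h.comp_quasiMeasurePreserving
    (measurePreserving_sub_right volume ξ).quasiMeasurePreserving

/-- Membership in `L²_ul`: finite norm and continuity of translations. (A measurable function
of finite norm is automatically in `L²_loc`.) -/
def MemL2ul (u : ℝ → ℂ) : Prop :=
  ulNorm u < ⊤ ∧ Tendsto (fun ξ : ℝ => ulNorm (fun x => u (x - ξ) - u x)) (𝓝 0) (𝓝 0)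

theorem MemL2ul.congr {u v : ℝ → ℂ} (hu : MemL2ul u) (h : u =ᵐ[volume] v) : MemL2ul v := by
  refine ⟨ulNorm_congr h ▸ hu.1, hu.2.congr fun ξ => ulNorm_congr ?_⟩
  filter_upwards [h, ae_translate h ξ] with x h1 h2
  rw [h1, h2]

theorem MemL2ul.add {u v : ℝ → ℂ} (hu : MemL2ul u) (hv : MemL2ul v)
    (hum : AEStronglyMeasurable u volume) (hvm : AEStronglyMeasurable v volume) :
    MemL2ul (fun x => u x + v x) := by
  refine ⟨(ulNorm_add_le hum hvm).trans_lt (ENNReal.add_lt_top.2 ⟨hu.1, hv.1⟩), ?_⟩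
  refine tendsto_of_tendsto_of_tendsto_of_le_of_le tendsto_const_nhds
    (by simpa using hu.2.add hv.2) (fun _ => zero_le) fun ξ => ?_
  refine le_trans (le_of_eq ?_) (ulNorm_add_le ((aesm_translate hum ξ).sub hum)
    ((aesm_translate hvm ξ).sub hvm))
  congr 1
  funext x
  simp only
  ring

theorem MemL2ul.const_smul {u : ℝ → ℂ} (hu : MemL2ul u) (a : ℂ) :
    MemL2ul (fun x => a • u x) := by
  refine ⟨by rw [ulNorm_const_smul]; exact ENNReal.mul_lt_top (by simp) hu.1, ?_⟩
  have : Tendsto (fun ξ : ℝ => ‖a‖ₑ * ulNorm (fun x => u (x - ξ) - u x)) (𝓝 0) (𝓝 0) := by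
    simpa using ENNReal.Tendsto.const_mul hu.2 (Or.inr (by simp : ‖a‖ₑ ≠ ⊤))
  refine this.congr fun ξ => ?_
  rw [← ulNorm_const_smul]
  congr 1
  funext x
  rw [smul_sub]

theorem MemL2ul.mul {u : ℝ → ℂ} (hu : MemL2ul u) (hum : AEStronglyMeasurable u volume)
    {g : ℝ → ℝ} (hg : IsBUC g) : MemL2ul (fun x => (g x : ℂ) * u x) := by
  obtain ⟨C, hC⟩ := hg.bounded
  refine ⟨(ulNorm_mul_le hC u).trans_lt (ENNReal.mul_lt_top (by simp) hu.1), ?_⟩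
  have hgm : AEStronglyMeasurable (fun x => (g x : ℂ)) volume :=
    (Complex.continuous_ofReal.comp hg.uniformContinuous.continuous).aestronglyMeasurable
  have key : ∀ ε : ℝ, 0 < ε → ∀ᶠ ξ : ℝ in 𝓝 0,
      ulNorm (fun x => (g (x - ξ) : ℂ) * u (x - ξ) - (g x : ℂ) * u x) ≤
        ENNReal.ofReal C * ulNorm (fun x => u (x - ξ) - u x) + ENNReal.ofReal ε * ulNorm u := by
    intro ε hε
    obtain ⟨δ, hδ, hgδ⟩ := Metric.uniformContinuous_iff.1 hg.uniformContinuous ε hε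
    filter_upwards [Metric.ball_mem_nhds (0 : ℝ) hδ] with ξ hξ
    have hsmall : ∀ x, |g (x - ξ) - g x| ≤ ε := by
      intro x
      have : dist (x - ξ) x < δ := by
        rw [Real.dist_eq]; simpa [Real.dist_eq] using hξ
      exact (Real.dist_eq _ _ ▸ hgδ this).le
    have e : (fun x => (g (x - ξ) : ℂ) * u (x - ξ) - (g x : ℂ) * u x) =
        fun x => (g (x - ξ) : ℂ) * (u (x - ξ) - u x) + ((g (x - ξ) - g x : ℝ) : ℂ) * u x := by
      funext x; push_cast; ring
    rw [e]
    have hgt := aesm_translate hgm ξ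
    refine (ulNorm_add_le (hgt.mul ((aesm_translate hum ξ).sub hum)) ?_).trans ?_
    · refine AEStronglyMeasurable.congr ((hgt.sub hgm).mul hum) (Eventually.of_forall fun x => ?_)
      simp
    · exact add_le_add (ulNorm_mul_le (fun x => hC (x - ξ)) _) (ulNorm_mul_le hsmall u)
  have hlim : Tendsto (fun ξ : ℝ => ENNReal.ofReal C * ulNorm (fun x => u (x - ξ) - u x))
      (𝓝 0) (𝓝 0) := by
    simpa using ENNReal.Tendsto.const_mul hu.2 (Or.inr (by simp : ENNReal.ofReal C ≠ ⊤))
  rw [ENNReal.tendsto_nhds_zero]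
  intro η hη
  by_cases hηt : η = ⊤
  · exact Eventually.of_forall fun _ => hηt ▸ le_top
  have hη2 : 0 < η / 2 := ENNReal.half_pos hη.ne'
  obtain ⟨ε, hε, hεη⟩ : ∃ ε : ℝ, 0 < ε ∧ ENNReal.ofReal ε * ulNorm u ≤ η / 2 := by
    have hpos : 0 < (η / 2).toReal := ENNReal.toReal_pos hη2.ne' (by
      exact (ENNReal.div_lt_top hηt (by norm_num)).ne)
    refine ⟨(η / 2).toReal / ((ulNorm u).toReal + 1), by positivity, ?_⟩
    rw [← ENNReal.ofReal_toReal hu.1.ne, ← ENNReal.ofReal_mul (by positivity),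
      ENNReal.toReal_ofReal ENNReal.toReal_nonneg]
    refine (ENNReal.ofReal_le_ofReal (?_ : _ ≤ (η / 2).toReal)).trans ENNReal.ofReal_toReal_le
    rw [div_mul_eq_mul_div, div_le_iff₀ (by positivity)]
    nlinarith [ENNReal.toReal_nonneg (a := ulNorm u)]
  filter_upwards [key ε hε, (ENNReal.tendsto_nhds_zero.1 hlim) (η / 2) hη2] with ξ h1 h2
  exact h1.trans ((add_le_add h2 hεη).trans (ENNReal.add_halves η).le)

/-- The uniformly local Lebesgue space `L²_ul(ℝ)` (classes modulo a.e. equality). -/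
def L2ul : Submodule ℂ Fn where
  carrier := {u | MemL2ul u}
  add_mem' {u v} hu hv :=
    (MemL2ul.add hu hv u.aesm v.aesm).congr
      (Fn.coeFn_add u v).symm
  zero_mem' := by
    have h0 : MemL2ul (fun _ => 0) := by
      have : ulNorm (fun _ => 0) = 0 := by simp [ulNorm]
      exact ⟨by simp [this], by simp [this]⟩
    exact h0.congr Fn.coeFn_zero.symm
  smul_mem' a u hu := (MemL2ul.const_smul hu a).congr (Fn.coeFn_smul a u).symm

theorem locallyIntegrable_of_mem {u : Fn} (hu : u ∈ L2ul) :
    LocallyIntegrable u volume := by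
  intro x
  refine ⟨Set.Icc (x - 1 / 2) (x - 1 / 2 + 1), Icc_mem_nhds (by linarith) (by linarith), ?_⟩
  have h1 : MemLp u 2 (volume.restrict (Set.Icc (x - 1 / 2) (x - 1 / 2 + 1))) :=
    ⟨u.aesm.restrict, lt_of_le_of_lt
      (le_iSup (fun ξ : ℝ => eLpNorm u 2 (volume.restrict (Set.Icc ξ (ξ + 1)))) (x - 1 / 2))
      hu.1⟩
  exact h1.integrable (by norm_num)

/-- `v` is the weak derivative of `u`: `∫ φ' u = - ∫ φ v` for all test functions `φ`. It is only
used for locally integrable `u` and `v`. -/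
def HasWeakDeriv (u v : Fn) : Prop :=
  ∀ φ : ℝ → ℝ, ContDiff ℝ ∞ φ → HasCompactSupport φ →
    ∫ x, deriv φ x • u x = - ∫ x, φ x • v x

theorem integrable_test {u : Fn} (hu : u ∈ L2ul) {φ : ℝ → ℝ}
    (hφ : Continuous φ) (hφc : HasCompactSupport φ) :
    Integrable (fun x => φ x • u x) volume :=
  (locallyIntegrable_of_mem hu).integrable_smul_left_of_hasCompactSupport hφ hφc

theorem HasWeakDeriv.add {u v u' v' : Fn} (hu : u ∈ L2ul) (hv : v ∈ L2ul)
    (hu' : u' ∈ L2ul) (hv' : v' ∈ L2ul) (h1 : HasWeakDeriv u u') (h2 : HasWeakDeriv v v') :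
    HasWeakDeriv (u + v) (u' + v') := by
  intro φ hφ hφc
  have hd : Continuous (deriv φ) := hφ.continuous_deriv (by simp)
  have e1 : ∫ x, deriv φ x • (u + v : Fn) x =
      ∫ x, (deriv φ x • u x + deriv φ x • v x) := by
    refine integral_congr_ae ?_
    filter_upwards [Fn.coeFn_add u v] with x hx
    rw [hx, smul_add]
  have e2 : ∫ x, φ x • (u' + v' : Fn) x =
      ∫ x, (φ x • u' x + φ x • v' x) := by
    refine integral_congr_ae ?_
    filter_upwards [Fn.coeFn_add u' v'] with x hx
    rw [hx, smul_add]
  rw [e1, e2, integral_add (integrable_test hu hd hφc.deriv) (integrable_test hv hd hφc.deriv),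
    integral_add (integrable_test hu' hφ.continuous hφc) (integrable_test hv' hφ.continuous hφc),
    h1 φ hφ hφc, h2 φ hφ hφc]
  ring

theorem HasWeakDeriv.smul {u u' : Fn} (a : ℂ) (h : HasWeakDeriv u u') :
    HasWeakDeriv (a • u) (a • u') := by
  intro φ hφ hφc
  have e : ∀ (ψ : ℝ → ℝ) (w : Fn),
      ∫ x, ψ x • (a • w : Fn) x = a • ∫ x, ψ x • w x := by
    intro ψ w
    rw [← integral_smul]
    refine integral_congr_ae ?_
    filter_upwards [Fn.coeFn_smul a w] with x hx
    rw [hx, smul_comm]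
  rw [e, e, h φ hφ hφc, smul_neg]

theorem HasWeakDeriv.unique {u v w : Fn} (hv : v ∈ L2ul) (hw : w ∈ L2ul)
    (h1 : HasWeakDeriv u v) (h2 : HasWeakDeriv u w) : v = w := by
  refine Fn.ext ?_
  refine ae_eq_of_integral_contDiff_smul_eq (locallyIntegrable_of_mem hv)
    (locallyIntegrable_of_mem hw) fun φ hφ hφc => ?_
  exact neg_injective ((h1 φ hφ hφc).symm.trans (h2 φ hφ hφc))

/-- The space `H^k_ul(ℝ)`: all (weak) derivatives of order at most `k` belong to `L²_ul`.
A function is in `H^{k+1}_ul` iff it is in `L²_ul` and its weak derivative is in `H^k_ul`. -/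
def HulAux : ℕ → {S : Submodule ℂ Fn // S ≤ L2ul}
  | 0 => ⟨L2ul, le_rfl⟩
  | k + 1 =>
    ⟨{ carrier := {u | u ∈ L2ul ∧ ∃ v ∈ (HulAux k).1, HasWeakDeriv u v}
       add_mem' := by
         rintro u v ⟨hu, u', hu', h1⟩ ⟨hv, v', hv', h2⟩
         exact ⟨L2ul.add_mem hu hv, u' + v', (HulAux k).1.add_mem hu' hv',
           h1.add hu hv ((HulAux k).2 hu') ((HulAux k).2 hv') h2⟩
       zero_mem' := by
         refine ⟨L2ul.zero_mem, 0, (HulAux k).1.zero_mem, fun φ _ _ => ?_⟩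
         have e : ∀ ψ : ℝ → ℝ, ∫ x, ψ x • (0 : Fn) x = 0 := by
           intro ψ
           rw [← integral_zero ℝ ℂ (μ := volume)]
           refine integral_congr_ae ?_
           filter_upwards [Fn.coeFn_zero] with x hx
           rw [hx]; simp
         rw [e, e, neg_zero]
       smul_mem' := by
         rintro a u ⟨hu, u', hu', h1⟩
         exact ⟨L2ul.smul_mem a hu, a • u', (HulAux k).1.smul_mem a hu', h1.smul a⟩ },
      fun _ hu => hu.1⟩

/-- The uniformly local Sobolev space `H^k_ul(ℝ)`; `H^0_ul = L²_ul`. -/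
def Hul (k : ℕ) : Submodule ℂ Fn := (HulAux k).1

theorem Hul_zero : Hul 0 = L2ul := rfl

theorem Hul_le (k : ℕ) : Hul k ≤ L2ul := (HulAux k).2

theorem mem_Hul_succ {k : ℕ} {u : Fn} :
    u ∈ Hul (k + 1) ↔ u ∈ L2ul ∧ ∃ v ∈ Hul k, HasWeakDeriv u v := Iff.rfl

theorem Hul_succ_le (k : ℕ) : Hul (k + 1) ≤ Hul k := by
  induction k with
  | zero => exact fun _ hu => hu.1
  | succ k ih =>
    rintro u ⟨hu, v, hv, h⟩
    exact ⟨hu, v, ih hv, h⟩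

/-- The weak derivative `∂ : H^{k+1}_ul → H^k_ul`. -/
def wderiv (k : ℕ) : Hul (k + 1) →ₗ[ℂ] Hul k where
  toFun u := ⟨u.2.2.choose, u.2.2.choose_spec.1⟩
  map_add' u v := by
    refine Subtype.ext (HasWeakDeriv.unique (u := (u + v : Hul (k + 1)).1)
      (Hul_le k (u + v).2.2.choose_spec.1) (L2ul.add_mem (Hul_le k u.2.2.choose_spec.1)
        (Hul_le k v.2.2.choose_spec.1)) (u + v).2.2.choose_spec.2 ?_)
    exact HasWeakDeriv.add u.2.1 v.2.1 (Hul_le k u.2.2.choose_spec.1)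
      (Hul_le k v.2.2.choose_spec.1) u.2.2.choose_spec.2 v.2.2.choose_spec.2
  map_smul' a u := by
    refine Subtype.ext (HasWeakDeriv.unique (u := (a • u : Hul (k + 1)).1)
      (Hul_le k (a • u).2.2.choose_spec.1) (L2ul.smul_mem a (Hul_le k u.2.2.choose_spec.1))
      (a • u).2.2.choose_spec.2 ?_)
    exact HasWeakDeriv.smul a u.2.2.choose_spec.2

theorem wderiv_spec (k : ℕ) (u : Hul (k + 1)) :
    HasWeakDeriv (u : Fn) (wderiv k u : Fn) :=
  u.2.2.choose_spec.2

theorem IsBUC.aesm {g : ℝ → ℝ} (hg : IsBUC g) (u : Fn) :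
    AEStronglyMeasurable (fun x => (g x : ℂ) * u x) volume :=
  (Complex.continuous_ofReal.comp hg.uniformContinuous.continuous).aestronglyMeasurable.mul u.aesm

/-- Multiplication by a bounded uniformly continuous real coefficient on `L²_ul = H^0_ul`. -/
def mulCoeff (g : ℝ → ℝ) (hg : IsBUC g) : Hul 0 →ₗ[ℂ] Hul 0 where
  toFun u := ⟨Fn.mk (fun x => (g x : ℂ) * (u : Fn) x) (hg.aesm u),
    (MemL2ul.mul u.2 u.1.aesm hg).congr (Fn.coeFn_mk _ (hg.aesm u)).symm⟩
  map_add' u v := by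
    refine Subtype.ext (Fn.ext ?_)
    refine (Fn.coeFn_mk _ (hg.aesm _)).trans (EventuallyEq.trans ?_ (Fn.coeFn_add _ _).symm)
    filter_upwards [Fn.coeFn_add u.1 v.1, Fn.coeFn_mk _ (hg.aesm u.1),
      Fn.coeFn_mk _ (hg.aesm v.1)] with x h1 h2 h3
    rw [h2, h3, ← mul_add, ← h1]
    rfl
  map_smul' a u := by
    refine Subtype.ext (Fn.ext ?_)
    refine (Fn.coeFn_mk _ (hg.aesm _)).trans (EventuallyEq.trans ?_ (Fn.coeFn_smul _ _).symm)
    filter_upwards [Fn.coeFn_smul a u.1, Fn.coeFn_mk _ (hg.aesm u.1)] with x h1 h2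
    rw [h2, RingHom.id_apply, smul_eq_mul, mul_left_comm, ← smul_eq_mul a, ← h1]
    rfl

/-! ### The energy space and the linearized generator -/

/-- `X = H^1_ul(ℝ) × L²_ul(ℝ)`, with complex scalars. -/
abbrev EnergySpace : Type := Hul 1 × Hul 0

/-- The norm of `X`, with values in `[0,∞]` (it is finite):
`‖(u,v)‖_X² = ‖u‖_{H^1_ul}² + ‖v‖_{L²_ul}²`,  `‖u‖_{H^1_ul}² = ‖u‖_{L²_ul}² + ‖u'‖_{L²_ul}²`. -/
def energyNorm (w : EnergySpace) : ℝ≥0∞ :=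
  (ulNorm (w.1 : Fn) ^ 2 + ulNorm (wderiv 0 w.1 : Fn) ^ 2 +
    ulNorm (w.2 : Fn) ^ 2) ^ (1 / 2 : ℝ)

/-- `Y = H^2_ul(ℝ) × H^1_ul(ℝ)` as a subspace of `X`. -/
def domainY : Submodule ℂ EnergySpace :=
  ((Hul 2).comap (Hul 1).subtype).prod ((Hul 1).comap (Hul 0).subtype)

/-- First component of an element of `Y`, as an element of `H^2_ul`. -/
def fstY : domainY →ₗ[ℂ] Hul 2 where
  toFun w := ⟨(w.1.1 : Fn), w.2.1⟩
  map_add' _ _ := rfl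
  map_smul' _ _ := rfl

/-- Second component of an element of `Y`, as an element of `H^1_ul`. -/
def sndY : domainY →ₗ[ℂ] Hul 1 where
  toFun w := ⟨(w.1.2 : Fn), w.2.2⟩
  map_add' _ _ := rfl
  map_smul' _ _ := rfl

/-- The inclusion `H^{k+1}_ul ⊆ H^k_ul`. -/
def incl (k : ℕ) : Hul (k + 1) →ₗ[ℂ] Hul k := Submodule.inclusion (Hul_succ_le k)

/-- The unbounded operator on `X` with domain `Y` given by
`(u, v) ↦ (v, α⁻¹ (u'' + c u' - g u - v + 2 α c v'))`. -/
def generator (α c : ℝ) (g : ℝ → ℝ) (hg : IsBUC g) : EnergySpace →ₗ.[ℂ] EnergySpace where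
  domain := domainY
  toFun := LinearMap.prod sndY
    (((α : ℂ)⁻¹) •
      ((wderiv 0 ∘ₗ wderiv 1 ∘ₗ fstY) + (c : ℂ) • (incl 0 ∘ₗ wderiv 1 ∘ₗ fstY)
        - (mulCoeff g hg ∘ₗ incl 0 ∘ₗ incl 1 ∘ₗ fstY)
        - (incl 0 ∘ₗ sndY) + (2 * (α : ℂ) * (c : ℂ)) • (wderiv 0 ∘ₗ sndY)))

/-- The map `A - z`, from the domain of `A` to `X`. -/
def shift (A : EnergySpace →ₗ.[ℂ] EnergySpace) (z : ℂ) : A.domain →ₗ[ℂ] EnergySpace :=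
  A.toFun - z • A.domain.subtype

/-- The resolvent set: `A - z` is a bijection from the domain of `A` onto `X` whose inverse is
bounded in `X`. -/
def opResolventSet (A : EnergySpace →ₗ.[ℂ] EnergySpace) : Set ℂ :=
  {z | Function.Bijective (shift A z) ∧
    ∃ C : ℝ≥0, ∀ w : A.domain, energyNorm (w : EnergySpace) ≤ C * energyNorm (shift A z w)}

/-- The spectrum of an unbounded operator on `X`. -/
def opSpectrum (A : EnergySpace →ₗ.[ℂ] EnergySpace) : Set ℂ := (opResolventSet A)ᶜ

/-- The eigenspace `ker (A - z)`, as a subspace of `X`. -/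
def eigenspace (A : EnergySpace →ₗ.[ℂ] EnergySpace) (z : ℂ) : Submodule ℂ EnergySpace :=
  (LinearMap.ker (shift A z)).map A.domain.subtype

/-- `z` is an (algebraically) simple eigenvalue: `ker (A - z)` is one-dimensional and
`X = ker (A - z) ⊕ range (A - z)`. For a closed operator on a Banach space this says exactly that
`z` is an isolated point of the spectrum whose spectral projection has rank one. -/
def IsSimpleEigenvalue (A : EnergySpace →ₗ.[ℂ] EnergySpace) (z : ℂ) : Prop :=
  Module.finrank ℂ (eigenspace A z) = 1 ∧
    IsCompl (eigenspace A z) (LinearMap.range (shift A z))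

end

end DampedWave

/-! The resolvent equation (A − z)(u, v) = f forces v = z u + f₁ and leaves one scalar equation u''
+ 2βu' − (g + q)u = F, where β = c(1 + 2αz)/2 and q = z + αz² (`shift_eq_iff`). The substitution w =
e^{βy}u removes the drift and gives w'' = P w + e^{βy}F with P = g + q + β², and q + β² = (1 +
αc²)(1 + 2αz)²/(4α) − 1/(4α). Bounded u correspond to w of size at most e^{by}, b = Re β. If Re z >
μ_α, then b > 0 and the limits of P at ±∞ are squares κ² with Re κ > b (`exists_sqrt_re_gt`). Since
g converges exponentially, the homogeneous equation has solutions asymptotic to pure exponentials at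
each end (`exists_jost`). Therefore a homogeneous solution of size e^{by} must decay at both ends,
and stays decaying after multiplication by e^{by}. Such a nonzero solution is called a bound state.

The spectral question is thereby reduced to the existence of bound states. If there is none, the
solutions decaying at −∞ and at +∞ are independent, and variation of constants bounds the inverse
(`Dichotomy.exists_forcedSol`, `mem_opResolventSet`). The forcing lies only in L²_ul, but
subtracting moving averages writes it as u'' plus a bounded continuous function
(`exists_regularization`), so that all estimates can be made in the sup norm. If there is a bound
state, it is unique up to a factor, and the symmetry of the Schrödinger operator forces the constant
Im P = (1 + αc²)(1 + 2α Re z) Im z to vanish, so z is real. The equation is then solvable exactly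
for forcings orthogonal to the bound state r. The forcing produced by the eigenvector itself pairs
with r to (1 + 2αz)(1 + αc²)∫r² ≠ 0, so the eigenvector is not in the range and spans a complement
of it (`isSimpleEigenvalue_of_boundState`).

It remains to study real bound states of r'' = (g + e)r, where e increases strictly with z to the
right of μ_α. Translation invariance gives the state e^{cy/2}h' at z = 0. Since h' < 0, its
logarithmic derivative is a bounded solution of a Riccati equation, which excludes states with z > 0
(`not_realState_of_riccati`). Only finitely many states exist because the quadratic form is
nonnegative on functions vanishing at enough points (`exists_forall_not_realStates`). Finally the
speed is unique and the front is unique up to translation (`IsFront.exists_translate`), and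
translating the front translates the bound states, so the eigenvalues depend only on α and V. -/

namespace DampedWave

noncomputable section

/-! ### A weighted contraction principle -/

/-- Contraction mapping principle in the space of continuous functions bounded by a multiple of a
weight `ρ`. -/
theorem exists_fixedPoint_of_weight {E : Type*} [NormedAddCommGroup E] [NormedSpace ℝ E]
    [CompleteSpace E] {ρ : ℝ → ℝ} (hρ : Continuous ρ) (hρ0 : ∀ y, 0 < ρ y)
    (T : (ℝ → E) → ℝ → E)
    (hcont : ∀ n, Continuous n → (∃ C, ∀ y, ‖n y‖ ≤ C * ρ y) → Continuous (T n))
    (h0 : ∃ C, ∀ y, ‖T 0 y‖ ≤ C * ρ y)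
    (hcontr : ∀ n m, Continuous n → (∃ C, ∀ y, ‖n y‖ ≤ C * ρ y) → Continuous m →
      (∃ C, ∀ y, ‖m y‖ ≤ C * ρ y) → ∀ D, (∀ y, ‖n y - m y‖ ≤ D * ρ y) →
      ∀ y, ‖T n y - T m y‖ ≤ D / 2 * ρ y) :
    ∃ n, Continuous n ∧ (∃ C, ∀ y, ‖n y‖ ≤ C * ρ y) ∧ T n = n := by
  have ex : ∀ f : BoundedContinuousFunction ℝ E, Continuous (fun y => ρ y • f y) ∧
      ∃ C, ∀ y, ‖ρ y • f y‖ ≤ C * ρ y := by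
    intro f
    refine ⟨hρ.smul f.continuous, ‖f‖, fun y => ?_⟩
    rw [norm_smul, Real.norm_of_nonneg (hρ0 y).le, mul_comm]
    exact mul_le_mul_of_nonneg_right (f.norm_coe_le_norm y) (hρ0 y).le
  have bd : ∀ n, Continuous n → (∃ C, ∀ y, ‖n y‖ ≤ C * ρ y) →
      ∃ C, ∀ y, ‖T n y‖ ≤ C * ρ y := by
    rintro n hn ⟨C, hC⟩
    obtain ⟨C0, hC0⟩ := h0
    refine ⟨C / 2 + C0, fun y => ?_⟩
    have h1 := hcontr n 0 hn ⟨C, hC⟩ continuous_const ⟨0, by simp⟩ C (by simpa using hC) y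
    have h2 := norm_add_le (T n y - T 0 y) (T 0 y)
    rw [sub_add_cancel] at h2
    linarith [hC0 y]
  -- Conjugating `T` by multiplication with `ρ` turns the weighted sup norm into the ordinary one,
  -- so Banach's theorem applies with factor 1/2.
  let S : BoundedContinuousFunction ℝ E → BoundedContinuousFunction ℝ E := fun f =>
    BoundedContinuousFunction.ofNormedAddCommGroup (fun y => (ρ y)⁻¹ • T (fun y => ρ y • f y) y)
      ((hρ.inv₀ fun y => (hρ0 y).ne').smul (hcont _ (ex f).1 (ex f).2))
      (bd _ (ex f).1 (ex f).2).choose (fun y => by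
        have := (bd _ (ex f).1 (ex f).2).choose_spec y
        rw [norm_smul, norm_inv, Real.norm_of_nonneg (hρ0 y).le, inv_mul_le_iff₀ (hρ0 y),
          mul_comm]
        exact this)
  have hS : ∀ f y, S f y = (ρ y)⁻¹ • T (fun y => ρ y • f y) y := fun f y => rfl
  have hSc : ContractingWith (1 / 2 : ℝ≥0) S := by
    refine ⟨by rw [div_lt_one] <;> norm_num, LipschitzWith.of_dist_le_mul fun f g => ?_⟩
    rw [BoundedContinuousFunction.dist_le (by positivity)]
    intro y
    have := hcontr _ _ (ex f).1 (ex f).2 (ex g).1 (ex g).2 (dist f g) (fun y => by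
      rw [← smul_sub, norm_smul, Real.norm_of_nonneg (hρ0 y).le, mul_comm, ← dist_eq_norm]
      exact mul_le_mul_of_nonneg_right (BoundedContinuousFunction.dist_coe_le_dist y)
        (hρ0 y).le) y
    rw [hS, hS, dist_eq_norm, ← smul_sub, norm_smul, norm_inv, Real.norm_of_nonneg (hρ0 y).le,
      inv_mul_le_iff₀ (hρ0 y)]
    refine this.trans (le_of_eq ?_)
    push_cast
    ring
  have hfix : S (hSc.fixedPoint S) = hSc.fixedPoint S := hSc.fixedPoint_isFixedPt
  set f := hSc.fixedPoint S
  refine ⟨fun y => ρ y • f y, (ex f).1, (ex f).2, ?_⟩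
  funext y
  have := hS f y
  rw [hfix] at this
  rw [this, smul_smul, mul_inv_cancel₀ (hρ0 y).ne', one_smul]

/-! ### Tail integrals -/

theorem integrableOn_Ioi_of_continuous {E : Type*} [NormedAddCommGroup E] {f : ℝ → E}
    (hf : Continuous f) {a : ℝ} (h : IntegrableOn f (Set.Ioi a)) (y : ℝ) :
    IntegrableOn f (Set.Ioi y) := by
  have h1 : IntegrableOn f (Set.Icc y a) := hf.integrableOn_Icc
  refine (h1.union h).mono_set fun x hx => ?_
  rcases le_or_gt x a with hxa | hxa
  · exact Or.inl ⟨le_of_lt hx, hxa⟩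
  · exact Or.inr hxa

theorem hasDerivAt_tail {E : Type*} [NormedAddCommGroup E] [NormedSpace ℝ E] [CompleteSpace E]
    {f : ℝ → E} (hf : Continuous f) (h : ∀ y, IntegrableOn f (Set.Ioi y)) (y : ℝ) :
    HasDerivAt (fun y => ∫ t in Set.Ioi y, f t) (-f y) y := by
  have e : (fun y => ∫ t in Set.Ioi y, f t) =
      fun y => (∫ t in Set.Ioi (0:ℝ), f t) - ∫ t in (0:ℝ)..y, f t := by
    funext y
    rw [eq_sub_iff_add_eq, add_comm]
    exact intervalIntegral.integral_interval_add_Ioi (h 0) (h y)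
  rw [e]
  exact (hf.integral_hasStrictDerivAt 0 y).hasDerivAt.const_sub _

theorem tendsto_tail {E : Type*} [NormedAddCommGroup E] [NormedSpace ℝ E] [CompleteSpace E]
    {f : ℝ → E} (h : IntegrableOn f (Set.Ioi 0)) :
    Tendsto (fun y => ∫ t in Set.Ioi y, f t) atTop (𝓝 0) := by
  have h1 := intervalIntegral_tendsto_integral_Ioi 0 h tendsto_id
  have h2 := (tendsto_const_nhds (x := ∫ t in Set.Ioi (0:ℝ), f t)).sub h1
  rw [sub_self] at h2
  refine h2.congr' ?_
  filter_upwards [eventually_ge_atTop (0:ℝ)] with y hy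
  rw [sub_eq_iff_eq_add, add_comm]
  exact (intervalIntegral.integral_interval_add_Ioi h
    (h.mono_set (Set.Ioi_subset_Ioi hy))).symm

/-! ### Second order linear equations -/

/-- `w` is a classical solution of `w'' = P w + f`, with derivative `w'`. -/
structure ForcedSol (P f w w' : ℝ → ℂ) : Prop where
  deriv_fst : ∀ y, HasDerivAt w (w' y) y
  deriv_snd : ∀ y, HasDerivAt w' (P y * w y + f y) y

/-- `w` is a classical solution of `w'' = P w`, with derivative `w'`. -/
structure Sol (P w w' : ℝ → ℂ) : Prop where
  deriv_fst : ∀ y, HasDerivAt w (w' y) y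
  deriv_snd : ∀ y, HasDerivAt w' (P y * w y) y

theorem Sol.continuous {P w w' : ℝ → ℂ} (h : Sol P w w') : Continuous w :=
  continuous_iff_continuousAt.2 fun y => (h.deriv_fst y).continuousAt

theorem Sol.continuous' {P w w' : ℝ → ℂ} (h : Sol P w w') : Continuous w' :=
  continuous_iff_continuousAt.2 fun y => (h.deriv_snd y).continuousAt

/-- The equation has no first-order term, so it is invariant under y ↦ −y; every result at +∞ gives
one at −∞. -/
theorem Sol.reflect {P w w' : ℝ → ℂ} (h : Sol P w w') :
    Sol (fun y => P (-y)) (fun y => w (-y)) (fun y => -w' (-y)) := by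
  refine ⟨fun y => ?_, fun y => ?_⟩
  · exact (HasDerivAt.scomp (h := fun y => -y) y (h.deriv_fst (-y)) (hasDerivAt_neg y)).congr_deriv
      (by simp)
  · exact (HasDerivAt.scomp (h := fun y => -y) y (h.deriv_snd (-y))
      (hasDerivAt_neg y)).fun_neg.congr_deriv (by simp)

theorem eq_const_of_hasDerivAt_zero {E : Type*} [NormedAddCommGroup E] [NormedSpace ℝ E]
    {f : ℝ → E} (h : ∀ y, HasDerivAt f 0 y) (x y : ℝ) : f x = f y :=
  is_const_of_deriv_eq_zero (fun y => (h y).differentiableAt) (fun y => (h y).deriv) x y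

theorem Sol.wronskian {P v v' w w' : ℝ → ℂ} (hv : Sol P v v') (hw : Sol P w w') (x y : ℝ) :
    v x * w' x - v' x * w x = v y * w' y - v' y * w y := by
  refine eq_const_of_hasDerivAt_zero (f := fun y => v y * w' y - v' y * w y) (fun y => ?_) x y
  exact (((hv.deriv_fst y).fun_mul (hw.deriv_snd y)).fun_sub
    ((hv.deriv_snd y).fun_mul (hw.deriv_fst y))).congr_deriv (by ring)

/-- The Picard operator is a contraction on the whole line at once, provided growth is measured
against an exponential steeper than the Lipschitz constant. -/
theorem exists_linear_ivp {E : Type*} [NormedAddCommGroup E] [NormedSpace ℝ E]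
    [CompleteSpace E] {A : ℝ → E →L[ℝ] E} (hA : Continuous A) {K : ℝ} (hK : 0 < K)
    (hAK : ∀ t, ‖A t‖ ≤ K) (y₀ : ℝ) (x₀ : E) :
    ∃ U : ℝ → E, U y₀ = x₀ ∧ ∀ y, HasDerivAt U (A y (U y)) y := by
  -- The rate 2K is chosen because ∫ K D e^{2K|t − y₀|} dt between y₀ and y is at most (D/2) e^{2K|y
  -- − y₀|}.
  have hρc : Continuous (fun y : ℝ => Real.exp (2 * K * |y - y₀|)) := by fun_prop
  have key : ∃ U : ℝ → E, Continuous U ∧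
      (∃ C, ∀ y, ‖U y‖ ≤ C * Real.exp (2 * K * |y - y₀|)) ∧
      (fun y => x₀ + ∫ t in y₀..y, A t (U t)) = U := by
    refine exists_fixedPoint_of_weight hρc (fun y => Real.exp_pos _)
      (fun n y => x₀ + ∫ t in y₀..y, A t (n t)) ?_ ?_ ?_
    · intro n hn _
      have hc : Continuous (fun t => A t (n t)) := hA.clm_apply hn
      exact continuous_const.add (intervalIntegral.continuous_primitive (fun a b =>
        hc.intervalIntegrable a b) y₀)
    · refine ⟨‖x₀‖, fun y => ?_⟩
      simp only [Pi.zero_apply, map_zero, intervalIntegral.integral_zero, add_zero]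
      exact le_mul_of_one_le_right (norm_nonneg _) (Real.one_le_exp (by positivity))
    · intro n m hn _ hm _ D hD y
      have hcn : Continuous (fun t => A t (n t)) := hA.clm_apply hn
      have hcm : Continuous (fun t => A t (m t)) := hA.clm_apply hm
      have hD0 : 0 ≤ D := by
        have := (norm_nonneg _).trans (hD y₀)
        simpa using this
      rw [add_sub_add_left_eq_sub, ← intervalIntegral.integral_sub (hcn.intervalIntegrable _ _)
        (hcm.intervalIntegrable _ _)]
      have hb : ∀ t, ‖A t (n t) - A t (m t)‖ ≤ K * D * Real.exp (2 * K * |t - y₀|) := by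
        intro t
        rw [← map_sub]
        refine ((A t).le_opNorm _).trans ?_
        rw [mul_assoc]
        exact mul_le_mul (hAK t) (hD t) (norm_nonneg _) hK.le
      rcases le_total y₀ y with hy | hy
      · have h1 : ∫ t in y₀..y, K * D * Real.exp (2 * K * (t - y₀)) =
            D / 2 * Real.exp (2 * K * (y - y₀)) - D / 2 := by
          rw [intervalIntegral.integral_eq_sub_of_hasDerivAt
            (f := fun t => D / 2 * Real.exp (2 * K * (t - y₀))) (fun t _ => ?_)
            (by apply Continuous.intervalIntegrable; fun_prop)]
          · simp
          · exact ((((hasDerivAt_id' t).sub_const y₀).const_mul (2 * K)).exp.const_mul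
              (D / 2)).congr_deriv (by ring)
        refine (intervalIntegral.norm_integral_le_of_norm_le hy (g := fun t =>
          K * D * Real.exp (2 * K * (t - y₀))) ?_
          (by apply Continuous.intervalIntegrable; fun_prop)).trans ?_
        · refine Eventually.of_forall fun t ht => (hb t).trans (le_of_eq ?_)
          rw [abs_of_nonneg (by linarith [ht.1])]
        · rw [h1, abs_of_nonneg (by linarith)]
          linarith
      · have h1 : ∫ t in y..y₀, K * D * Real.exp (2 * K * (y₀ - t)) =
            D / 2 * Real.exp (2 * K * (y₀ - y)) - D / 2 := by
          rw [intervalIntegral.integral_eq_sub_of_hasDerivAt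
            (f := fun t => -(D / 2 * Real.exp (2 * K * (y₀ - t)))) (fun t _ => ?_)
            (by apply Continuous.intervalIntegrable; fun_prop)]
          · simp; ring
          · exact ((((hasDerivAt_id' t).const_sub y₀).const_mul (2 * K)).exp.const_mul
              (D / 2)).fun_neg.congr_deriv (by ring)
        rw [intervalIntegral.integral_symm, norm_neg]
        refine (intervalIntegral.norm_integral_le_of_norm_le hy (g := fun t =>
          K * D * Real.exp (2 * K * (y₀ - t))) ?_
          (by apply Continuous.intervalIntegrable; fun_prop)).trans ?_
        · refine Eventually.of_forall fun t ht => (hb t).trans (le_of_eq ?_)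
          rw [abs_of_nonpos (by linarith [ht.2]), neg_sub]
        · rw [h1, abs_of_nonpos (by linarith), neg_sub]
          linarith
  obtain ⟨U, hU, -, hfix⟩ := key
  have hc : Continuous (fun t => A t (U t)) := hA.clm_apply hU
  refine ⟨U, ?_, fun y => ?_⟩
  · rw [← hfix]; simp
  · have := (hc.integral_hasStrictDerivAt y₀ y).hasDerivAt.const_add x₀
    rwa [hfix] at this

theorem exists_sol_ivp {P : ℝ → ℂ} (hP : Continuous P) {C : ℝ} (hPC : ∀ y, ‖P y‖ ≤ C)
    (y₀ : ℝ) (a b : ℂ) : ∃ w w', Sol P w w' ∧ w y₀ = a ∧ w' y₀ = b := by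
  let A₀ : ℂ × ℂ →L[ℝ] ℂ × ℂ :=
    (ContinuousLinearMap.inl ℝ ℂ ℂ).comp (ContinuousLinearMap.snd ℝ ℂ ℂ)
  let A₁ : ℂ × ℂ →L[ℝ] ℂ × ℂ :=
    (ContinuousLinearMap.inr ℝ ℂ ℂ).comp (ContinuousLinearMap.fst ℝ ℂ ℂ)
  have hC : 0 ≤ C := (norm_nonneg _).trans (hPC 0)
  obtain ⟨U, hU0, hU⟩ := exists_linear_ivp (A := fun t => A₀ + P t • A₁)
    (continuous_const.add (hP.smul continuous_const)) (K := ‖A₀‖ + C * ‖A₁‖ + 1)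
    (by positivity) (fun t => by
      refine (norm_add_le _ _).trans ?_
      rw [norm_smul]
      have := mul_le_mul_of_nonneg_right (hPC t) (norm_nonneg A₁)
      linarith) y₀ (a, b)
  refine ⟨fun y => (U y).1, fun y => (U y).2, ⟨fun y => ?_, fun y => ?_⟩, by simp [hU0],
    by simp [hU0]⟩
  · have := (ContinuousLinearMap.fst ℝ ℂ ℂ).hasFDerivAt.comp_hasDerivAt y (hU y)
    exact this.congr_deriv (by simp [A₀, A₁])
  · have := (ContinuousLinearMap.snd ℝ ℂ ℂ).hasFDerivAt.comp_hasDerivAt y (hU y)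
    exact this.congr_deriv (by simp [A₀, A₁])

/-- Every solution that is not identically zero has a companion with Wronskian `1`. -/
theorem Sol.exists_companion {P : ℝ → ℂ} (hP : Continuous P) {C : ℝ} (hPC : ∀ y, ‖P y‖ ≤ C)
    {v v' : ℝ → ℂ} (hv : Sol P v v') {y₀ : ℝ} (h0 : v y₀ ≠ 0) :
    ∃ w w', Sol P w w' ∧ ∀ y, v y * w' y - v' y * w y = 1 := by
  obtain ⟨w, w', hw, h1, h2⟩ := exists_sol_ivp hP hPC y₀ 0 (v y₀)⁻¹
  refine ⟨w, w', hw, fun y => ?_⟩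
  rw [hv.wronskian hw y y₀, h1, h2, mul_zero, sub_zero, mul_inv_cancel₀ h0]

/-- Two solutions with vanishing Wronskian are proportional. -/
theorem Sol.eq_smul {P : ℝ → ℂ} (hP : Continuous P) {C : ℝ} (hPC : ∀ y, ‖P y‖ ≤ C)
    {v v' w w' : ℝ → ℂ} (hv : Sol P v v') (hw : Sol P w w') {y₀ : ℝ} (h0 : v y₀ ≠ 0)
    {x : ℝ} (hW : v x * w' x - v' x * w x = 0) :
    ∃ a : ℂ, ∀ y, w y = a * v y ∧ w' y = a * v' y := by
  obtain ⟨f, f', hf, hvf⟩ := hv.exists_companion hP hPC h0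
  have h0 : ∀ y, v y * w' y - v' y * w y = 0 := fun y => by rw [hv.wronskian hw y x, hW]
  refine ⟨w 0 * f' 0 - w' 0 * f 0, fun y => ?_⟩
  rw [hw.wronskian hf 0 y]
  constructor
  · linear_combination (-w y) * hvf y + f y * h0 y
  · linear_combination (-w' y) * hvf y + f' y * h0 y

theorem inner_mul_self_complex (c a : ℂ) : inner ℝ a (c * a) = c.re * ‖a‖ ^ 2 := by
  rw [← Complex.normSq_eq_norm_sq, Complex.normSq_apply, Complex.inner]
  simp
  ring

/-- Solutions of `w'' = (κ² + p) w` grow at most like `e^{Re κ y}` if `p` is integrable. -/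
theorem Sol.growth {κ : ℂ} (hκ : 0 < κ.re) {p : ℝ → ℂ} (hp : Continuous p)
    (hpi : IntegrableOn p (Set.Ioi 0)) {w w' : ℝ → ℂ} (h : Sol (fun y => κ ^ 2 + p y) w w') :
    ∃ C, ∀ y, 0 ≤ y → ‖w y‖ ≤ C * Real.exp (κ.re * y) ∧ ‖w' y‖ ≤ C * Real.exp (κ.re * y) := by
  have hκ0 : κ ≠ 0 := fun h => by simp [h] at hκ
  have hκn : 0 < ‖κ‖ := norm_pos_iff.2 hκ0
  have hpi' : ∀ y, IntegrableOn (fun t => ‖p t‖) (Set.Ioi y) := fun y =>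
    (integrableOn_Ioi_of_continuous hp hpi y).norm
  set Θ : ℝ → ℝ := fun y => ∫ t in Set.Ioi y, ‖p t‖ with hΘ
  have hΘd : ∀ y, HasDerivAt Θ (-‖p y‖) y := hasDerivAt_tail hp.norm hpi'
  have hΘ0 : ∀ y, 0 ≤ Θ y := fun y => integral_nonneg fun t => norm_nonneg _
  -- These combinations diagonalize the unperturbed system: a' = κa + pw and b' = −κb + pw. Hence S
  -- = |a|² + |b|² grows at rate at most 2 Re κ plus a multiple of the integrable |p|.
  set a : ℝ → ℂ := fun y => w' y + κ * w y with ha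
  set b : ℝ → ℂ := fun y => w' y - κ * w y with hb
  have had : ∀ y, HasDerivAt a (κ * a y + p y * w y) y := fun y =>
    ((h.deriv_snd y).fun_add ((h.deriv_fst y).const_mul κ)).congr_deriv (by simp only [ha]; ring)
  have hbd : ∀ y, HasDerivAt b (-κ * b y + p y * w y) y := fun y =>
    ((h.deriv_snd y).fun_sub ((h.deriv_fst y).const_mul κ)).congr_deriv (by simp only [hb]; ring)
  set S : ℝ → ℝ := fun y => ‖a y‖ ^ 2 + ‖b y‖ ^ 2 with hS
  have hSd : ∀ y, HasDerivAt S (2 * inner ℝ (a y) (κ * a y + p y * w y) +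
      2 * inner ℝ (b y) (-κ * b y + p y * w y)) y := fun y =>
    (had y).norm_sq.fun_add (hbd y).norm_sq
  have hwab : ∀ y, ‖w y‖ ≤ (‖a y‖ + ‖b y‖) / (2 * ‖κ‖) := by
    intro y
    have e : w y = (a y - b y) / (2 * κ) := by simp only [ha, hb]; field_simp; ring
    rw [e, norm_div, norm_mul]
    simp only [Complex.norm_ofNat]
    gcongr
    exact norm_sub_le _ _
  have hSle : ∀ y, 2 * inner ℝ (a y) (κ * a y + p y * w y) +
      2 * inner ℝ (b y) (-κ * b y + p y * w y) ≤ (2 * κ.re + 2 / ‖κ‖ * ‖p y‖) * S y := by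
    intro y
    rw [inner_add_right, inner_add_right, inner_mul_self_complex, inner_mul_self_complex]
    have h1 : inner ℝ (a y) (p y * w y) ≤ ‖a y‖ * (‖p y‖ * ‖w y‖) := by
      rw [← norm_mul]; exact real_inner_le_norm _ _
    have h2 : inner ℝ (b y) (p y * w y) ≤ ‖b y‖ * (‖p y‖ * ‖w y‖) := by
      rw [← norm_mul]; exact real_inner_le_norm _ _
    have h3 : (‖a y‖ + ‖b y‖) * (‖p y‖ * ‖w y‖) ≤
        (‖a y‖ + ‖b y‖) * (‖p y‖ * ((‖a y‖ + ‖b y‖) / (2 * ‖κ‖))) := by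
      gcongr; exact hwab y
    have h4 : (‖a y‖ + ‖b y‖) * (‖p y‖ * ((‖a y‖ + ‖b y‖) / (2 * ‖κ‖))) =
        (‖a y‖ + ‖b y‖) ^ 2 * (‖p y‖ / (2 * ‖κ‖)) := by ring
    have h5 : (‖a y‖ + ‖b y‖) ^ 2 * (‖p y‖ / (2 * ‖κ‖)) ≤
        (2 * S y) * (‖p y‖ / (2 * ‖κ‖)) := by
      gcongr
      simp only [hS]
      nlinarith [sq_nonneg (‖a y‖ - ‖b y‖)]
    have h6 : 2 / ‖κ‖ * ‖p y‖ * S y = 2 * ((2 * S y) * (‖p y‖ / (2 * ‖κ‖))) := by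
      field_simp
    have h7 : 0 ≤ κ.re * ‖b y‖ ^ 2 := by positivity
    rw [add_mul, h6]
    simp only [Complex.neg_re]
    have h8 : 2 * κ.re * S y = 2 * (κ.re * ‖a y‖ ^ 2) + 2 * (κ.re * ‖b y‖ ^ 2) := by
      simp only [hS]; ring
    rw [h8]
    nlinarith
  -- Integrating factor: since Θ' = −|p|, the differential inequality for S says exactly that Z is
  -- nonincreasing.
  set Z : ℝ → ℝ := fun y => S y * Real.exp (-2 * κ.re * y + 2 / ‖κ‖ * Θ y) with hZ
  have hZd : ∀ y, HasDerivAt Z ((2 * inner ℝ (a y) (κ * a y + p y * w y) +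
      2 * inner ℝ (b y) (-κ * b y + p y * w y) - (2 * κ.re + 2 / ‖κ‖ * ‖p y‖) * S y) *
      Real.exp (-2 * κ.re * y + 2 / ‖κ‖ * Θ y)) y := by
    intro y
    exact ((hSd y).fun_mul (((hasDerivAt_id' y).const_mul (-2 * κ.re)).fun_add
      ((hΘd y).const_mul (2 / ‖κ‖))).exp).congr_deriv (by ring)
  have hZanti : Antitone Z := antitone_of_hasDerivAt_nonpos hZd fun y =>
    mul_nonpos_of_nonpos_of_nonneg (sub_nonpos.2 (hSle y)) (Real.exp_pos _).le
  have hSb : ∀ y, 0 ≤ y → S y ≤ Z 0 * Real.exp (2 * (κ.re * y)) := by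
    intro y hy
    have h1 : S y * Real.exp (-2 * κ.re * y) ≤ Z y := by
      simp only [hZ]
      gcongr
      have := hΘ0 y
      have : 0 ≤ 2 / ‖κ‖ * Θ y := by positivity
      linarith
    have h2 := h1.trans (hZanti hy)
    have e : Real.exp (-2 * κ.re * y) * Real.exp (2 * (κ.re * y)) = 1 := by
      rw [← Real.exp_add]; simp; ring
    calc S y = S y * Real.exp (-2 * κ.re * y) * Real.exp (2 * (κ.re * y)) := by
          rw [mul_assoc, e, mul_one]
      _ ≤ _ := by gcongr
  have hZ0 : 0 ≤ Z 0 := by simp only [hZ, hS]; positivity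
  have key : ∀ y, 0 ≤ y → ‖a y‖ ≤ √(Z 0) * Real.exp (κ.re * y) ∧
      ‖b y‖ ≤ √(Z 0) * Real.exp (κ.re * y) := by
    intro y hy
    have h1 := hSb y hy
    have e : Z 0 * Real.exp (2 * (κ.re * y)) = (√(Z 0) * Real.exp (κ.re * y)) ^ 2 := by
      rw [mul_pow, Real.sq_sqrt hZ0, ← Real.exp_nat_mul]; norm_num
    rw [e] at h1
    constructor
    · refine abs_le_of_sq_le_sq' ?_ (by positivity) |>.2
      simp only [hS] at h1
      nlinarith [sq_nonneg ‖b y‖]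
    · refine abs_le_of_sq_le_sq' ?_ (by positivity) |>.2
      simp only [hS] at h1
      nlinarith [sq_nonneg ‖a y‖]
  refine ⟨√(Z 0) / ‖κ‖ + √(Z 0), fun y hy => ?_⟩
  obtain ⟨k1, k2⟩ := key y hy
  constructor
  · refine (hwab y).trans ?_
    rw [div_le_iff₀ (by positivity)]
    have e : (√(Z 0) / ‖κ‖ + √(Z 0)) * Real.exp (κ.re * y) * (2 * ‖κ‖) =
        2 * (√(Z 0) * Real.exp (κ.re * y)) + 2 * ‖κ‖ * (√(Z 0) * Real.exp (κ.re * y)) := by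
      field_simp
    rw [e]
    have : 0 ≤ 2 * ‖κ‖ * (√(Z 0) * Real.exp (κ.re * y)) := by positivity
    linarith
  · have e : w' y = (a y + b y) / 2 := by simp only [ha, hb]; ring
    have h1 : ‖w' y‖ ≤ (‖a y‖ + ‖b y‖) / 2 := by
      rw [e, norm_div]
      simp only [Complex.norm_ofNat]
      gcongr
      exact norm_add_le _ _
    have : 0 ≤ √(Z 0) / ‖κ‖ * Real.exp (κ.re * y) := by positivity
    rw [add_mul]
    linarith

theorem norm_cexp_mul_real (κ : ℂ) (y : ℝ) : ‖Complex.exp (κ * y)‖ = Real.exp (κ.re * y) := by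
  rw [Complex.norm_exp]; simp

theorem hasDerivAt_cexp_mul_real (κ : ℂ) (y : ℝ) :
    HasDerivAt (fun y : ℝ => Complex.exp (κ * y)) (κ * Complex.exp (κ * y)) y := by
  have h1 : HasDerivAt (fun y : ℝ => κ * (y : ℂ)) κ y := by
    simpa using (Complex.ofRealCLM.hasDerivAt (x := y)).const_mul κ
  exact h1.cexp.congr_deriv (by ring)

/-- The solution of `w'' = (κ² + p) w` asymptotic to `e^{-κ y}`, for integrable `p`. -/
theorem exists_jost {κ : ℂ} (hκ : 0 < κ.re) {p : ℝ → ℂ} (hp : Continuous p)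
    (hpi : IntegrableOn p (Set.Ioi 0)) :
    ∃ w w', Sol (fun y => κ ^ 2 + p y) w w' ∧
      Tendsto (fun y : ℝ => Complex.exp (κ * y) * w y) atTop (𝓝 1) ∧
      Tendsto (fun y : ℝ => Complex.exp (κ * y) * w' y) atTop (𝓝 (-κ)) := by
  have hκ0 : κ ≠ 0 := fun h => by simp [h] at hκ
  have hκn : 0 < ‖κ‖ := norm_pos_iff.2 hκ0
  have hpi' : ∀ y, IntegrableOn (fun t => ‖p t‖) (Set.Ioi y) := fun y =>
    (integrableOn_Ioi_of_continuous hp hpi y).norm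
  set Θ : ℝ → ℝ := fun y => ∫ t in Set.Ioi y, ‖p t‖ with hΘ
  have hΘd : ∀ y, HasDerivAt Θ (-‖p y‖) y := hasDerivAt_tail hp.norm hpi'
  have hΘ0 : ∀ y, 0 ≤ Θ y := fun y => integral_nonneg fun t => norm_nonneg _
  have hΘl : Tendsto Θ atTop (𝓝 0) := tendsto_tail (hpi' 0)
  have hΘc : Continuous Θ := continuous_iff_continuousAt.2 fun y => (hΘd y).continuousAt
  have hΘa : Antitone Θ := antitone_of_hasDerivAt_nonpos hΘd fun y => by simp
  -- This weight satisfies ρ' = −(2/|κ|)|p|ρ, whence ∫_y^∞ |p|ρ = (|κ|/2)(ρ(y) − 1). That value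
  -- makes the operator below contract by 1/2 without any smallness of p.
  set ρ : ℝ → ℝ := fun y => Real.exp (2 / ‖κ‖ * Θ y) with hρ
  have hρc : Continuous ρ := by fun_prop
  have hρa : Antitone ρ := fun x y hxy => by
    simp only [hρ]; gcongr; exact hΘa hxy
  have hρ1 : ∀ y, 1 ≤ ρ y := fun y => Real.one_le_exp (by have := hΘ0 y; positivity)
  have hρl : Tendsto ρ atTop (𝓝 1) := by
    have := (hΘl.const_mul (2 / ‖κ‖)).rexp
    simpa using this
  have hρd : ∀ y, HasDerivAt (fun y => -(‖κ‖ / 2 * ρ y)) (‖p y‖ * ρ y) y := fun y =>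
    (((hΘd y).const_mul (2 / ‖κ‖)).exp.const_mul (‖κ‖ / 2)).fun_neg.congr_deriv (by
      simp only [hρ]; field_simp)
  have hρint : ∀ y, IntegrableOn (fun t => ‖p t‖ * ρ t) (Set.Ioi y) ∧
      ∫ t in Set.Ioi y, ‖p t‖ * ρ t = ‖κ‖ / 2 * (ρ y - 1) := by
    intro y
    have hl : Tendsto (fun y => -(‖κ‖ / 2 * ρ y)) atTop (𝓝 (-(‖κ‖ / 2 * 1))) :=
      (hρl.const_mul _).neg
    have hnn : ∀ x ∈ Set.Ioi y, 0 ≤ ‖p x‖ * ρ x := fun x _ =>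
      mul_nonneg (norm_nonneg _) (zero_le_one.trans (hρ1 x))
    refine ⟨integrableOn_Ioi_deriv_of_nonneg' (fun x _ => hρd x) hnn hl, ?_⟩
    rw [integral_Ioi_of_hasDerivAt_of_nonneg' (fun x _ => hρd x) hnn hl]
    ring
  have hint : ∀ n : ℝ → ℂ, Continuous n → (∃ C, ∀ y, ‖n y‖ ≤ C * ρ y) → ∀ y,
      IntegrableOn (fun t => p t * n t) (Set.Ioi y) := by
    rintro n hn ⟨C, hC⟩ y
    refine Integrable.mono' ((hρint y).1.const_mul C)
      (hp.mul hn).aestronglyMeasurable.restrict (Eventually.of_forall fun t => ?_)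
    rw [norm_mul]
    have := mul_le_mul_of_nonneg_left (hC t) (norm_nonneg (p t))
    linarith
  have hint2 : ∀ n : ℝ → ℂ, Continuous n → (∃ C, ∀ y, ‖n y‖ ≤ C * ρ y) → ∀ y,
      IntegrableOn (fun t : ℝ => Complex.exp (-2 * κ * t) * (p t * n t)) (Set.Ioi y) := by
    rintro n hn hC y
    refine Integrable.mono' ((hint n hn hC y).norm.const_mul (Real.exp (-2 * κ.re * y)))
      (Continuous.aestronglyMeasurable (by fun_prop)).restrict ?_
    refine (ae_restrict_iff' measurableSet_Ioi).2 (Eventually.of_forall fun t ht => ?_)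
    rw [norm_mul, norm_cexp_mul_real]
    refine mul_le_mul_of_nonneg_right (Real.exp_le_exp.2 ?_) (norm_nonneg _)
    have : (-2 * κ).re = -2 * κ.re := by simp
    rw [this]
    have : y < t := ht
    nlinarith
  -- the integral operator and its derivative
  set D : (ℝ → ℂ) → ℝ → ℂ := fun n y => -Complex.exp (2 * κ * y) *
    ∫ t in Set.Ioi y, Complex.exp (-2 * κ * t) * (p t * n t) with hD
  -- Writing w = e^{−κy}n turns the equation into n'' − 2κn' = pn. A fixed point of T solves it with
  -- n' = D n, and tends to 1 at +∞.
  set T : (ℝ → ℂ) → ℝ → ℂ := fun n y => 1 + (1 / (2 * κ)) *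
    ((∫ t in Set.Ioi y, p t * n t) + D n y) with hT
  have hDbound : ∀ n : ℝ → ℂ, Continuous n → ∀ C, (∀ y, ‖n y‖ ≤ C * ρ y) → ∀ y,
      ‖D n y‖ ≤ C * (‖κ‖ / 2 * (ρ y - 1)) := by
    intro n hn C hC y
    simp only [hD]
    have h1 := norm_integral_le_of_norm_le (μ := volume.restrict (Set.Ioi y))
      (f := fun t : ℝ => -Complex.exp (2 * κ * y) * (Complex.exp (-2 * κ * t) * (p t * n t)))
      ((hρint y).1.const_mul C) ?_
    · rwa [integral_const_mul, integral_const_mul, (hρint y).2] at h1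
    · refine (ae_restrict_iff' measurableSet_Ioi).2 (Eventually.of_forall fun t ht => ?_)
      rw [← mul_assoc, norm_mul, norm_mul, norm_mul, norm_neg, norm_cexp_mul_real,
        norm_cexp_mul_real, ← Real.exp_add]
      have hyt : y < t := ht
      have h2 : Real.exp ((2 * κ).re * y + (-2 * κ).re * t) ≤ 1 := by
        rw [Real.exp_le_one_iff]
        simp
        nlinarith
      have h3 : ‖p t‖ * ‖n t‖ ≤ C * (‖p t‖ * ρ t) := by
        have := mul_le_mul_of_nonneg_left (hC t) (norm_nonneg (p t))
        linarith
      exact (mul_le_of_le_one_left (by positivity) h2).trans h3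
  have hIbound : ∀ n : ℝ → ℂ, Continuous n → ∀ C, (∀ y, ‖n y‖ ≤ C * ρ y) → ∀ y,
      ‖∫ t in Set.Ioi y, p t * n t‖ ≤ C * (‖κ‖ / 2 * (ρ y - 1)) := by
    intro n hn C hC y
    have h1 := norm_integral_le_of_norm_le (μ := volume.restrict (Set.Ioi y))
      (f := fun t : ℝ => p t * n t) ((hρint y).1.const_mul C) ?_
    · rwa [integral_const_mul, (hρint y).2] at h1
    · refine Eventually.of_forall fun t => ?_
      rw [norm_mul]
      have := mul_le_mul_of_nonneg_left (hC t) (norm_nonneg (p t))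
      linarith
  have hTbound : ∀ n : ℝ → ℂ, Continuous n → ∀ C, (∀ y, ‖n y‖ ≤ C * ρ y) → ∀ y,
      ‖T n y - 1‖ ≤ C / 2 * (ρ y - 1) := by
    intro n hn C hC y
    simp only [hT, add_sub_cancel_left]
    rw [norm_mul, norm_div, norm_one, norm_mul, Complex.norm_ofNat]
    have h1 := (norm_add_le (∫ t in Set.Ioi y, p t * n t) (D n y)).trans
      (add_le_add (hIbound n hn C hC y) (hDbound n hn C hC y))
    calc 1 / (2 * ‖κ‖) * ‖(∫ t in Set.Ioi y, p t * n t) + D n y‖ ≤ 1 / (2 * ‖κ‖) *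
          (C * (‖κ‖ / 2 * (ρ y - 1)) + C * (‖κ‖ / 2 * (ρ y - 1))) := by gcongr
      _ = C / 2 * (ρ y - 1) := by field_simp; ring
  have hDd : ∀ n : ℝ → ℂ, Continuous n → (∃ C, ∀ y, ‖n y‖ ≤ C * ρ y) → ∀ y,
      HasDerivAt (D n) (2 * κ * D n y + p y * n y) y := by
    intro n hn hC y
    refine ((hasDerivAt_cexp_mul_real (2 * κ) y).fun_neg.fun_mul
      (hasDerivAt_tail (by fun_prop) (hint2 n hn hC) y)).congr_deriv ?_
    have e : Complex.exp (2 * κ * y) * Complex.exp (-2 * κ * y) = 1 := by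
      rw [← Complex.exp_add]; simp
    simp only [hD]
    linear_combination (p y * n y) * e
  have hTd : ∀ n : ℝ → ℂ, Continuous n → (∃ C, ∀ y, ‖n y‖ ≤ C * ρ y) → ∀ y,
      HasDerivAt (T n) (D n y) y := by
    intro n hn hC y
    refine ((((hasDerivAt_tail (hp.mul hn) (hint n hn hC) y).fun_add
      (hDd n hn hC y)).const_mul (1 / (2 * κ))).const_add 1).congr_deriv ?_
    rw [Pi.mul_apply]
    field_simp
    ring
  obtain ⟨n, hn, hnC, hfix⟩ : ∃ n, Continuous n ∧ (∃ C, ∀ y, ‖n y‖ ≤ C * ρ y) ∧ T n = n := by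
    refine exists_fixedPoint_of_weight hρc (fun y => Real.exp_pos _) T ?_ ?_ ?_
    · exact fun n hn hC => continuous_iff_continuousAt.2 fun y => (hTd n hn hC y).continuousAt
    · refine ⟨1, fun y => ?_⟩
      simp [hT, hD, hρ1 y]
    · intro n m hn hnC hm hmC Δ hΔ y
      have hΔ0 : 0 ≤ Δ := by
        have h1 := (norm_nonneg _).trans (hΔ 0)
        exact nonneg_of_mul_nonneg_left h1 (Real.exp_pos _)
      -- T is affine with constant term 1, so the bound on T n − 1 also controls differences.
      have e : T n y - T m y = T (fun y => n y - m y) y - 1 := by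
        have e1 : ∫ t in Set.Ioi y, p t * (n t - m t) =
            (∫ t in Set.Ioi y, p t * n t) - ∫ t in Set.Ioi y, p t * m t := by
          rw [← integral_sub (hint n hn hnC y) (hint m hm hmC y)]
          exact integral_congr_ae (Eventually.of_forall fun t => by ring)
        have e2 : ∫ t in Set.Ioi y, Complex.exp (-2 * κ * t) * (p t * (n t - m t)) =
            (∫ t in Set.Ioi y, Complex.exp (-2 * κ * t) * (p t * n t)) -
            ∫ t in Set.Ioi y, Complex.exp (-2 * κ * t) * (p t * m t) := by
          rw [← integral_sub (hint2 n hn hnC y) (hint2 m hm hmC y)]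
          exact integral_congr_ae (Eventually.of_forall fun t => by
            simp only; ring)
        simp only [hT, hD, e1, e2]
        ring
      rw [e]
      refine (hTbound _ (hn.sub hm) Δ hΔ y).trans ?_
      have := hρ1 y
      gcongr
      linarith
  have hnd : ∀ y, HasDerivAt n (D n y) y := fun y => by
    have := hTd n hn hnC y
    rwa [hfix] at this
  have hnl : Tendsto n atTop (𝓝 1) := by
    obtain ⟨C, hC⟩ := hnC
    rw [tendsto_iff_norm_sub_tendsto_zero]
    refine squeeze_zero (fun _ => norm_nonneg _) (g := fun y => C / 2 * (ρ y - 1)) (fun y => ?_) ?_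
    · have := hTbound n hn C hC y
      rwa [hfix] at this
    · simpa using (hρl.sub_const 1).const_mul (C / 2)
  have hDl : Tendsto (D n) atTop (𝓝 0) := by
    obtain ⟨C, hC⟩ := hnC
    refine squeeze_zero_norm (hDbound n hn C hC) ?_
    simpa using ((hρl.sub_const 1).const_mul (‖κ‖ / 2)).const_mul C
  have ee : ∀ y : ℝ, Complex.exp (κ * y) * Complex.exp (-κ * y) = 1 := fun y => by
    rw [← Complex.exp_add]; simp
  refine ⟨fun y => Complex.exp (-κ * y) * n y, fun y => Complex.exp (-κ * y) * (D n y - κ * n y),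
    ⟨fun y => ?_, fun y => ?_⟩, ?_, ?_⟩
  · exact ((hasDerivAt_cexp_mul_real (-κ) y).fun_mul (hnd y)).congr_deriv (by ring)
  · exact ((hasDerivAt_cexp_mul_real (-κ) y).fun_mul
      ((hDd n hn hnC y).fun_sub ((hnd y).const_mul κ))).congr_deriv (by ring)
  · refine hnl.congr fun y => ?_
    rw [← mul_assoc, ee, one_mul]
  · have := hDl.sub (hnl.const_mul κ)
    rw [mul_one, zero_sub] at this
    refine this.congr fun y => ?_
    rw [← mul_assoc, ee, one_mul]

/-! ### Integrals against exponentials -/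

/-- The constant does not depend on S, so the same estimate serves half-lines and bounded intervals
ending at y. -/
theorem setIntegral_le_of_left {F : ℝ → ℂ} (hF : Continuous F) {δ A y : ℝ} (hδ : 0 < δ)
    (hA : 0 ≤ A) {S : Set ℝ} (hS : MeasurableSet S) (hSy : S ⊆ Set.Iic y)
    (h : ∀ t ∈ S, ‖F t‖ ≤ A * Real.exp (-δ * (y - t))) :
    IntegrableOn F S ∧ ‖∫ t in S, F t‖ ≤ A / δ := by
  have e : ∀ t, A * Real.exp (-δ * (y - t)) = A * Real.exp (-δ * y) * Real.exp (δ * t) := by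
    intro t; rw [mul_assoc, ← Real.exp_add]; congr 2; ring
  have hi : IntegrableOn (fun t => A * Real.exp (-δ * (y - t))) (Set.Iic y) := by
    simp only [e]
    exact (integrableOn_exp_mul_Iic hδ y).const_mul _
  have hiv : ∫ t in Set.Iic y, A * Real.exp (-δ * (y - t)) = A / δ := by
    simp only [e]
    rw [integral_const_mul, integral_exp_mul_Iic hδ, mul_div_assoc', mul_assoc, ← Real.exp_add]
    simp
  have hae : ∀ᵐ t ∂volume.restrict S, ‖F t‖ ≤ A * Real.exp (-δ * (y - t)) :=
    (ae_restrict_iff' hS).2 (Eventually.of_forall h)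
  refine ⟨Integrable.mono' (hi.mono_set hSy) hF.aestronglyMeasurable.restrict hae, ?_⟩
  refine (norm_integral_le_of_norm_le (hi.mono_set hSy) hae).trans ?_
  rw [← hiv]
  exact setIntegral_mono_set hi (Eventually.of_forall fun t => by positivity)
    hSy.eventuallyLE

theorem setIntegral_le_of_right {F : ℝ → ℂ} (hF : Continuous F) {δ A y : ℝ} (hδ : 0 < δ)
    (hA : 0 ≤ A) {S : Set ℝ} (hS : MeasurableSet S) (hSy : S ⊆ Set.Ioi y)
    (h : ∀ t ∈ S, ‖F t‖ ≤ A * Real.exp (-δ * (t - y))) :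
    IntegrableOn F S ∧ ‖∫ t in S, F t‖ ≤ A / δ := by
  have e : ∀ t, A * Real.exp (-δ * (t - y)) = A * Real.exp (δ * y) * Real.exp (-δ * t) := by
    intro t; rw [mul_assoc, ← Real.exp_add]; congr 2; ring
  have hi : IntegrableOn (fun t => A * Real.exp (-δ * (t - y))) (Set.Ioi y) := by
    simp only [e]
    exact (integrableOn_exp_mul_Ioi (by linarith) y).const_mul _
  have hiv : ∫ t in Set.Ioi y, A * Real.exp (-δ * (t - y)) = A / δ := by
    simp only [e]
    rw [integral_const_mul, integral_exp_mul_Ioi (by linarith), mul_div_assoc', mul_neg,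
      mul_assoc, ← Real.exp_add]
    simp
  have hae : ∀ᵐ t ∂volume.restrict S, ‖F t‖ ≤ A * Real.exp (-δ * (t - y)) :=
    (ae_restrict_iff' hS).2 (Eventually.of_forall h)
  refine ⟨Integrable.mono' (hi.mono_set hSy) hF.aestronglyMeasurable.restrict hae, ?_⟩
  refine (norm_integral_le_of_norm_le (hi.mono_set hSy) hae).trans ?_
  rw [← hiv]
  exact setIntegral_mono_set hi (Eventually.of_forall fun t => by positivity)
    hSy.eventuallyLE

/-! ### Equations with exponentially dichotomous ends -/

/-- Both functions are bounded by a multiple of `m`. -/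
def BoundedBy (w w' : ℝ → ℂ) (m : ℝ → ℝ) : Prop :=
  ∃ C, 0 ≤ C ∧ ∀ y, ‖w y‖ ≤ C * m y ∧ ‖w' y‖ ≤ C * m y

theorem BoundedBy.mono {w w' : ℝ → ℂ} {m n : ℝ → ℝ} (h : BoundedBy w w' m)
    (hmn : ∀ y, m y ≤ n y) : BoundedBy w w' n := by
  obtain ⟨C, hC, h⟩ := h
  exact ⟨C, hC, fun y => ⟨(h y).1.trans (mul_le_mul_of_nonneg_left (hmn y) hC),
    (h y).2.trans (mul_le_mul_of_nonneg_left (hmn y) hC)⟩⟩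

theorem BoundedBy.smul {w w' v v' : ℝ → ℂ} {m : ℝ → ℝ} (h : BoundedBy w w' m) {a : ℂ}
    (hv : ∀ y, v y = a * w y ∧ v' y = a * w' y) : BoundedBy v v' m := by
  obtain ⟨C, hC, h⟩ := h
  refine ⟨‖a‖ * C, by positivity, fun y => ?_⟩
  rw [(hv y).1, (hv y).2, norm_mul, norm_mul, mul_assoc]
  exact ⟨mul_le_mul_of_nonneg_left (h y).1 (norm_nonneg _),
    mul_le_mul_of_nonneg_left (h y).2 (norm_nonneg _)⟩

/-- A nontrivial solution of `w'' = P w` for which `e^{-b y} w` and `e^{-b y} w'` are bounded. -/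
def IsBoundState (P : ℝ → ℂ) (b : ℝ) (w w' : ℝ → ℂ) : Prop :=
  Sol P w w' ∧ (∃ y, w y ≠ 0) ∧ BoundedBy w w' fun y => Real.exp (b * y)

/-- The potential converges integrably to `κ₊²` and `κ₋²` at `±∞`, with `Re κ± > b > 0`. -/
structure Dichotomy (P : ℝ → ℂ) (b : ℝ) (κ₁ κ₂ : ℂ) : Prop where
  continuous : Continuous P
  bounded : ∃ C, ∀ y, ‖P y‖ ≤ C
  pos : 0 < b
  lt_right : b < κ₁.re
  lt_left : b < κ₂.re
  integrable_right : IntegrableOn (fun y => P y - κ₁ ^ 2) (Set.Ioi 0)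
  integrable_left : IntegrableOn (fun y => P (-y) - κ₂ ^ 2) (Set.Ioi 0)

/-- The piecewise linear exponent with slopes `r` on the right and `l` on the left. -/
def expo (r l y : ℝ) : ℝ := r * max y 0 + l * min y 0

theorem expo_of_nonneg (r l : ℝ) {y : ℝ} (hy : 0 ≤ y) : expo r l y = r * y := by
  simp [expo, hy]

theorem expo_of_nonpos (r l : ℝ) {y : ℝ} (hy : y ≤ 0) : expo r l y = l * y := by
  simp [expo, hy]

theorem expo_neg (r l y : ℝ) : expo r l (-y) = -expo l r y := by
  rcases le_total 0 y with h | h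
  · rw [expo_of_nonpos r l (by linarith), expo_of_nonneg l r h]; ring
  · rw [expo_of_nonneg r l (by linarith), expo_of_nonpos l r h]; ring

/-- Both slopes are at least s, so the exponent increases at rate at least s across the kink at 0.
This is the source of the exponentially decaying kernels in the Green's function bounds. -/
theorem expo_le {r l s : ℝ} (hr : s ≤ r) (hl : s ≤ l) {t y : ℝ} (h : t ≤ y) :
    expo r l t ≤ expo r l y - s * (y - t) := by
  rcases le_total 0 t with ht | ht
  · rw [expo_of_nonneg r l ht, expo_of_nonneg r l (ht.trans h)]; nlinarith
  · rcases le_total 0 y with hy | hy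
    · rw [expo_of_nonpos r l ht, expo_of_nonneg r l hy]; nlinarith
    · rw [expo_of_nonpos r l ht, expo_of_nonpos r l hy]; nlinarith

theorem abs_expo_of_nonneg {r : ℝ} (hr : 0 ≤ r) (l : ℝ) {y : ℝ} (hy : 0 ≤ y) :
    |expo r l y| = r * y := by
  rw [expo_of_nonneg r l hy, abs_of_nonneg (by positivity)]

theorem abs_expo_of_nonpos (r : ℝ) {l : ℝ} (hl : 0 ≤ l) {y : ℝ} (hy : y ≤ 0) :
    |expo r l y| = -(l * y) := by
  rw [expo_of_nonpos r l hy, abs_of_nonpos (mul_nonpos_of_nonneg_of_nonpos hl hy)]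

namespace Dichotomy

variable {P : ℝ → ℂ} {b : ℝ} {κ₁ κ₂ : ℂ}

theorem reflect (h : Dichotomy P b κ₁ κ₂) : Dichotomy (fun y => P (-y)) b κ₂ κ₁ where
  continuous := h.continuous.comp continuous_neg
  bounded := h.bounded.imp fun C hC y => hC (-y)
  pos := h.pos
  lt_right := h.lt_left
  lt_left := h.lt_right
  integrable_right := h.integrable_left
  integrable_left := by simpa using h.integrable_right

theorem growth_right (h : Dichotomy P b κ₁ κ₂) {w w' : ℝ → ℂ} (hw : Sol P w w') :
    ∃ C, ∀ y, 0 ≤ y → ‖w y‖ ≤ C * Real.exp (κ₁.re * y) ∧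
      ‖w' y‖ ≤ C * Real.exp (κ₁.re * y) := by
  refine Sol.growth (p := fun y => P y - κ₁ ^ 2) (h.pos.trans h.lt_right)
    (h.continuous.sub continuous_const) h.integrable_right ?_
  simpa using hw

theorem growth_left (h : Dichotomy P b κ₁ κ₂) {w w' : ℝ → ℂ} (hw : Sol P w w') :
    ∃ C, ∀ y, y ≤ 0 → ‖w y‖ ≤ C * Real.exp (-(κ₂.re * y)) ∧
      ‖w' y‖ ≤ C * Real.exp (-(κ₂.re * y)) := by
  obtain ⟨C, hC⟩ := h.reflect.growth_right hw.reflect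
  refine ⟨C, fun y hy => ?_⟩
  have := hC (-y) (by linarith)
  simpa using this

theorem boundedBy_of_halves {w w' : ℝ → ℂ} {m : ℝ → ℝ} (hm : ∀ y, 0 ≤ m y)
    (h1 : ∃ C, ∀ y, 0 ≤ y → ‖w y‖ ≤ C * m y ∧ ‖w' y‖ ≤ C * m y)
    (h2 : ∃ C, ∀ y, y ≤ 0 → ‖w y‖ ≤ C * m y ∧ ‖w' y‖ ≤ C * m y) : BoundedBy w w' m := by
  obtain ⟨C, hC⟩ := h1
  obtain ⟨D, hD⟩ := h2
  refine ⟨max (max C D) 0, le_max_right _ _, fun y => ?_⟩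
  rcases le_total 0 y with hy | hy
  · have : C * m y ≤ max (max C D) 0 * m y :=
      mul_le_mul_of_nonneg_right ((le_max_left C D).trans (le_max_left _ _)) (hm y)
    exact ⟨(hC y hy).1.trans this, (hC y hy).2.trans this⟩
  · have : D * m y ≤ max (max C D) 0 * m y :=
      mul_le_mul_of_nonneg_right ((le_max_right C D).trans (le_max_left _ _)) (hm y)
    exact ⟨(hD y hy).1.trans this, (hD y hy).2.trans this⟩

theorem growth (h : Dichotomy P b κ₁ κ₂) {w w' : ℝ → ℂ} (hw : Sol P w w') :
    BoundedBy w w' fun y => Real.exp |expo κ₁.re κ₂.re y| := by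
  have hr := (h.pos.trans h.lt_right).le
  have hl := (h.pos.trans h.lt_left).le
  refine boundedBy_of_halves (fun y => (Real.exp_pos _).le) ?_ ?_
  · obtain ⟨C, hC⟩ := h.growth_right hw
    exact ⟨C, fun y hy => by rw [abs_expo_of_nonneg hr _ hy]; exact hC y hy⟩
  · obtain ⟨C, hC⟩ := h.growth_left hw
    exact ⟨C, fun y hy => by rw [abs_expo_of_nonpos _ hl hy]; exact hC y hy⟩

theorem exists_bound_of_tendsto {κ : ℂ} {w : ℝ → ℂ} (hw : Continuous w) {l : ℂ}
    (h : Tendsto (fun y : ℝ => Complex.exp (κ * y) * w y) atTop (𝓝 l)) :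
    ∃ C, ∀ y, 0 ≤ y → ‖w y‖ ≤ C * Real.exp (-(κ.re * y)) := by
  obtain ⟨R, hR⟩ := eventually_atTop.1
    ((h.norm.eventually (gt_mem_nhds (lt_add_one ‖l‖))))
  obtain ⟨D, hD⟩ := (isCompact_Icc (a := (0:ℝ)) (b := R)).exists_bound_of_continuousOn
    (f := fun y : ℝ => Complex.exp (κ * y) * w y)
    (Continuous.continuousOn (by fun_prop))
  refine ⟨max D (‖l‖ + 1), fun y hy => ?_⟩
  have h1 : ‖Complex.exp (κ * y) * w y‖ ≤ max D (‖l‖ + 1) := by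
    rcases le_total y R with h | h
    · exact (hD y ⟨hy, h⟩).trans (le_max_left _ _)
    · exact (hR y h).le.trans (le_max_right _ _)
  rw [norm_mul, norm_cexp_mul_real] at h1
  rw [Real.exp_neg, ← div_eq_mul_inv, le_div_iff₀ (Real.exp_pos _), mul_comm]
  exact h1

/-- The solution decaying at `+∞`. -/
theorem exists_right (h : Dichotomy P b κ₁ κ₂) : ∃ w w', Sol P w w' ∧
    (BoundedBy w w' fun y => Real.exp (-expo κ₁.re κ₂.re y)) ∧
    Tendsto (fun y : ℝ => Complex.exp (κ₁ * y) * w y) atTop (𝓝 1) ∧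
    Tendsto (fun y : ℝ => Complex.exp (κ₁ * y) * w' y) atTop (𝓝 (-κ₁)) := by
  obtain ⟨w, w', hw, h1, h2⟩ := exists_jost (p := fun y => P y - κ₁ ^ 2)
    (h.pos.trans h.lt_right) (h.continuous.sub continuous_const) h.integrable_right
  have hw : Sol P w w' := by simpa using hw
  refine ⟨w, w', hw, boundedBy_of_halves (fun y => (Real.exp_pos _).le) ?_ ?_, h1, h2⟩
  · obtain ⟨C, hC⟩ := exists_bound_of_tendsto hw.continuous h1
    obtain ⟨D, hD⟩ := exists_bound_of_tendsto hw.continuous' h2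
    refine ⟨max C D, fun y hy => ?_⟩
    rw [expo_of_nonneg _ _ hy]
    exact ⟨(hC y hy).trans (mul_le_mul_of_nonneg_right (le_max_left _ _) (Real.exp_pos _).le),
      (hD y hy).trans (mul_le_mul_of_nonneg_right (le_max_right _ _) (Real.exp_pos _).le)⟩
  · obtain ⟨C, hC⟩ := h.growth_left hw
    exact ⟨C, fun y hy => by rw [expo_of_nonpos _ _ hy]; exact hC y hy⟩

theorem exists_ne_zero_of_tendsto {κ : ℂ} {w : ℝ → ℂ}
    (h : Tendsto (fun y : ℝ => Complex.exp (κ * y) * w y) atTop (𝓝 1)) : ∃ y, w y ≠ 0 := by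
  by_contra! hc
  have : Tendsto (fun y : ℝ => Complex.exp (κ * y) * w y) atTop (𝓝 0) := by
    simp [hc]
  exact one_ne_zero (tendsto_nhds_unique h this)

/-- A solution growing at most like `e^{b y}` at `+∞` is a multiple of the decaying one. -/
theorem eq_smul_right (h : Dichotomy P b κ₁ κ₂) {v v' w w' : ℝ → ℂ} (hv : Sol P v v')
    (hv0 : ∃ y, v y ≠ 0)
    (hvb : BoundedBy v v' fun y => Real.exp (-expo κ₁.re κ₂.re y)) (hw : Sol P w w')
    (hwb : ∃ C, ∀ y, 0 ≤ y → ‖w y‖ ≤ C * Real.exp (b * y) ∧ ‖w' y‖ ≤ C * Real.exp (b * y)) :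
    ∃ a : ℂ, ∀ y, w y = a * v y ∧ w' y = a * v' y := by
  obtain ⟨y₀, hy₀⟩ := hv0
  obtain ⟨B, hB⟩ := h.bounded
  refine hv.eq_smul h.continuous hB hw hy₀ (x := 0) ?_
  obtain ⟨C, hC⟩ := hwb
  obtain ⟨D, hD, hvb⟩ := hvb
  -- The Wronskian is constant, and it is O(e^{(b − Re κ₁)y}) at +∞; as b < Re κ₁ it vanishes.
  have hlim : Tendsto (fun y : ℝ => 2 * D * C * Real.exp ((b - κ₁.re) * y)) atTop (𝓝 0) := by
    have h1 : Tendsto (fun y : ℝ => (b - κ₁.re) * y) atTop atBot :=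
      tendsto_id.const_mul_atTop_of_neg (by linarith [h.lt_right])
    simpa using (Real.tendsto_exp_atBot.comp h1).const_mul (2 * D * C)
  have hlim2 : Tendsto (fun y => v y * w' y - v' y * w y) atTop (𝓝 0) := by
    refine squeeze_zero_norm' ?_ hlim
    filter_upwards [eventually_ge_atTop 0] with y hy
    have e : Real.exp ((b - κ₁.re) * y) = Real.exp (-(κ₁.re * y)) * Real.exp (b * y) := by
      rw [← Real.exp_add]; congr 1; ring
    have h1 := hvb y
    beta_reduce at h1
    rw [expo_of_nonneg _ _ hy] at h1
    have h2 := hC y hy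
    calc ‖v y * w' y - v' y * w y‖ ≤ ‖v y‖ * ‖w' y‖ + ‖v' y‖ * ‖w y‖ := by
          rw [← norm_mul, ← norm_mul]; exact norm_sub_le _ _
      _ ≤ (D * Real.exp (-(κ₁.re * y))) * (C * Real.exp (b * y)) +
          (D * Real.exp (-(κ₁.re * y))) * (C * Real.exp (b * y)) := by
          gcongr
          exacts [h1.1, h2.2, h1.2, h2.1]
      _ = _ := by rw [e]; ring
  have hc : Tendsto (fun y => v y * w' y - v' y * w y) atTop (𝓝 (v 0 * w' 0 - v' 0 * w 0)) :=
    tendsto_const_nhds.congr fun y => hv.wronskian hw 0 y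
  exact tendsto_nhds_unique hc hlim2

/-- This is the reflection of the solution decaying at +∞. -/
theorem exists_left (h : Dichotomy P b κ₁ κ₂) : ∃ w w', Sol P w w' ∧ (∃ y, w y ≠ 0) ∧
    BoundedBy w w' fun y => Real.exp (expo κ₁.re κ₂.re y) := by
  obtain ⟨w, w', hw, ⟨C, hC0, hC⟩, h1, -⟩ := h.reflect.exists_right
  obtain ⟨y, hy⟩ := exists_ne_zero_of_tendsto h1
  refine ⟨fun y => w (-y), fun y => -w' (-y), by simpa using hw.reflect, ⟨-y, by simpa using hy⟩,
    C, hC0, fun y => ?_⟩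
  have := hC (-y)
  beta_reduce at this
  rw [expo_neg, neg_neg] at this
  simpa using this

/-- A bound state decays exponentially at both ends. -/
theorem boundState_decay (h : Dichotomy P b κ₁ κ₂) {w w' : ℝ → ℂ} (hw : IsBoundState P b w w') :
    BoundedBy w w' fun y => Real.exp (-|expo κ₁.re κ₂.re y|) := by
  obtain ⟨hs, -, C, hC0, hC⟩ := hw
  have hr := (h.pos.trans h.lt_right).le
  have hl := (h.pos.trans h.lt_left).le
  refine boundedBy_of_halves (fun y => (Real.exp_pos _).le) ?_ ?_
  · obtain ⟨v, v', hv, hvb, hv1, -⟩ := h.exists_right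
    obtain ⟨a, ha⟩ := h.eq_smul_right hv (exists_ne_zero_of_tendsto hv1) hvb hs
      ⟨C, fun y _ => hC y⟩
    obtain ⟨D, -, hD⟩ := hvb.smul ha
    refine ⟨D, fun y hy => ?_⟩
    have := hD y
    beta_reduce at this
    rwa [expo_of_nonneg _ _ hy, ← abs_expo_of_nonneg hr κ₂.re hy] at this
  -- After reflection the bound becomes e^{−by}, which on y ≥ 0 is stronger than the e^{by}
  -- required, because b > 0.
  · obtain ⟨v, v', hv, hvb, hv1, -⟩ := h.reflect.exists_right
    obtain ⟨a, ha⟩ := h.reflect.eq_smul_right hv (exists_ne_zero_of_tendsto hv1) hvb hs.reflect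
      ⟨C, fun y hy => by
        have h1 := hC (-y)
        have h2 : C * Real.exp (b * -y) ≤ C * Real.exp (b * y) := by
          have := h.pos
          gcongr
          linarith
        rw [norm_neg]
        exact ⟨h1.1.trans h2, h1.2.trans h2⟩⟩
    obtain ⟨D, -, hD⟩ := hvb.smul ha
    refine ⟨D, fun y hy => ?_⟩
    have := hD (-y)
    beta_reduce at this
    rw [expo_neg, neg_neg, expo_of_nonpos _ _ hy] at this
    rw [abs_expo_of_nonpos _ hl hy, neg_neg]
    simpa using this

/-- Any two bound states are proportional. -/
theorem boundState_unique (h : Dichotomy P b κ₁ κ₂) {v v' w w' : ℝ → ℂ}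
    (hv : IsBoundState P b v v') (hw : Sol P w w')
    (hwb : BoundedBy w w' fun y => Real.exp (b * y)) :
    ∃ a : ℂ, ∀ y, w y = a * v y ∧ w' y = a * v' y := by
  obtain ⟨C, -, hC⟩ := hwb
  exact h.eq_smul_right hv.1 hv.2.1 ((h.boundState_decay hv).mono fun y =>
    Real.exp_le_exp.2 (neg_le_neg (le_abs_self _))) hw ⟨C, fun y _ => hC y⟩

end Dichotomy

/-! ### Variation of constants and solvability of the forced equation. -/

theorem hasDerivAt_integral_Iic {f : ℝ → ℂ} (hf : Continuous f)
    (h : ∀ y, IntegrableOn f (Set.Iic y)) (y : ℝ) :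
    HasDerivAt (fun y => ∫ t in Set.Iic y, f t) (f y) y := by
  have e : (fun y => ∫ t in Set.Iic y, f t) =
      fun y => (∫ t in Set.Iic (0:ℝ), f t) + ∫ t in (0:ℝ)..y, f t := by
    funext y
    rw [← intervalIntegral.integral_Iic_sub_Iic (h 0) (h y)]
    ring
  rw [e]
  exact (hf.integral_hasStrictDerivAt 0 y).hasDerivAt.const_add _

/-- Variation of constants. -/
theorem Sol.variation {P f φ φ' ψ ψ' I J : ℝ → ℂ} {W : ℂ} (hφ : Sol P φ φ') (hψ : Sol P ψ ψ')
    (hW : ∀ y, φ y * ψ' y - φ' y * ψ y = W) (hW0 : W ≠ 0)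
    (hI : ∀ y, HasDerivAt I (φ y * f y) y) (hJ : ∀ y, HasDerivAt J (-(ψ y * f y)) y) :
    ForcedSol P f (fun y => W⁻¹ * (ψ y * I y + φ y * J y))
      (fun y => W⁻¹ * (ψ' y * I y + φ' y * J y)) := by
  refine ⟨fun y => ?_, fun y => ?_⟩
  · exact ((((hψ.deriv_fst y).fun_mul (hI y)).fun_add
      ((hφ.deriv_fst y).fun_mul (hJ y))).const_mul W⁻¹).congr_deriv (by ring)
  · refine ((((hψ.deriv_snd y).fun_mul (hI y)).fun_add
      ((hφ.deriv_snd y).fun_mul (hJ y))).const_mul W⁻¹).congr_deriv ?_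
    have e : W⁻¹ * W = 1 := inv_mul_cancel₀ hW0
    linear_combination (W⁻¹ * f y) * hW y + f y * e

theorem norm_combination_le {K a b c d : ℂ} {A B : ℝ} (hA : ‖a * b‖ ≤ A) (hB : ‖c * d‖ ≤ B) :
    ‖K * (a * b + c * d)‖ ≤ ‖K‖ * (A + B) := by
  rw [norm_mul]
  exact mul_le_mul_of_nonneg_left ((norm_add_le _ _).trans (add_le_add hA hB)) (norm_nonneg _)

theorem norm_mul_le_of_exp {a b : ℂ} {C D s t : ℝ} (hC : 0 ≤ C)
    (ha : ‖a‖ ≤ C * Real.exp s) (hb : ‖b‖ ≤ D * Real.exp t) :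
    ‖a * b‖ ≤ C * D * Real.exp (s + t) := by
  rw [norm_mul, Real.exp_add]
  calc ‖a‖ * ‖b‖ ≤ (C * Real.exp s) * (D * Real.exp t) :=
        mul_le_mul ha hb (norm_nonneg _) (by positivity)
    _ = _ := by ring

namespace Dichotomy

variable {P : ℝ → ℂ} {b : ℝ} {κ₁ κ₂ : ℂ}

/-- In the absence of bound states, the forced equation is uniformly solvable. -/
theorem exists_forcedSol (h : Dichotomy P b κ₁ κ₂) (hno : ∀ w w', ¬ IsBoundState P b w w') :
    ∃ C, 0 ≤ C ∧ ∀ f : ℝ → ℂ, Continuous f → ∀ M, 0 ≤ M →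
      (∀ y, ‖f y‖ ≤ M * Real.exp (b * y)) → ∃ w w', ForcedSol P f w w' ∧
        ∀ y, ‖w y‖ ≤ C * M * Real.exp (b * y) ∧ ‖w' y‖ ≤ C * M * Real.exp (b * y) := by
  obtain ⟨φ, φ', hφ, hφ0, C₁, hC₁, hφb⟩ := h.exists_left
  obtain ⟨ψ, ψ', hψ, ⟨C₂, hC₂, hψb⟩, hψ1, -⟩ := h.exists_right
  obtain ⟨B, hB⟩ := h.bounded
  have hb := h.pos
  set θ := expo κ₁.re κ₂.re with hθ
  beta_reduce at hφb hψb
  set s := min κ₁.re κ₂.re with hs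
  have hsb : b < s := lt_min h.lt_right h.lt_left
  have hθs : ∀ {t y : ℝ}, t ≤ y → θ t ≤ θ y - s * (y - t) := fun hty =>
    expo_le (min_le_left _ _) (min_le_right _ _) hty
  set W := φ 0 * ψ' 0 - φ' 0 * ψ 0 with hWdef
  have hW : ∀ y, φ y * ψ' y - φ' y * ψ y = W := fun y => hφ.wronskian hψ y 0
  -- A vanishing Wronskian would make the solutions decaying at the two ends proportional. The
  -- common solution would be a bound state, since κ₁ and κ₂ both have real part larger than b.
  have hW0 : W ≠ 0 := by
    intro hW0
    obtain ⟨y₀, hy₀⟩ := hφ0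
    obtain ⟨a, ha⟩ := hφ.eq_smul h.continuous hB hψ hy₀ hW0
    refine hno ψ ψ' ⟨hψ, exists_ne_zero_of_tendsto hψ1, ?_⟩
    refine boundedBy_of_halves (fun y => (Real.exp_pos _).le) ?_ ?_
    · refine ⟨C₂, fun y hy => ?_⟩
      have h1 : Real.exp (-θ y) ≤ Real.exp (b * y) := by
        rw [hθ, expo_of_nonneg _ _ hy, Real.exp_le_exp]
        nlinarith [h.lt_right]
      exact ⟨(hψb y).1.trans (mul_le_mul_of_nonneg_left h1 hC₂),
        (hψb y).2.trans (mul_le_mul_of_nonneg_left h1 hC₂)⟩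
    · refine ⟨‖a‖ * C₁, fun y hy => ?_⟩
      have h1 : Real.exp (θ y) ≤ Real.exp (b * y) := by
        rw [hθ, expo_of_nonpos _ _ hy, Real.exp_le_exp]
        nlinarith [h.lt_left]
      rw [(ha y).1, (ha y).2, norm_mul, norm_mul, mul_assoc]
      exact ⟨mul_le_mul_of_nonneg_left
          ((hφb y).1.trans (mul_le_mul_of_nonneg_left h1 hC₁)) (norm_nonneg _),
        mul_le_mul_of_nonneg_left
          ((hφb y).2.trans (mul_le_mul_of_nonneg_left h1 hC₁)) (norm_nonneg _)⟩
  have hδ : 0 < s + b := by linarith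
  have hδ' : 0 < s - b := by linarith
  refine ⟨‖W⁻¹‖ * (C₁ * C₂ / (s + b) + C₁ * C₂ / (s - b)), by positivity,
    fun f hf M hM hfM => ?_⟩
  have hl : ∀ y, IntegrableOn (fun t => φ t * f t) (Set.Iic y) ∧
      ‖∫ t in Set.Iic y, φ t * f t‖ ≤ C₁ * M / (s + b) * Real.exp (θ y + b * y) := by
    intro y
    have := setIntegral_le_of_left (F := fun t => φ t * f t) (hφ.continuous.mul hf) hδ
      (A := C₁ * M * Real.exp (θ y + b * y)) (by positivity) measurableSet_Iic
      (le_refl (Set.Iic y)) (fun t ht => by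
        have ht : t ≤ y := ht
        refine (norm_mul_le_of_exp hC₁ (hφb t).1 (hfM t)).trans ?_
        rw [mul_assoc _ (Real.exp _) (Real.exp _), ← Real.exp_add]
        refine mul_le_mul_of_nonneg_left (Real.exp_le_exp.2 ?_) (by positivity)
        linarith [hθs ht])
    exact ⟨this.1, this.2.trans (le_of_eq (by ring))⟩
  have hr : ∀ y, IntegrableOn (fun t => ψ t * f t) (Set.Ioi y) ∧
      ‖∫ t in Set.Ioi y, ψ t * f t‖ ≤ C₂ * M / (s - b) * Real.exp (-θ y + b * y) := by
    intro y
    have := setIntegral_le_of_right (F := fun t => ψ t * f t) (hψ.continuous.mul hf) hδ'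
      (A := C₂ * M * Real.exp (-θ y + b * y)) (by positivity) measurableSet_Ioi
      (le_refl (Set.Ioi y)) (fun t ht => by
        have ht : y < t := ht
        refine (norm_mul_le_of_exp hC₂ (hψb t).1 (hfM t)).trans ?_
        rw [mul_assoc _ (Real.exp _) (Real.exp _), ← Real.exp_add]
        refine mul_le_mul_of_nonneg_left (Real.exp_le_exp.2 ?_) (by positivity)
        linarith [hθs ht.le])
    exact ⟨this.1, this.2.trans (le_of_eq (by ring))⟩
  refine ⟨_, _, hφ.variation hψ hW hW0
    (hasDerivAt_integral_Iic (hφ.continuous.mul hf) fun y => (hl y).1)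
    (hasDerivAt_tail (hψ.continuous.mul hf) fun y => (hr y).1), fun y => ?_⟩
  -- The factor e^{∓θ} of each homogeneous solution cancels the e^{±θ} of the integral it
  -- multiplies, leaving e^{by}.
  have e1 : -θ y + (θ y + b * y) = b * y := by ring
  have e2 : θ y + (-θ y + b * y) = b * y := by ring
  constructor
  · refine (norm_combination_le (norm_mul_le_of_exp hC₂ (hψb y).1 (hl y).2)
      (norm_mul_le_of_exp hC₁ (hφb y).1 (hr y).2)).trans (le_of_eq ?_)
    rw [e1, e2]; ring
  · refine (norm_combination_le (norm_mul_le_of_exp hC₂ (hψb y).2 (hl y).2)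
      (norm_mul_le_of_exp hC₁ (hφb y).2 (hr y).2)).trans (le_of_eq ?_)
    rw [e1, e2]; ring

/-- If `φ` is a bound state, the forced equation is solvable as soon as the forcing is
orthogonal to `φ`. -/
theorem exists_forcedSol_of_orthogonal (h : Dichotomy P b κ₁ κ₂) {φ φ' : ℝ → ℂ}
    (hφs : IsBoundState P b φ φ') {f : ℝ → ℂ} (hf : Continuous f) {M : ℝ}
    (hfM : ∀ y, ‖f y‖ ≤ M * Real.exp (b * y)) (horth : ∫ t, φ t * f t = 0) :
    ∃ w w', ForcedSol P f w w' ∧ BoundedBy w w' fun y => Real.exp (b * y) := by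
  obtain ⟨C₁, hC₁, hφb⟩ := h.boundState_decay hφs
  obtain ⟨hφ, ⟨y₀, hy₀⟩, -⟩ := hφs
  obtain ⟨B, hB⟩ := h.bounded
  obtain ⟨ψ, ψ', hψ, hW⟩ := hφ.exists_companion h.continuous hB hy₀
  obtain ⟨C₂, hC₂, hψb⟩ := h.growth hψ
  have hb := h.pos
  have hM : 0 ≤ M := by
    have := (norm_nonneg _).trans (hfM 0)
    simpa using this
  have hr := h.lt_right
  have hl := h.lt_left
  beta_reduce at hφb hψb
  set θ := fun y => |expo κ₁.re κ₂.re y| with hθ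
  have hθr : ∀ {y : ℝ}, 0 ≤ y → θ y = κ₁.re * y := fun hy =>
    abs_expo_of_nonneg (by linarith) _ hy
  have hθl : ∀ {y : ℝ}, y ≤ 0 → θ y = -(κ₂.re * y) := fun hy =>
    abs_expo_of_nonpos _ (by linarith) hy
  set s := min κ₁.re κ₂.re with hs
  have hs₁ : s ≤ κ₁.re := min_le_left _ _
  have hs₂ : s ≤ κ₂.re := min_le_right _ _
  have hsb : b < s := lt_min hr hl
  have hδ : 0 < s + b := by linarith
  have hδ' : 0 < s - b := by linarith
  have hφf : ∀ t, ‖φ t * f t‖ ≤ C₁ * M * Real.exp (-θ t + b * t) := fun t =>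
    norm_mul_le_of_exp hC₁ (hφb t).1 (hfM t)
  have hψf : ∀ t, ‖ψ t * f t‖ ≤ C₂ * M * Real.exp (θ t + b * t) := fun t =>
    norm_mul_le_of_exp hC₂ (hψb t).1 (hfM t)
  have hcφ : Continuous (fun t => φ t * f t) := hφ.continuous.mul hf
  have hcψ : Continuous (fun t => ψ t * f t) := hψ.continuous.mul hf
  -- integrals over half-lines
  have hIl : ∀ y, y ≤ 0 → IntegrableOn (fun t => φ t * f t) (Set.Iic y) ∧
      ‖∫ t in Set.Iic y, φ t * f t‖ ≤ C₁ * M * Real.exp (-θ y + b * y) / (s + b) := by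
    intro y hy
    refine setIntegral_le_of_left hcφ hδ (by positivity) measurableSet_Iic le_rfl fun t ht => ?_
    have ht : t ≤ y := ht
    refine (hφf t).trans ?_
    rw [mul_assoc _ (Real.exp _) (Real.exp _), ← Real.exp_add, hθl hy, hθl (ht.trans hy)]
    refine mul_le_mul_of_nonneg_left (Real.exp_le_exp.2 ?_) (by positivity)
    nlinarith
  have hIr : ∀ y, 0 ≤ y → IntegrableOn (fun t => φ t * f t) (Set.Ioi y) ∧
      ‖∫ t in Set.Ioi y, φ t * f t‖ ≤ C₁ * M * Real.exp (-θ y + b * y) / (s - b) := by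
    intro y hy
    refine setIntegral_le_of_right hcφ hδ' (by positivity) measurableSet_Ioi le_rfl fun t ht => ?_
    have ht : y < t := ht
    refine (hφf t).trans ?_
    rw [mul_assoc _ (Real.exp _) (Real.exp _), ← Real.exp_add, hθr hy, hθr (hy.trans ht.le)]
    refine mul_le_mul_of_nonneg_left (Real.exp_le_exp.2 ?_) (by positivity)
    nlinarith
  have hint : Integrable (fun t => φ t * f t) := by
    rw [← integrableOn_univ, ← Set.Iic_union_Ioi (a := (0:ℝ))]
    exact (hIl 0 le_rfl).1.union (hIr 0 le_rfl).1
  -- For y ≥ 0, orthogonality replaces the integral over (−∞, y] by minus the one over (y, ∞). The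
  -- integral therefore compensates the growth of ψ at both ends.
  have hI : ∀ y, ‖∫ t in Set.Iic y, φ t * f t‖ ≤
      C₁ * M / (s - b) * Real.exp (-θ y + b * y) := by
    intro y
    rcases le_total 0 y with hy | hy
    · have e := integral_add_compl (measurableSet_Iic (a := y)) hint
      rw [Set.compl_Iic, horth] at e
      rw [eq_neg_of_add_eq_zero_left e, norm_neg]
      exact (hIr y hy).2.trans (le_of_eq (by ring))
    · refine (hIl y hy).2.trans ?_
      rw [div_mul_eq_mul_div]
      gcongr
      linarith
  -- The companion ψ may grow in both directions, so its integral is based at 0 and is dominated by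
  -- the contribution near y.
  have hJ : ∀ y, ‖-∫ t in (0:ℝ)..y, ψ t * f t‖ ≤
      C₂ * M / (s - b) * Real.exp (θ y + b * y) := by
    intro y
    rw [norm_neg]
    rcases le_total 0 y with hy | hy
    · rw [intervalIntegral.integral_of_le hy]
      have := (setIntegral_le_of_left (A := C₂ * M * Real.exp (θ y + b * y)) hcψ hδ
        (by positivity) (measurableSet_Ioc (a := (0:ℝ)) (b := y)) (fun t ht => ht.2)
        fun t ht => ?_).2
      · refine this.trans ?_
        rw [div_mul_eq_mul_div]
        gcongr
        linarith
      · refine (hψf t).trans ?_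
        rw [mul_assoc _ (Real.exp _) (Real.exp _), ← Real.exp_add, hθr hy, hθr ht.1.le]
        refine mul_le_mul_of_nonneg_left (Real.exp_le_exp.2 ?_) (by positivity)
        nlinarith [ht.2]
    · rw [intervalIntegral.integral_of_ge hy, norm_neg]
      have := (setIntegral_le_of_right (A := C₂ * M * Real.exp (θ y + b * y)) hcψ hδ'
        (by positivity) (measurableSet_Ioc (a := y) (b := (0:ℝ))) (fun t ht => ht.1)
        fun t ht => ?_).2
      · exact this.trans (le_of_eq (by ring))
      · refine (hψf t).trans ?_
        rw [mul_assoc _ (Real.exp _) (Real.exp _), ← Real.exp_add, hθl hy, hθl ht.2]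
        refine mul_le_mul_of_nonneg_left (Real.exp_le_exp.2 ?_) (by positivity)
        nlinarith [ht.1]
  refine ⟨_, _, hφ.variation hψ hW one_ne_zero
    (hasDerivAt_integral_Iic hcφ fun y => hint.integrableOn)
    (fun y => (hcψ.integral_hasStrictDerivAt 0 y).hasDerivAt.fun_neg),
    ‖(1:ℂ)⁻¹‖ * (C₂ * (C₁ * M / (s - b)) + C₁ * (C₂ * M / (s - b))), by positivity,
    fun y => ?_⟩
  have e1 : θ y + (-θ y + b * y) = b * y := by ring
  have e2 : -θ y + (θ y + b * y) = b * y := by ring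
  constructor
  · refine (norm_combination_le (norm_mul_le_of_exp hC₂ (hψb y).1 (hI y))
      (norm_mul_le_of_exp hC₁ (hφb y).1 (hJ y))).trans (le_of_eq ?_)
    rw [e1, e2]; ring
  · refine (norm_combination_le (norm_mul_le_of_exp hC₂ (hψb y).2 (hI y))
      (norm_mul_le_of_exp hC₁ (hφb y).2 (hJ y))).trans (le_of_eq ?_)
    rw [e1, e2]; ring

end Dichotomy

/-! ### Primitives and weak derivatives -/

/-- `U` is a primitive of `v`. -/
def IsPrimitive (U v : ℝ → ℂ) : Prop := ∀ a b, U b - U a = ∫ t in a..b, v t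

theorem intervalIntegrable_of_locallyIntegrable {v : ℝ → ℂ} (hv : LocallyIntegrable v volume)
    (a b : ℝ) : IntervalIntegrable v volume a b :=
  intervalIntegrable_iff.2
    ((hv.integrableOn_isCompact isCompact_uIcc).mono_set Set.uIoc_subset_uIcc)

theorem isPrimitive_integral {v : ℝ → ℂ} (hv : LocallyIntegrable v volume) (c : ℝ) :
    IsPrimitive (fun x => ∫ t in c..x, v t) v := fun a b =>
  intervalIntegral.integral_interval_sub_left (intervalIntegrable_of_locallyIntegrable hv c b)
    (intervalIntegrable_of_locallyIntegrable hv c a)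

theorem IsPrimitive.eq {U v : ℝ → ℂ} (h : IsPrimitive U v) (c x : ℝ) :
    U x = U c + ∫ t in c..x, v t := by rw [← h c x]; ring

theorem IsPrimitive.continuous {U v : ℝ → ℂ} (h : IsPrimitive U v)
    (hv : LocallyIntegrable v volume) : Continuous U := by
  have e : U = fun x => U 0 + ∫ t in (0:ℝ)..x, v t := funext (h.eq 0)
  rw [e]
  exact continuous_const.add (intervalIntegral.continuous_primitive
    (intervalIntegrable_of_locallyIntegrable hv) 0)

theorem IsPrimitive.hasDerivAt {U v : ℝ → ℂ} (h : IsPrimitive U v) (hv : Continuous v) (y : ℝ) :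
    HasDerivAt U (v y) y := by
  have e : U = fun x => U 0 + ∫ t in (0:ℝ)..x, v t := funext (h.eq 0)
  rw [e]
  exact (hv.integral_hasStrictDerivAt 0 y).hasDerivAt.const_add _

theorem isPrimitive_of_hasDerivAt {U v : ℝ → ℂ} (h : ∀ y, HasDerivAt U (v y) y)
    (hv : Continuous v) : IsPrimitive U v := fun a b =>
  (intervalIntegral.integral_eq_sub_of_hasDerivAt (fun x _ => h x)
    (hv.intervalIntegrable a b)).symm

theorem IsPrimitive.congr {U v w : ℝ → ℂ} (h : IsPrimitive U v) (hvw : v =ᵐ[volume] w) :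
    IsPrimitive U w := fun a b => by
  rw [h a b]
  exact intervalIntegral.integral_congr_ae (hvw.mono fun x hx _ => hx)

theorem absolutelyContinuous_const (c : ℂ) (a b : ℝ) :
    AbsolutelyContinuousOnInterval (fun _ : ℝ => c) a b :=
  (contDiff_const (n := 1)).contDiffOn.absolutelyContinuousOnInterval

/-- Real and imaginary parts are treated separately and recombined with the constants 1 and i. -/
theorem IsPrimitive.absolutelyContinuous {U v : ℝ → ℂ} (h : IsPrimitive U v)
    (hv : LocallyIntegrable v volume) (a b : ℝ) : AbsolutelyContinuousOnInterval U a b := by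
  have hi := intervalIntegrable_of_locallyIntegrable hv a b
  have hre : IntervalIntegrable (fun t => (v t).re) volume a b := ⟨hi.1.re, hi.2.re⟩
  have him : IntervalIntegrable (fun t => (v t).im) volume a b := ⟨hi.1.im, hi.2.im⟩
  have h1 := (hre.absolutelyContinuousOnInterval_intervalIntegral
    (Set.left_mem_uIcc (a := a) (b := b))).fun_smul (absolutelyContinuous_const 1 a b)
  have h2 := (him.absolutelyContinuousOnInterval_intervalIntegral
    (Set.left_mem_uIcc (a := a) (b := b))).fun_smul (absolutelyContinuous_const Complex.I a b)
  have h3 := (absolutelyContinuous_const (U a) a b).fun_add (h1.fun_add h2)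
  have e : U = fun x => U a + ((∫ t in a..x, (v t).re) • (1:ℂ) +
      (∫ t in a..x, (v t).im) • Complex.I) := by
    funext x
    rw [h.eq a x]
    congr 1
    have hix := intervalIntegrable_of_locallyIntegrable hv a x
    apply Complex.ext
    · have := Complex.reCLM.intervalIntegral_comp_comm hix
      simp only [Complex.reCLM_apply] at this
      simp [← this]
    · have := Complex.imCLM.intervalIntegral_comp_comm hix
      simp only [Complex.imCLM_apply] at this
      simp [← this]
  rw [e]
  exact h3

theorem IsPrimitive.ae_hasDerivAt {U v : ℝ → ℂ} (h : IsPrimitive U v)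
    (hv : LocallyIntegrable v volume) : ∀ᵐ x, HasDerivAt U (v x) x := by
  filter_upwards [LocallyIntegrable.ae_hasDerivAt_integral hv] with x hx
  have e : U = fun x => U 0 + ∫ t in (0:ℝ)..x, v t := funext (h.eq 0)
  rw [e]
  exact (hx 0).const_add _

theorem exists_support_subset {φ : ℝ → ℝ} (h : HasCompactSupport φ) :
    ∃ R, 0 < R ∧ ∀ x, R ≤ |x| → φ x = 0 ∧ deriv φ x = 0 := by
  obtain ⟨R, hR⟩ := h.isCompact.isBounded.subset_ball 0
  refine ⟨max R 1, by positivity, fun x hx => ?_⟩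
  have hx' : x ∉ tsupport φ := fun hc => by
    have := hR hc
    rw [Metric.mem_ball, dist_zero_right, Real.norm_eq_abs] at this
    exact absurd (this.trans_le (le_max_left _ _)) (not_lt.2 hx)
  exact ⟨image_eq_zero_of_notMem_tsupport hx',
    image_eq_zero_of_notMem_tsupport fun hc => hx' (tsupport_deriv_subset hc)⟩

theorem integral_eq_interval_of_vanish {f : ℝ → ℂ} {R : ℝ} (hR : 0 < R)
    (h : ∀ x, R ≤ |x| → f x = 0) : ∫ x, f x = ∫ x in (-R)..R, f x := by
  rw [intervalIntegral.integral_of_le (by linarith)]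
  refine (setIntegral_eq_integral_of_forall_compl_eq_zero fun x hx => h x ?_).symm
  rw [Set.mem_Ioc, not_and_or, not_lt, not_le] at hx
  rcases hx with hx | hx
  · rw [abs_of_nonpos (by linarith)]; linarith
  · rw [abs_of_pos (by linarith)]; exact hx.le

/-- Integration by parts against a test function. -/
theorem IsPrimitive.integral_deriv_smul {U v : ℝ → ℂ} (h : IsPrimitive U v)
    (hv : LocallyIntegrable v volume) {φ : ℝ → ℝ} (hφ : ContDiff ℝ ∞ φ)
    (hφc : HasCompactSupport φ) : ∫ x, deriv φ x • U x = -∫ x, φ x • v x := by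
  obtain ⟨R, hR, hφR⟩ := exists_support_subset hφc
  have hd : Continuous (deriv φ) := hφ.continuous_deriv (by simp)
  have hU := h.continuous hv
  have hvi := intervalIntegrable_of_locallyIntegrable hv
  rw [integral_eq_interval_of_vanish (f := fun x => deriv φ x • U x) hR
      fun x hx => by simp [(hφR x hx).2],
    integral_eq_interval_of_vanish (f := fun x => φ x • v x) hR
      fun x hx => by simp [(hφR x hx).1]]
  set w : ℝ → ℂ := fun x => deriv φ x • U x + φ x • v x with hw
  have hw1 : ∀ a b, IntervalIntegrable (fun x => deriv φ x • U x) volume a b := fun a b =>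
    (hd.smul hU).intervalIntegrable a b
  have hw2 : ∀ a b, IntervalIntegrable (fun x => φ x • v x) volume a b := fun a b =>
    (hvi a b).continuousOn_smul hφ.continuous.continuousOn
  have hwl : LocallyIntegrable w volume := by
    refine (hd.smul hU).locallyIntegrable.add ?_
    exact hv.continuous_smul hφ.continuous
  -- The function φU − ∫(φ'U + φv) is absolutely continuous with zero derivative almost everywhere,
  -- hence constant. Comparing its values at ±R, where φ vanishes, gives the formula.
  have hG : AbsolutelyContinuousOnInterval
      (fun x => φ x • U x - ∫ t in (-R)..x, w t) (-R) R := by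
    refine AbsolutelyContinuousOnInterval.fun_sub (AbsolutelyContinuousOnInterval.fun_smul ?_
      (h.absolutelyContinuous hv _ _)) ((isPrimitive_integral hwl _).absolutelyContinuous hwl _ _)
    exact (hφ.of_le (by simp)).contDiffOn.absolutelyContinuousOnInterval
  obtain ⟨C, hC⟩ := hG.const_of_ae_hasDerivAt_zero (by
    filter_upwards [h.ae_hasDerivAt hv,
      (isPrimitive_integral hwl (-R)).ae_hasDerivAt hwl] with x h1 h2 _
    have h3 := ((hφ.differentiable (by simp)).differentiableAt (x := x)).hasDerivAt
    refine ((h3.fun_smul h1).fun_sub h2).congr_deriv ?_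
    simp only [hw]
    abel)
  have e1 := hC (-R) Set.left_mem_uIcc
  have e2 := hC R Set.right_mem_uIcc
  rw [← e1] at e2
  simp only [(hφR R (le_abs_self R)).1, (hφR (-R) (by rw [abs_neg]; exact le_abs_self R)).1,
    zero_smul, intervalIntegral.integral_same, zero_sub, neg_zero, neg_eq_zero] at e2
  rw [hw, intervalIntegral.integral_add (hw1 _ _) (hw2 _ _)] at e2
  exact eq_neg_of_add_eq_zero_left e2

/-- The lemma of du Bois-Reymond. -/
theorem ae_const_of_integral_deriv_smul {z : ℝ → ℂ} (hz : LocallyIntegrable z volume)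
    (h : ∀ φ : ℝ → ℝ, ContDiff ℝ ∞ φ → HasCompactSupport φ → ∫ x, deriv φ x • z x = 0) :
    ∃ c : ℂ, z =ᵐ[volume] fun _ => c := by
  let B : ContDiffBump (0:ℝ) := ⟨1, 2, one_pos, one_lt_two⟩
  set χ : ℝ → ℝ := B.normed volume with hχ
  have hχs : ContDiff ℝ ∞ χ := B.contDiff_normed
  have hχc : HasCompactSupport χ := B.hasCompactSupport_normed
  have hχi : ∫ x, χ x = 1 := B.integral_normed
  refine ⟨∫ x, χ x • z x, ae_eq_of_integral_contDiff_smul_eq hz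
    (locallyIntegrable_const _) fun φ hφ hφc => ?_⟩
  set m := ∫ x, φ x with hm
  -- Subtracting m times a bump of integral 1 makes the mean zero, so the primitive of η has compact
  -- support and is an admissible test function.
  set η : ℝ → ℝ := fun x => φ x - m * χ x with hη
  have hηs : ContDiff ℝ ∞ η := hφ.sub (contDiff_const.mul hχs)
  obtain ⟨R₁, hR₁, h1⟩ := exists_support_subset hφc
  obtain ⟨R₂, hR₂, h2⟩ := exists_support_subset hχc
  set R := max R₁ R₂ with hR
  have hR0 : 0 < R := hR₁.trans_le (le_max_left _ _)
  have hηR : ∀ x, R ≤ |x| → η x = 0 := fun x hx => by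
    simp [hη, (h1 x ((le_max_left _ _).trans hx)).1, (h2 x ((le_max_right _ _).trans hx)).1]
  have hφi : Integrable φ := hφ.continuous.integrable_of_hasCompactSupport hφc
  have hχint : Integrable χ := hχs.continuous.integrable_of_hasCompactSupport hχc
  have hηi : ∫ x, η x = 0 := by
    rw [integral_sub hφi (hχint.const_mul m), integral_const_mul, hχi]; simp [hm]
  have hηint : Integrable η := hφi.sub (hχint.const_mul m)
  set ψ : ℝ → ℝ := fun x => ∫ t in (-R)..x, η t with hψ
  have hψd : ∀ x, HasDerivAt ψ (η x) x := fun x =>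
    (hηs.continuous.integral_hasStrictDerivAt _ x).hasDerivAt
  have hψd' : deriv ψ = η := funext fun x => (hψd x).deriv
  have hψs : ContDiff ℝ ∞ ψ :=
    contDiff_infty_iff_deriv.2 ⟨fun x => (hψd x).differentiableAt, by rwa [hψd']⟩
  have hψR : ∀ x, R ≤ |x| → ψ x = 0 := by
    intro x hx
    rcases le_total 0 x with h0 | h0
    · rw [abs_of_nonneg h0] at hx
      rw [hψ, ← hηi]
      simp only
      rw [intervalIntegral.integral_of_le (by linarith)]
      refine setIntegral_eq_integral_of_forall_compl_eq_zero fun y hy => hηR y ?_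
      rw [Set.mem_Ioc, not_and_or, not_lt, not_le] at hy
      rcases hy with hy | hy
      · rw [abs_of_nonpos (by linarith)]; linarith
      · rw [abs_of_pos (by linarith)]; linarith
    · rw [abs_of_nonpos h0] at hx
      simp only [hψ]
      rw [intervalIntegral.integral_symm, neg_eq_zero]
      refine (intervalIntegral.integral_congr (g := fun _ => (0:ℝ)) fun y hy => hηR y ?_).trans
        (by simp)
      rw [Set.uIcc_of_le (by linarith)] at hy
      rw [abs_of_nonpos (by linarith [hy.2])]
      linarith [hy.2]
  have hψc : HasCompactSupport ψ := by
    refine HasCompactSupport.intro (isCompact_Icc (a := -R) (b := R)) fun x hx => hψR x ?_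
    by_contra! hc
    exact hx (abs_le.1 hc.le)
  have key := h ψ hψs hψc
  rw [hψd'] at key
  have hz1 : Integrable (fun x => φ x • z x) :=
    hz.integrable_smul_left_of_hasCompactSupport hφ.continuous hφc
  have hz2 : Integrable (fun x => χ x • z x) :=
    hz.integrable_smul_left_of_hasCompactSupport hχs.continuous hχc
  have e : ∫ x, η x • z x = (∫ x, φ x • z x) - m • ∫ x, χ x • z x := by
    have hz3 : Integrable (fun x => m • χ x • z x) := hz2.smul m
    rw [← integral_smul, ← integral_sub hz1 hz3]
    refine integral_congr_ae (Eventually.of_forall fun x => ?_)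
    simp only [hη, sub_smul, mul_smul]
  rw [e, sub_eq_zero] at key
  rw [key, integral_smul_const]

/-- The difference between u and a primitive of v has zero weak derivative, hence is constant almost
everywhere. -/
theorem exists_primitive_of_weakDeriv {u v : ℝ → ℂ} (hu : LocallyIntegrable u volume)
    (hv : LocallyIntegrable v volume)
    (h : ∀ φ : ℝ → ℝ, ContDiff ℝ ∞ φ → HasCompactSupport φ →
      ∫ x, deriv φ x • u x = - ∫ x, φ x • v x) :
    ∃ U, u =ᵐ[volume] U ∧ IsPrimitive U v := by
  set K : ℝ → ℂ := fun x => ∫ t in (0:ℝ)..x, v t with hK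
  have hKp : IsPrimitive K v := isPrimitive_integral hv 0
  have hKl : LocallyIntegrable K volume := (hKp.continuous hv).locallyIntegrable
  obtain ⟨c, hc⟩ := ae_const_of_integral_deriv_smul (hu.sub hKl) fun φ hφ hφc => by
    have hd : Continuous (deriv φ) := hφ.continuous_deriv (by simp)
    simp only [Pi.sub_apply, smul_sub]
    rw [integral_sub (hu.integrable_smul_left_of_hasCompactSupport hd hφc.deriv)
      (hKl.integrable_smul_left_of_hasCompactSupport hd hφc.deriv), h φ hφ hφc,
      hKp.integral_deriv_smul hv hφ hφc, sub_self]
  refine ⟨fun x => K x + c, ?_, fun a b => by rw [← hKp a b]; ring⟩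
  filter_upwards [hc] with x hx
  rw [← hx]
  simp

/-! ### Estimates in uniformly local spaces -/

/-- By Cauchy–Schwarz on an interval of length at most 1. The factor √|b − a| is kept because it
provides a modulus of continuity for primitives of L²_ul functions. -/
theorem norm_integral_le_ulNorm {F : ℝ → ℂ} (hF : AEStronglyMeasurable F volume)
    (hF' : ulNorm F < ⊤) {a b : ℝ} (hab : |b - a| ≤ 1) :
    ‖∫ t in a..b, F t‖ ≤ √|b - a| * (ulNorm F).toReal := by
  have hsub : Set.uIoc a b ⊆ Set.Icc (min a b) (min a b + 1) := fun x hx => by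
    have h1 := hx.1
    have h2 := hx.2
    refine ⟨h1.le, h2.trans ?_⟩
    have := max_sub_min_eq_abs a b
    rw [abs_sub_comm] at hab
    rw [abs_sub_comm b a] at this
    linarith
  have hvol : volume (Set.uIoc a b) = ENNReal.ofReal |b - a| := by
    rw [Set.uIoc, Real.volume_Ioc, max_sub_min_eq_abs]
  have h1 : eLpNorm F 1 (volume.restrict (Set.uIoc a b)) ≤
      ulNorm F * ENNReal.ofReal √|b - a| := by
    refine (eLpNorm_le_eLpNorm_mul_rpow_measure_univ (q := 2) (by norm_num)
      hF.restrict).trans ?_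
    refine mul_le_mul' ?_ (le_of_eq ?_)
    · exact (eLpNorm_mono_measure _ (Measure.restrict_mono hsub le_rfl)).trans
        (le_iSup (fun ξ : ℝ => eLpNorm F 2 (volume.restrict (Set.Icc ξ (ξ + 1)))) (min a b))
    · rw [Measure.restrict_apply MeasurableSet.univ, Set.univ_inter, hvol, Real.sqrt_eq_rpow,
        ENNReal.ofReal_rpow_of_nonneg (abs_nonneg _) (by norm_num)]
      norm_num
  have h2 : ‖∫ t in a..b, F t‖ₑ ≤ ulNorm F * ENNReal.ofReal √|b - a| := by
    refine le_trans ?_ h1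
    rw [eLpNorm_one_eq_lintegral_enorm, ← ofReal_norm,
      intervalIntegral.norm_integral_eq_norm_integral_uIoc, ofReal_norm]
    exact enorm_integral_le_lintegral_enorm _
  have h3 := ENNReal.toReal_mono (ENNReal.mul_lt_top hF' ENNReal.ofReal_lt_top).ne h2
  rw [toReal_enorm, ENNReal.toReal_mul, ENNReal.toReal_ofReal (Real.sqrt_nonneg _)] at h3
  linarith

theorem norm_integral_le_ulNorm' {F : ℝ → ℂ} (hF : AEStronglyMeasurable F volume)
    (hF' : ulNorm F < ⊤) {a b : ℝ} (hab : |b - a| ≤ 1) :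
    ‖∫ t in a..b, F t‖ ≤ (ulNorm F).toReal := by
  refine (norm_integral_le_ulNorm hF hF' hab).trans ?_
  exact mul_le_of_le_one_left ENNReal.toReal_nonneg (Real.sqrt_le_one.2 hab)

theorem ulNorm_le_of_bound {u : ℝ → ℂ} {C : ℝ} (h : ∀ x, ‖u x‖ ≤ C) :
    ulNorm u ≤ ENNReal.ofReal C := by
  refine iSup_le fun ξ => ?_
  refine (eLpNorm_le_of_ae_bound (Eventually.of_forall h)).trans ?_
  rw [Measure.restrict_apply MeasurableSet.univ, Set.univ_inter, Real.volume_Icc]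
  simp

/-- Continuity of translations, which is part of membership in L²_ul, follows here already in the
sup norm. -/
theorem memL2ul_of_uniformContinuous {u : ℝ → ℂ} {C : ℝ} (h : ∀ x, ‖u x‖ ≤ C)
    (hu : UniformContinuous u) : MemL2ul u := by
  refine ⟨(ulNorm_le_of_bound h).trans_lt ENNReal.ofReal_lt_top, ?_⟩
  rw [ENNReal.tendsto_nhds_zero]
  intro ε hε
  by_cases hεt : ε = ⊤
  · exact Eventually.of_forall fun _ => hεt ▸ le_top
  have hpos : 0 < ε.toReal := ENNReal.toReal_pos hε.ne' hεt
  obtain ⟨δ, hδ, hd⟩ := Metric.uniformContinuous_iff.1 hu ε.toReal hpos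
  filter_upwards [Metric.ball_mem_nhds (0 : ℝ) hδ] with ξ hξ
  rw [← ENNReal.ofReal_toReal hεt]
  refine ulNorm_le_of_bound fun x => ?_
  rw [← dist_eq_norm]
  refine (hd ?_).le
  rw [Real.dist_eq]
  simpa [Real.dist_eq] using hξ

theorem uniformContinuous_of_modulus {U : ℝ → ℂ} {A B : ℝ}
    (h : ∀ a b, |b - a| ≤ 1 → ‖U b - U a‖ ≤ A * √|b - a| + B * |b - a|) :
    UniformContinuous U := by
  rw [Metric.uniformContinuous_iff]
  intro ε hε
  have hl : Tendsto (fun t : ℝ => A * √|t| + B * |t|) (𝓝 0) (𝓝 0) := by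
    have : Continuous (fun t : ℝ => A * √|t| + B * |t|) := by fun_prop
    simpa using this.tendsto 0
  obtain ⟨δ, hδ, hd⟩ := Metric.eventually_nhds_iff.1 (hl.eventually (gt_mem_nhds hε))
  refine ⟨min δ 1, by positivity, fun {a b} hab => ?_⟩
  rw [Real.dist_eq] at hab
  rw [dist_eq_norm]
  refine (h b a (hab.le.trans (min_le_right _ _))).trans_lt (hd ?_)
  rw [dist_zero_right, Real.norm_eq_abs]
  exact hab.trans_le (min_le_left _ _)

theorem locallyIntegrable_coe (u : Hul 0) : LocallyIntegrable (u : Fn) volume :=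
  locallyIntegrable_of_mem u.2

theorem ulNorm_lt_top {k : ℕ} (u : Hul k) : ulNorm (u : Fn) < ⊤ := (Hul_le k u.2).1

/-- The continuous representative of a function with a weak derivative. -/
theorem exists_representative {u v : Fn} (hu : u ∈ L2ul) (hv : v ∈ L2ul)
    (h : HasWeakDeriv u v) : ∃ U : ℝ → ℂ, (u : ℝ → ℂ) =ᵐ[volume] U ∧ IsPrimitive U v ∧
      ∃ C, ∀ y, ‖U y‖ ≤ C := by
  have hvl := locallyIntegrable_of_mem hv
  obtain ⟨U, hU, hUv⟩ := exists_primitive_of_weakDeriv (locallyIntegrable_of_mem hu) hvl h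
  refine ⟨U, hU, hUv, (ulNorm u).toReal + (ulNorm v).toReal, fun y => ?_⟩
  have hUc := hUv.continuous hvl
  have h1 : ‖∫ t in y..y + 1, U t‖ ≤ (ulNorm u).toReal := by
    rw [ulNorm_congr hU]
    exact norm_integral_le_ulNorm' hUc.aestronglyMeasurable
      (by rw [← ulNorm_congr hU]; exact hu.1) (by simp)
  have h2 : ‖∫ t in y..y + 1, (U t - U y)‖ ≤ (ulNorm v).toReal := by
    refine (intervalIntegral.norm_integral_le_of_norm_le_const
      (C := (ulNorm v).toReal) fun t ht => ?_).trans (le_of_eq (by simp))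
    rw [Set.uIoc_of_le (by linarith)] at ht
    rw [hUv y t]
    refine norm_integral_le_ulNorm' v.aesm hv.1 ?_
    rw [abs_of_pos (by linarith [ht.1])]
    linarith [ht.2]
  -- Pointwise control from local averages: U(y) is the mean of U over [y, y + 1] minus the mean of
  -- its increments, which are integrals of v over intervals of length at most 1.
  have e : U y = (∫ t in y..y + 1, U t) - ∫ t in y..y + 1, (U t - U y) := by
    rw [intervalIntegral.integral_sub (hUc.intervalIntegrable _ _) (by simp)]
    simp
  rw [e]
  exact (norm_sub_le _ _).trans (add_le_add h1 h2)

/-- A locally integrable function with bounded local integrals is, up to a bounded continuous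
function, the second derivative of a bounded function. -/
theorem exists_regularization {F : ℝ → ℂ} (hF : LocallyIntegrable F volume) {M : ℝ}
    (hM : ∀ a b, |b - a| ≤ 1 → ‖∫ t in a..b, F t‖ ≤ M) :
    ∃ u u' r : ℝ → ℂ, Continuous r ∧ (∀ y, HasDerivAt u (u' y) y) ∧
      IsPrimitive u' (fun t => F t - r t) ∧
      ∀ y, ‖u y‖ ≤ M ∧ ‖u' y‖ ≤ 2 * M ∧ ‖r y‖ ≤ 3 * M := by
  -- Subtract from a primitive K of F its moving average A over [x, x + 1]. The difference Φ is an
  -- average of increments of K and so is bounded, and A' = K(·+1) − K =: r is bounded as well,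
  -- although K itself may be unbounded.
  have step : ∀ F : ℝ → ℂ, LocallyIntegrable F volume →
      (∀ a b, |b - a| ≤ 1 → ‖∫ t in a..b, F t‖ ≤ M) →
      ∃ Φ r : ℝ → ℂ, Continuous Φ ∧ Continuous r ∧ IsPrimitive Φ (fun t => F t - r t) ∧
        (∀ y, ‖Φ y‖ ≤ M ∧ ‖r y‖ ≤ M) ∧ ∀ y, r y = ∫ t in y..y + 1, F t := by
    intro F hF hM
    set K : ℝ → ℂ := fun x => ∫ t in (0:ℝ)..x, F t with hK
    have hKp : IsPrimitive K F := isPrimitive_integral hF 0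
    have hKc : Continuous K := hKp.continuous hF
    set A : ℝ → ℂ := fun x => ∫ t in x..x + 1, K t with hA
    set r : ℝ → ℂ := fun x => K (x + 1) - K x with hr
    have hrc : Continuous r := by fun_prop
    have hAd : ∀ x, HasDerivAt A (r x) x := by
      intro x
      have h1 := (hKc.integral_hasStrictDerivAt 0 (x + 1)).hasDerivAt.comp_add_const x 1
      have h2 := (hKc.integral_hasStrictDerivAt 0 x).hasDerivAt
      have e : A = fun x => (∫ t in (0:ℝ)..x + 1, K t) - ∫ t in (0:ℝ)..x, K t := by
        funext x
        exact (intervalIntegral.integral_interval_sub_left (hKc.intervalIntegrable _ _)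
          (hKc.intervalIntegrable _ _)).symm
      rw [e]
      exact h1.fun_sub h2
    have hAc : Continuous A := continuous_iff_continuousAt.2 fun x => (hAd x).continuousAt
    refine ⟨fun x => K x - A x, r, hKc.sub hAc, hrc, fun a b => ?_, fun y => ⟨?_, ?_⟩,
      fun y => hKp y (y + 1)⟩
    · rw [intervalIntegral.integral_sub (intervalIntegrable_of_locallyIntegrable hF a b)
        (hrc.intervalIntegrable a b), ← hKp a b, ← isPrimitive_of_hasDerivAt hAd hrc a b]
      ring
    · have e : K y - A y = -∫ t in y..y + 1, (K t - K y) := by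
        rw [intervalIntegral.integral_sub (hKc.intervalIntegrable _ _) (by simp)]
        simp [hA]
      beta_reduce
      rw [e, norm_neg]
      refine (intervalIntegral.norm_integral_le_of_norm_le_const
        (C := M) fun t ht => ?_).trans (le_of_eq (by simp))
      rw [Set.uIoc_of_le (by linarith)] at ht
      rw [hKp y t]
      refine hM _ _ ?_
      rw [abs_of_pos (by linarith [ht.1])]
      linarith [ht.2]
    · simp only [hr]
      rw [hKp y (y + 1)]
      exact hM _ _ (by simp)
  obtain ⟨Φ, r₁, hΦ, hr₁, hΦF, hb₁, -⟩ := step F hF hM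
  obtain ⟨u, r₂, hu, hr₂, huΦ, hb₂, hr₂e⟩ := step Φ hΦ.locallyIntegrable fun a b hab => by
    refine (intervalIntegral.norm_integral_le_of_norm_le_const fun t _ => (hb₁ t).1).trans ?_
    exact mul_le_of_le_one_right ((norm_nonneg _).trans (hb₁ 0).1) hab
  -- The second remainder is a moving integral of the continuous function Φ, hence differentiable.
  -- Thus u' = Φ − r₂ is again a primitive, and the final remainder r₁ + Φ(·+1) − Φ is continuous
  -- and bounded by 3M.
  have hr₂p : IsPrimitive r₂ fun t => Φ (t + 1) - Φ t := by
    refine isPrimitive_of_hasDerivAt (fun x => ?_) (by fun_prop)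
    have h1 := (hΦ.integral_hasStrictDerivAt 0 (x + 1)).hasDerivAt.comp_add_const x 1
    have h2 := (hΦ.integral_hasStrictDerivAt 0 x).hasDerivAt
    have e : r₂ = fun x => (∫ t in (0:ℝ)..x + 1, Φ t) - ∫ t in (0:ℝ)..x, Φ t := by
      funext x
      rw [hr₂e]
      exact (intervalIntegral.integral_interval_sub_left (hΦ.intervalIntegrable _ _)
        (hΦ.intervalIntegrable _ _)).symm
    rw [e]
    exact h1.fun_sub h2
  refine ⟨u, fun y => Φ y - r₂ y, fun t => r₁ t + (Φ (t + 1) - Φ t), by fun_prop,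
    huΦ.hasDerivAt (hΦ.sub hr₂), fun a b => ?_, fun y => ⟨(hb₂ y).1, ?_, ?_⟩⟩
  · have hc : Continuous fun t => Φ (t + 1) - Φ t := by fun_prop
    have e : ∫ t in a..b, (F t - (r₁ t + (Φ (t + 1) - Φ t))) =
        (∫ t in a..b, (F t - r₁ t)) - ∫ t in a..b, (Φ (t + 1) - Φ t) := by
      rw [← intervalIntegral.integral_sub
        ((intervalIntegrable_of_locallyIntegrable hF a b).sub (hr₁.intervalIntegrable a b))
        (hc.intervalIntegrable a b)]
      exact intervalIntegral.integral_congr fun t _ => by ring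
    rw [e, ← hΦF a b, ← hr₂p a b]
    ring
  · refine (norm_sub_le _ _).trans ?_
    linarith [(hb₁ y).1, (hb₂ y).2]
  · refine (norm_add_le _ _).trans ?_
    have := norm_sub_le (Φ (y + 1)) (Φ y)
    linarith [(hb₁ y).1, (hb₁ (y + 1)).1, (hb₁ y).2]

/-! ### The reduced operator `u'' + 2 β u' - (g + q) u` -/

/-- The operator `u ↦ u'' + 2 β u' - g u - q u` from `H²_ul` to `L²_ul`. -/
def reducedOp (β q : ℂ) (g : ℝ → ℝ) (hg : IsBUC g) : Hul 2 →ₗ[ℂ] Hul 0 :=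
  (wderiv 0 ∘ₗ wderiv 1) + (2 * β) • (incl 0 ∘ₗ wderiv 1)
    - (mulCoeff g hg ∘ₗ incl 0 ∘ₗ incl 1) - q • (incl 0 ∘ₗ incl 1)

theorem Fn.coeFn_sub (u v : Fn) : ((u - v : Fn) : ℝ → ℂ) =ᵐ[volume] fun x => u x - v x :=
  AEEqFun.coeFn_sub (γ := ℂ) u v

theorem mulCoeff_coe (g : ℝ → ℝ) (hg : IsBUC g) (u : Hul 0) :
    ((mulCoeff g hg u : Fn) : ℝ → ℂ) =ᵐ[volume] fun x => (g x : ℂ) * (u : Fn) x :=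
  Fn.coeFn_mk _ (hg.aesm u)

theorem reducedOp_coe (β q : ℂ) (g : ℝ → ℝ) (hg : IsBUC g) (u : Hul 2) :
    ((reducedOp β q g hg u : Fn) : ℝ → ℂ) =ᵐ[volume] fun x =>
      (wderiv 0 (wderiv 1 u) : Fn) x + 2 * β * (wderiv 1 u : Fn) x
        - g x * (u : Fn) x - q * (u : Fn) x := by
  have e : (reducedOp β q g hg u : Fn) = (wderiv 0 (wderiv 1 u) : Fn) +
      (2 * β) • (wderiv 1 u : Fn) - (mulCoeff g hg (incl 0 (incl 1 u)) : Fn) - q • (u : Fn) := rfl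
  rw [e]
  filter_upwards [Fn.coeFn_sub ((wderiv 0 (wderiv 1 u) : Fn) + (2 * β) • (wderiv 1 u : Fn) -
      (mulCoeff g hg (incl 0 (incl 1 u)) : Fn)) (q • (u : Fn)),
    Fn.coeFn_sub ((wderiv 0 (wderiv 1 u) : Fn) + (2 * β) • (wderiv 1 u : Fn))
      (mulCoeff g hg (incl 0 (incl 1 u)) : Fn),
    Fn.coeFn_add (wderiv 0 (wderiv 1 u) : Fn) ((2 * β) • (wderiv 1 u : Fn)),
    Fn.coeFn_smul (2 * β) (wderiv 1 u : Fn), Fn.coeFn_smul q (u : Fn),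
    mulCoeff_coe g hg (incl 0 (incl 1 u))] with x h1 h2 h3 h4 h5 h6
  rw [h1, h2, h3, h4, h5, h6]
  rfl

/-- `U` is a bounded classical solution of `U'' + 2 β U' - (g + q) U = G` with bounded
derivative `U'`. -/
structure BoundedSol (β q : ℂ) (g : ℝ → ℝ) (G U U' : ℝ → ℂ) : Prop where
  deriv_fst : ∀ y, HasDerivAt U (U' y) y
  deriv_snd : ∀ y, HasDerivAt U' (G y - 2 * β * U' y + (g y + q) * U y) y
  bounded : ∃ C, ∀ y, ‖U y‖ ≤ C ∧ ‖U' y‖ ≤ C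

/-- Elements of `H²_ul` whose image under the reduced operator is continuous are classical. -/
theorem exists_boundedSol {β q : ℂ} {g : ℝ → ℝ} (hg : IsBUC g) (u : Hul 2) {G : ℝ → ℂ}
    (hG : Continuous G) (h : ((reducedOp β q g hg u : Fn) : ℝ → ℂ) =ᵐ[volume] G) :
    ∃ U U', BoundedSol β q g G U U' ∧ ((u : Fn) : ℝ → ℂ) =ᵐ[volume] U := by
  have hgc := hg.uniformContinuous.continuous
  obtain ⟨U, hU, hUp, C, hC⟩ := exists_representative (Hul_le 2 u.2)
    (Hul_le 1 (wderiv 1 u).2) (wderiv_spec 1 u)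
  obtain ⟨U', hU', hU'p, C', hC'⟩ := exists_representative (Hul_le 1 (wderiv 1 u).2)
    (wderiv 0 (wderiv 1 u)).2 (wderiv_spec 0 (wderiv 1 u))
  have hUc := hUp.continuous (locallyIntegrable_of_mem (Hul_le 1 (wderiv 1 u).2))
  have hU'c := hU'p.continuous (locallyIntegrable_coe (wderiv 0 (wderiv 1 u)))
  have h2 : ((wderiv 0 (wderiv 1 u) : Fn) : ℝ → ℂ) =ᵐ[volume]
      fun y => G y - 2 * β * U' y + (g y + q) * U y := by
    filter_upwards [h, hU, hU', reducedOp_coe β q g hg u] with x h1 h2 h3 h4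
    rw [h4, h2, h3] at h1
    linear_combination h1
  refine ⟨U, U', ⟨(hUp.congr hU').hasDerivAt hU'c, (hU'p.congr h2).hasDerivAt (by fun_prop),
    max C C', fun y => ⟨(hC y).trans (le_max_left _ _), (hC' y).trans (le_max_right _ _)⟩⟩, hU⟩

theorem hasWeakDeriv_mk {U v : ℝ → ℂ} (hU : AEStronglyMeasurable U volume) {w : Fn}
    (hv : LocallyIntegrable v volume) (hw : (w : ℝ → ℂ) =ᵐ[volume] v) (h : IsPrimitive U v) :
    HasWeakDeriv (Fn.mk U hU) w := by
  intro φ hφ hφc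
  have e1 : ∫ x, deriv φ x • (Fn.mk U hU) x = ∫ x, deriv φ x • U x :=
    integral_congr_ae ((Fn.coeFn_mk U hU).mono fun x hx => by simp only [hx])
  have e2 : ∫ x, φ x • w x = ∫ x, φ x • v x :=
    integral_congr_ae (hw.mono fun x hx => by simp only [hx])
  rw [e1, e2]
  exact h.integral_deriv_smul hv hφ hφc

/-- Bounded solutions of the reduced equation with forcing in `L²_ul` belong to `H²_ul`. -/
theorem exists_hul_two {β q : ℂ} {g : ℝ → ℝ} (hg : IsBUC g) (F : Hul 0) {U U' : ℝ → ℂ} {C : ℝ}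
    (hU : ∀ y, HasDerivAt U (U' y) y)
    (hU' : IsPrimitive U' fun t => (F : Fn) t + (-2 * β * U' t + (g t + q) * U t))
    (hU'c : Continuous U') (hC : ∀ y, ‖U y‖ ≤ C ∧ ‖U' y‖ ≤ C) :
    ∃ u : Hul 2, reducedOp β q g hg u = F ∧ ((u : Fn) : ℝ → ℂ) =ᵐ[volume] U ∧
      ((wderiv 1 u : Fn) : ℝ → ℂ) =ᵐ[volume] U' := by
  have hgc := hg.uniformContinuous.continuous
  have hUc : Continuous U := continuous_iff_continuousAt.2 fun y => (hU y).continuousAt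
  obtain ⟨B, hB⟩ := hg.bounded
  have hC0 : 0 ≤ C := (norm_nonneg _).trans (hC 0).1
  have hR : ∀ t, ‖-2 * β * U' t + (g t + q) * U t‖ ≤ 2 * ‖β‖ * C + (B + ‖q‖) * C := by
    intro t
    refine (norm_add_le _ _).trans ?_
    rw [norm_mul, norm_mul, norm_mul, norm_neg, Complex.norm_ofNat]
    have h1 : ‖(g t : ℂ) + q‖ ≤ B + ‖q‖ := by
      refine (norm_add_le _ _).trans ?_
      rw [Complex.norm_real, Real.norm_eq_abs]
      linarith [hB t]
    gcongr
    · exact (hC t).2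
    · exact (norm_nonneg _).trans h1
    · exact (hC t).1
  have hUuc : UniformContinuous U := by
    refine uniformContinuous_of_modulus (A := 0) (B := C) fun a b _ => ?_
    rw [isPrimitive_of_hasDerivAt hU hU'c a b, zero_mul, zero_add]
    exact intervalIntegral.norm_integral_le_of_norm_le_const fun t _ => (hC t).2
  have hRc : Continuous fun t => -2 * β * U' t + (g t + q) * U t := by fun_prop
  have hFi := intervalIntegrable_of_locallyIntegrable (locallyIntegrable_coe F)
  -- The L²_ul part of U'' contributes a square-root modulus of continuity, the bounded part a
  -- Lipschitz one.
  have hU'uc : UniformContinuous U' := by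
    refine uniformContinuous_of_modulus (A := (ulNorm (F : Fn)).toReal)
      (B := 2 * ‖β‖ * C + (B + ‖q‖) * C) fun a b hab => ?_
    rw [hU' a b, intervalIntegral.integral_add (hFi a b) (hRc.intervalIntegrable a b)]
    refine (norm_add_le _ _).trans (add_le_add ?_
      (intervalIntegral.norm_integral_le_of_norm_le_const fun t _ => hR t))
    rw [mul_comm]
    exact norm_integral_le_ulNorm (F : Fn).aesm (ulNorm_lt_top F) hab
  set u₀ : Fn := Fn.mk U hUc.aestronglyMeasurable with hu₀
  set u₁ : Fn := Fn.mk U' hU'c.aestronglyMeasurable with hu₁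
  have e₀ : (u₀ : ℝ → ℂ) =ᵐ[volume] U := Fn.coeFn_mk _ _
  have e₁ : (u₁ : ℝ → ℂ) =ᵐ[volume] U' := Fn.coeFn_mk _ _
  have m₀ : u₀ ∈ L2ul := (memL2ul_of_uniformContinuous (fun x => (hC x).1) hUuc).congr e₀.symm
  have m₁ : u₁ ∈ L2ul := (memL2ul_of_uniformContinuous (fun x => (hC x).2) hU'uc).congr e₁.symm
  set u₂ : Hul 0 := F - (2 * β) • (⟨u₁, m₁⟩ : Hul 0) + mulCoeff g hg ⟨u₀, m₀⟩ +
    q • (⟨u₀, m₀⟩ : Hul 0) with hu₂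
  have e₂ : ((u₂ : Fn) : ℝ → ℂ) =ᵐ[volume]
      fun t => (F : Fn) t + (-2 * β * U' t + (g t + q) * U t) := by
    have e : (u₂ : Fn) = (F : Fn) - (2 * β) • u₁ + (mulCoeff g hg ⟨u₀, m₀⟩ : Fn) + q • u₀ := rfl
    rw [e]
    filter_upwards [Fn.coeFn_add ((F : Fn) - (2 * β) • u₁ + (mulCoeff g hg ⟨u₀, m₀⟩ : Fn))
        (q • u₀), Fn.coeFn_add ((F : Fn) - (2 * β) • u₁) (mulCoeff g hg ⟨u₀, m₀⟩ : Fn),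
      Fn.coeFn_sub (F : Fn) ((2 * β) • u₁), Fn.coeFn_smul (2 * β) u₁, Fn.coeFn_smul q u₀,
      mulCoeff_coe g hg ⟨u₀, m₀⟩, e₀, e₁] with x h1 h2 h3 h4 h5 h6 h7 h8
    rw [h1, h2, h3, h4, h5, h6]
    simp only [h7, h8, smul_eq_mul]
    ring
  have d₁ : HasWeakDeriv u₁ u₂ := hasWeakDeriv_mk _
    ((locallyIntegrable_coe F).add hRc.locallyIntegrable) e₂ hU'
  have d₀ : HasWeakDeriv u₀ u₁ := hasWeakDeriv_mk _ hU'c.locallyIntegrable e₁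
    (isPrimitive_of_hasDerivAt hU hU'c)
  let u : Hul 2 := ⟨u₀, m₀, u₁, ⟨m₁, u₂, u₂.2, d₁⟩, d₀⟩
  have w₁ : (wderiv 1 u : Fn) = u₁ :=
    HasWeakDeriv.unique (Hul_le 1 (wderiv 1 u).2) m₁ (wderiv_spec 1 u) d₀
  have w₂ : (wderiv 0 (wderiv 1 u) : Fn) = u₂ := by
    refine HasWeakDeriv.unique (u := u₁) (wderiv 0 (wderiv 1 u)).2 u₂.2 ?_ d₁
    have := wderiv_spec 0 (wderiv 1 u)
    rwa [w₁] at this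
  refine ⟨u, Subtype.ext (Fn.ext ?_), e₀, by rw [w₁]; exact e₁⟩
  filter_upwards [reducedOp_coe β q g hg u, e₀, e₁, e₂] with x h1 h2 h3 h4
  rw [h1, w₁, w₂, h3, h4]
  have : ((u : Fn) : ℝ → ℂ) x = U x := h2
  rw [this]
  ring

/-- The potential of the equation satisfied by `e^{β y} u`. -/
def potential (β q : ℂ) (g : ℝ → ℝ) : ℝ → ℂ := fun y => g y + q + β ^ 2

/-- Passing from `w = e^{β y} u` to `u`. -/
theorem ForcedSol.toBoundedSol {β q : ℂ} {g : ℝ → ℝ} {G w w' : ℝ → ℂ} {D : ℝ}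
    (h : ForcedSol (potential β q g) (fun y => Complex.exp (β * y) * G y) w w')
    (hD : ∀ y, ‖w y‖ ≤ D * Real.exp (β.re * y) ∧ ‖w' y‖ ≤ D * Real.exp (β.re * y)) :
    BoundedSol β q g G (fun y => Complex.exp (-β * y) * w y)
      (fun y => Complex.exp (-β * y) * (w' y - β * w y)) ∧
    ∀ y : ℝ, ‖Complex.exp (-β * y) * w y‖ ≤ D ∧
      ‖Complex.exp (-β * y) * (w' y - β * w y)‖ ≤ (1 + ‖β‖) * D := by
  have ee : ∀ y : ℝ, Complex.exp (-β * y) * Complex.exp (β * y) = 1 := fun y => by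
    rw [← Complex.exp_add]; simp
  have hD0 : 0 ≤ D := by
    have := (norm_nonneg _).trans (hD 0).1
    simpa using this
  have hb : ∀ y : ℝ, ‖Complex.exp (-β * y) * w y‖ ≤ D ∧
      ‖Complex.exp (-β * y) * (w' y - β * w y)‖ ≤ (1 + ‖β‖) * D := by
    intro y
    have e : Real.exp ((-β).re * y) * Real.exp (β.re * y) = 1 := by
      rw [← Real.exp_add]; simp
    rw [norm_mul, norm_mul, norm_cexp_mul_real]
    have h1 : ‖w' y - β * w y‖ ≤ (1 + ‖β‖) * D * Real.exp (β.re * y) := by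
      refine (norm_sub_le _ _).trans ?_
      rw [norm_mul]
      have := mul_le_mul_of_nonneg_left (hD y).1 (norm_nonneg β)
      linarith [(hD y).2]
    have hp := Real.exp_pos ((-β).re * y)
    constructor
    · refine (mul_le_mul_of_nonneg_left (hD y).1 hp.le).trans (le_of_eq ?_)
      linear_combination D * e
    · refine (mul_le_mul_of_nonneg_left h1 hp.le).trans (le_of_eq ?_)
      linear_combination (1 + ‖β‖) * D * e
  refine ⟨⟨fun y => ?_, fun y => ?_, (1 + ‖β‖) * D, fun y => ⟨(hb y).1.trans ?_, (hb y).2⟩⟩, hb⟩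
  · exact ((hasDerivAt_cexp_mul_real (-β) y).fun_mul (h.deriv_fst y)).congr_deriv (by ring)
  · refine ((hasDerivAt_cexp_mul_real (-β) y).fun_mul
      ((h.deriv_snd y).fun_sub ((h.deriv_fst y).const_mul β))).congr_deriv ?_
    simp only [potential]
    linear_combination G y * ee y
  · exact le_mul_of_one_le_left hD0 (by linarith [norm_nonneg β])

/-- Passing from `u` to `w = e^{β y} u`. -/
theorem BoundedSol.toForcedSol {β q : ℂ} {g : ℝ → ℝ} {G U U' : ℝ → ℂ}
    (h : BoundedSol β q g G U U') :
    ForcedSol (potential β q g) (fun y => Complex.exp (β * y) * G y)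
      (fun y => Complex.exp (β * y) * U y) (fun y => Complex.exp (β * y) * (U' y + β * U y)) ∧
    BoundedBy (fun y => Complex.exp (β * y) * U y)
      (fun y => Complex.exp (β * y) * (U' y + β * U y)) fun y => Real.exp (β.re * y) := by
  refine ⟨⟨fun y => ?_, fun y => ?_⟩, ?_⟩
  · exact ((hasDerivAt_cexp_mul_real β y).fun_mul (h.deriv_fst y)).congr_deriv (by ring)
  · refine ((hasDerivAt_cexp_mul_real β y).fun_mul
      ((h.deriv_snd y).fun_add ((h.deriv_fst y).const_mul β))).congr_deriv ?_
    simp only [potential]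
    ring
  · obtain ⟨C, hC⟩ := h.bounded
    have hC0 : 0 ≤ C := (norm_nonneg _).trans (hC 0).1
    refine ⟨(1 + ‖β‖) * C, by positivity, fun y => ?_⟩
    have hp := Real.exp_pos (β.re * y)
    rw [norm_mul, norm_mul, norm_cexp_mul_real, mul_comm (Real.exp _), mul_comm (Real.exp _)]
    constructor
    · refine mul_le_mul_of_nonneg_right ((hC y).1.trans ?_) hp.le
      exact le_mul_of_one_le_left hC0 (by linarith [norm_nonneg β])
    · refine mul_le_mul_of_nonneg_right ((norm_add_le _ _).trans ?_) hp.le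
      rw [norm_mul]
      have := mul_le_mul_of_nonneg_left (hC y).1 (norm_nonneg β)
      linarith [(hC y).2]

/-! ### Solvability of the reduced equation -/

theorem ulNorm_le_of_ae_bound {u v : ℝ → ℂ} {C : ℝ} (h : u =ᵐ[volume] v) (hv : ∀ x, ‖v x‖ ≤ C) :
    ulNorm u ≤ ENNReal.ofReal C := ulNorm_congr h ▸ ulNorm_le_of_bound hv

/-- Solving the reduced equation by a regularization followed by a classical solution. -/
theorem exists_reducedOp_eq {β q : ℂ} {g : ℝ → ℝ} (hg : IsBUC g) (F H₀ : Hul 0) {H : ℝ → ℂ}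
    (hH : Continuous H) (hH₀ : ((H₀ : Fn) : ℝ → ℂ) =ᵐ[volume] H) {u u' r w w' : ℝ → ℂ} {M D : ℝ}
    (hr : Continuous r) (hu : ∀ y, HasDerivAt u (u' y) y)
    (hu' : IsPrimitive u' fun t => (F : Fn) t - r t) (hM : ∀ y, ‖u y‖ ≤ M ∧ ‖u' y‖ ≤ M)
    (hw : ForcedSol (potential β q g) (fun y => Complex.exp (β * y) *
      (r y - 2 * β * u' y + (g y + q) * u y - H y)) w w')
    (hD : ∀ y, ‖w y‖ ≤ D * Real.exp (β.re * y) ∧ ‖w' y‖ ≤ D * Real.exp (β.re * y)) :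
    ∃ v : Hul 2, reducedOp β q g hg v = F - H₀ ∧
      ulNorm (v : Fn) ≤ ENNReal.ofReal (M + (1 + ‖β‖) * D) ∧
      ulNorm (wderiv 1 v : Fn) ≤ ENNReal.ofReal (M + (1 + ‖β‖) * D) := by
  have hgc := hg.uniformContinuous.continuous
  obtain ⟨hv, hvb⟩ := hw.toBoundedSol hD
  set v := fun y : ℝ => Complex.exp (-β * y) * w y
  set v' := fun y : ℝ => Complex.exp (-β * y) * (w' y - β * w y)
  have hD0 : 0 ≤ D := (norm_nonneg _).trans (hvb 0).1
  have hu'c : Continuous u' :=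
    hu'.continuous ((locallyIntegrable_coe F).sub hr.locallyIntegrable)
  have huc : Continuous u := continuous_iff_continuousAt.2 fun y => (hu y).continuousAt
  have hvc : Continuous v := continuous_iff_continuousAt.2 fun y => (hv.deriv_fst y).continuousAt
  have hv'c : Continuous v' := continuous_iff_continuousAt.2 fun y => (hv.deriv_snd y).continuousAt
  have hb : ∀ y, ‖u y + v y‖ ≤ M + (1 + ‖β‖) * D ∧ ‖u' y + v' y‖ ≤ M + (1 + ‖β‖) * D := by
    intro y
    have : D ≤ (1 + ‖β‖) * D := le_mul_of_one_le_left hD0 (by linarith [norm_nonneg β])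
    exact ⟨(norm_add_le _ _).trans (add_le_add (hM y).1 ((hvb y).1.trans this)),
      (norm_add_le _ _).trans (add_le_add (hM y).2 (hvb y).2)⟩
  have hprim : IsPrimitive (fun y => u' y + v' y) fun t => ((F - H₀ : Hul 0) : Fn) t +
      (-2 * β * (u' t + v' t) + (g t + q) * (u t + v t)) := by
    have hc : Continuous fun y => r y - 2 * β * u' y + (g y + q) * u y - H y -
        2 * β * v' y + (g y + q) * v y := by fun_prop
    have h2 := isPrimitive_of_hasDerivAt hv.deriv_snd hc
    have h3 : IsPrimitive (fun y => u' y + v' y) fun y => ((F : Fn) y - r y) +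
        (r y - 2 * β * u' y + (g y + q) * u y - H y - 2 * β * v' y + (g y + q) * v y) := by
      intro a b
      rw [intervalIntegral.integral_add ((intervalIntegrable_of_locallyIntegrable
        (locallyIntegrable_coe F) a b).sub (hr.intervalIntegrable a b))
        (hc.intervalIntegrable a b), ← hu' a b, ← h2 a b]
      ring
    refine h3.congr ?_
    filter_upwards [Fn.coeFn_sub (F : Fn) (H₀ : Fn), hH₀] with x h1 h2
    have e : ((F - H₀ : Hul 0) : Fn) = (F : Fn) - (H₀ : Fn) := rfl
    rw [e, h1, h2]
    ring
  obtain ⟨s, hs, hs1, hs2⟩ := exists_hul_two hg (F - H₀)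
    (fun y => (hu y).fun_add (hv.deriv_fst y)) hprim (hu'c.add hv'c) hb
  exact ⟨s, hs, ulNorm_le_of_ae_bound hs1 fun y => (hb y).1,
    ulNorm_le_of_ae_bound hs2 fun y => (hb y).2⟩

theorem norm_residual_le {β q : ℂ} {g : ℝ → ℝ} {B : ℝ} (hB : ∀ y, |g y| ≤ B)
    {u u' r : ℝ → ℂ} {N : ℝ} (h : ∀ y, ‖u y‖ ≤ N ∧ ‖u' y‖ ≤ 2 * N ∧ ‖r y‖ ≤ 3 * N) (y : ℝ) :
    ‖r y - 2 * β * u' y + (g y + q) * u y‖ ≤ (3 + 4 * ‖β‖ + B + ‖q‖) * N := by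
  obtain ⟨h1, h2, h3⟩ := h y
  have h4 : ‖(g y : ℂ) + q‖ ≤ B + ‖q‖ := by
    refine (norm_add_le _ _).trans ?_
    rw [Complex.norm_real, Real.norm_eq_abs]
    linarith [hB y]
  have h5 : ‖2 * β * u' y‖ ≤ 2 * ‖β‖ * (2 * N) := by
    rw [norm_mul, norm_mul, Complex.norm_ofNat]; gcongr
  have h6 : ‖((g y : ℂ) + q) * u y‖ ≤ (B + ‖q‖) * N := by
    rw [norm_mul]
    exact mul_le_mul h4 h1 (norm_nonneg _) ((norm_nonneg _).trans h4)
  refine (norm_add_le _ _).trans ?_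
  have := norm_sub_le (r y) (2 * β * u' y)
  linarith

/-- An element of the kernel has a bounded classical representative U, and e^{βy}U would be a bound
state unless it vanishes. -/
theorem reducedOp_injective {β q : ℂ} {g : ℝ → ℝ} (hg : IsBUC g)
    (hno : ∀ w w', ¬ IsBoundState (potential β q g) β.re w w') {u : Hul 2}
    (hu : reducedOp β q g hg u = 0) : u = 0 := by
  obtain ⟨U, U', hU, hUu⟩ := exists_boundedSol hg u (G := fun _ => 0) continuous_const (by
    rw [hu]; exact Fn.coeFn_zero)
  obtain ⟨h1, h2⟩ := hU.toForcedSol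
  have h0 : ∀ y, U y = 0 := by
    by_contra! hc
    obtain ⟨y, hy⟩ := hc
    refine hno _ _ ⟨⟨h1.deriv_fst, fun y => ?_⟩, ⟨y, mul_ne_zero (Complex.exp_ne_zero _) hy⟩, h2⟩
    simpa using h1.deriv_snd y
  refine Subtype.ext (Fn.ext ?_)
  filter_upwards [hUu, Fn.coeFn_zero] with x h1 h2
  rw [h1, h0]
  exact h2.symm

/-- In the absence of bound states the reduced operator has a bounded inverse. -/
theorem reducedOp_surjective {β q : ℂ} {g : ℝ → ℝ} (hg : IsBUC g) {κ₁ κ₂ : ℂ}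
    (h : Dichotomy (potential β q g) β.re κ₁ κ₂)
    (hno : ∀ w w', ¬ IsBoundState (potential β q g) β.re w w') :
    ∃ C : ℝ≥0, ∀ F : Hul 0, ∃ u : Hul 2, reducedOp β q g hg u = F ∧
      ulNorm (u : Fn) ≤ C * ulNorm (F : Fn) ∧ ulNorm (wderiv 1 u : Fn) ≤ C * ulNorm (F : Fn) := by
  obtain ⟨C, hC, hsol⟩ := h.exists_forcedSol hno
  obtain ⟨B, hB⟩ := hg.bounded
  have hB0 : 0 ≤ B := (abs_nonneg _).trans (hB 0)
  have hgc := hg.uniformContinuous.continuous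
  set c₀ := 3 + 4 * ‖β‖ + B + ‖q‖ with hc₀
  obtain ⟨K, hK⟩ : ∃ K : ℝ≥0, (K : ℝ) = 2 + (1 + ‖β‖) * (C * c₀) := ⟨⟨_, by positivity⟩, rfl⟩
  refine ⟨K, fun F => ?_⟩
  set N := (ulNorm (F : Fn)).toReal with hN
  have hN0 : 0 ≤ N := ENNReal.toReal_nonneg
  -- With u'' = F − r, the correction v to u must solve v'' + 2βv' − (g + q)v = r − 2βu' + (g + q)u.
  -- Its right-hand side is continuous and bounded by a multiple of the L²_ul norm of F.
  obtain ⟨u, u', r, hr, hu, hu', hb⟩ := exists_regularization (locallyIntegrable_coe F)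
    (M := N) fun a b hab => norm_integral_le_ulNorm' (F : Fn).aesm (ulNorm_lt_top F) hab
  have hu'c : Continuous u' :=
    hu'.continuous ((locallyIntegrable_coe F).sub hr.locallyIntegrable)
  have huc : Continuous u := continuous_iff_continuousAt.2 fun y => (hu y).continuousAt
  obtain ⟨w, w', hw, hwb⟩ := hsol (fun y => Complex.exp (β * y) *
    (r y - 2 * β * u' y + (g y + q) * u y - 0)) (by fun_prop) (c₀ * N) (by positivity)
    (fun y => by
      rw [norm_mul, norm_cexp_mul_real, mul_comm, sub_zero]
      exact mul_le_mul_of_nonneg_right (norm_residual_le hB hb y) (Real.exp_pos _).le)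
  obtain ⟨v, hv, hv1, hv2⟩ := exists_reducedOp_eq hg F 0 (H := fun _ => 0) continuous_const
    Fn.coeFn_zero (M := 2 * N) hr hu hu' (fun y => ⟨(hb y).1.trans (by linarith), (hb y).2.1⟩)
    hw hwb
  have e : ENNReal.ofReal (2 * N + (1 + ‖β‖) * (C * (c₀ * N))) =
      (K : ℝ≥0∞) * ulNorm (F : Fn) := by
    rw [← ENNReal.ofReal_toReal (ulNorm_lt_top F).ne, ← hN, ← ENNReal.ofReal_coe_nnreal,
      ← ENNReal.ofReal_mul (by positivity), hK]
    ring_nf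
  exact ⟨v, by rw [hv, sub_zero], e ▸ hv1, e ▸ hv2⟩

/-! ### Bound states and orthogonality -/

theorem integrable_exp_neg_mul_abs {δ : ℝ} (hδ : 0 < δ) :
    Integrable fun y : ℝ => Real.exp (-δ * |y|) := by
  rw [← integrableOn_univ, ← Set.Iic_union_Ioi (a := (0:ℝ))]
  refine IntegrableOn.union ?_ ?_
  · refine (integrableOn_exp_mul_Iic hδ 0).congr_fun (fun y hy => ?_) measurableSet_Iic
    rw [abs_of_nonpos hy]; ring_nf
  · refine (integrableOn_exp_mul_Ioi (neg_lt_zero.2 hδ) 0).congr_fun (fun y hy => ?_)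
      measurableSet_Ioi
    rw [abs_of_pos hy]

theorem tendsto_exp_neg_mul_abs {δ : ℝ} (hδ : 0 < δ) :
    Tendsto (fun y : ℝ => Real.exp (-δ * |y|)) atTop (𝓝 0) ∧
    Tendsto (fun y : ℝ => Real.exp (-δ * |y|)) atBot (𝓝 0) := by
  constructor
  · exact Real.tendsto_exp_atBot.comp
      (tendsto_abs_atTop_atTop.const_mul_atTop_of_neg (by linarith))
  · exact Real.tendsto_exp_atBot.comp
      (tendsto_abs_atBot_atTop.const_mul_atTop_of_neg (by linarith))

namespace Dichotomy

variable {P : ℝ → ℂ} {b : ℝ} {κ₁ κ₂ : ℂ}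

/-- A bound state decays exponentially even after multiplication by `e^{b y}`. -/
theorem boundState_decay_mul (h : Dichotomy P b κ₁ κ₂) {φ φ' : ℝ → ℂ}
    (hφ : IsBoundState P b φ φ') : ∃ δ, 0 < δ ∧ ∃ C, 0 ≤ C ∧ ∀ y,
      ‖φ y‖ * Real.exp (b * y) ≤ C * Real.exp (-δ * |y|) ∧
      ‖φ' y‖ * Real.exp (b * y) ≤ C * Real.exp (-δ * |y|) ∧
      ‖φ y‖ ≤ C * Real.exp (-δ * |y|) ∧ ‖φ' y‖ ≤ C * Real.exp (-δ * |y|) := by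
  obtain ⟨C, hC, hb⟩ := h.boundState_decay hφ
  have hp := h.pos
  have hr := h.lt_right
  have hl := h.lt_left
  have hδ : 0 < min κ₁.re κ₂.re - b := sub_pos.2 (lt_min hr hl)
  have h1 : ∀ y, -|expo κ₁.re κ₂.re y| + b * y ≤ -(min κ₁.re κ₂.re - b) * |y| := by
    intro y
    rcases le_total 0 y with hy | hy
    · rw [abs_expo_of_nonneg (by linarith) _ hy, abs_of_nonneg hy]
      nlinarith [min_le_left κ₁.re κ₂.re]
    · rw [abs_expo_of_nonpos _ (by linarith) hy, abs_of_nonpos hy]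
      nlinarith [min_le_right κ₁.re κ₂.re]
  have h2 : ∀ y, -|expo κ₁.re κ₂.re y| ≤ -(min κ₁.re κ₂.re - b) * |y| := by
    intro y
    rcases le_total 0 y with hy | hy
    · rw [abs_expo_of_nonneg (by linarith) _ hy, abs_of_nonneg hy]
      nlinarith [min_le_left κ₁.re κ₂.re]
    · rw [abs_expo_of_nonpos _ (by linarith) hy, abs_of_nonpos hy]
      nlinarith [min_le_right κ₁.re κ₂.re]
  have key : ∀ (a : ℂ) (y : ℝ), ‖a‖ ≤ C * Real.exp (-|expo κ₁.re κ₂.re y|) →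
      ‖a‖ * Real.exp (b * y) ≤ C * Real.exp (-(min κ₁.re κ₂.re - b) * |y|) ∧
      ‖a‖ ≤ C * Real.exp (-(min κ₁.re κ₂.re - b) * |y|) := by
    intro a y ha
    constructor
    · refine (mul_le_mul_of_nonneg_right ha (Real.exp_pos _).le).trans ?_
      rw [mul_assoc, ← Real.exp_add]
      exact mul_le_mul_of_nonneg_left (Real.exp_le_exp.2 (h1 y)) hC
    · exact ha.trans (mul_le_mul_of_nonneg_left (Real.exp_le_exp.2 (h2 y)) hC)
  exact ⟨_, hδ, C, hC, fun y => ⟨(key _ y (hb y).1).1, (key _ y (hb y).2).1,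
    (key _ y (hb y).1).2, (key _ y (hb y).2).2⟩⟩

theorem integrable_boundState_mul (h : Dichotomy P b κ₁ κ₂) {φ φ' : ℝ → ℂ}
    (hφ : IsBoundState P b φ φ') {f : ℝ → ℂ} (hf : Continuous f) {M : ℝ}
    (hfM : ∀ y, ‖f y‖ ≤ M * Real.exp (b * y)) : Integrable fun y => φ y * f y := by
  obtain ⟨δ, hδ, C, hC, hb⟩ := h.boundState_decay_mul hφ
  have hM : 0 ≤ M := by
    have := (norm_nonneg _).trans (hfM 0)
    simpa using this
  refine Integrable.mono' ((integrable_exp_neg_mul_abs hδ).const_mul (M * C))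
    (hφ.1.continuous.mul hf).aestronglyMeasurable (Eventually.of_forall fun y => ?_)
  rw [norm_mul]
  calc ‖φ y‖ * ‖f y‖ ≤ ‖φ y‖ * (M * Real.exp (b * y)) :=
        mul_le_mul_of_nonneg_left (hfM y) (norm_nonneg _)
    _ = M * (‖φ y‖ * Real.exp (b * y)) := by ring
    _ ≤ M * (C * Real.exp (-δ * |y|)) := mul_le_mul_of_nonneg_left (hb y).1 hM
    _ = _ := by ring

/-- Forcings of solvable equations are orthogonal to bound states. -/
theorem integral_boundState_mul_eq_zero (h : Dichotomy P b κ₁ κ₂) {φ φ' : ℝ → ℂ}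
    (hφ : IsBoundState P b φ φ') {f w w' : ℝ → ℂ} (hf : Continuous f) {M : ℝ}
    (hfM : ∀ y, ‖f y‖ ≤ M * Real.exp (b * y)) (hw : ForcedSol P f w w')
    (hwb : BoundedBy w w' fun y => Real.exp (b * y)) : ∫ y, φ y * f y = 0 := by
  obtain ⟨δ, hδ, C, hC, hb⟩ := h.boundState_decay_mul hφ
  obtain ⟨D, hD, hwb⟩ := hwb
  have hd : ∀ y, HasDerivAt (fun y => φ y * w' y - φ' y * w y) (φ y * f y) y := fun y =>
    (((hφ.1.deriv_fst y).fun_mul (hw.deriv_snd y)).fun_sub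
      ((hφ.1.deriv_snd y).fun_mul (hw.deriv_fst y))).congr_deriv (by ring)
  have hbound : ∀ y, ‖φ y * w' y - φ' y * w y‖ ≤ 2 * D * C * Real.exp (-δ * |y|) := by
    intro y
    refine (norm_sub_le _ _).trans ?_
    rw [norm_mul, norm_mul]
    have h1 : ‖φ y‖ * ‖w' y‖ ≤ ‖φ y‖ * (D * Real.exp (b * y)) :=
      mul_le_mul_of_nonneg_left (hwb y).2 (norm_nonneg _)
    have h2 : ‖φ' y‖ * ‖w y‖ ≤ ‖φ' y‖ * (D * Real.exp (b * y)) :=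
      mul_le_mul_of_nonneg_left (hwb y).1 (norm_nonneg _)
    have h3 := mul_le_mul_of_nonneg_left (hb y).1 hD
    have h4 := mul_le_mul_of_nonneg_left (hb y).2.1 hD
    linarith
  have hz := tendsto_exp_neg_mul_abs hδ
  rw [integral_of_hasDerivAt_of_tendsto hd (h.integrable_boundState_mul hφ hf hfM) (m := 0) (n := 0)
    (squeeze_zero_norm hbound (by simpa using hz.2.const_mul (2 * D * C)))
    (squeeze_zero_norm hbound (by simpa using hz.1.const_mul (2 * D * C))), sub_zero]

end Dichotomy

/-! ### Reduction of the resolvent equation -/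

theorem wderiv_incl (u : Hul 2) : wderiv 0 (incl 1 u) = incl 0 (wderiv 1 u) :=
  Subtype.ext (HasWeakDeriv.unique (wderiv 0 (incl 1 u)).2 (Hul_le 1 (wderiv 1 u).2)
    (wderiv_spec 0 (incl 1 u)) (wderiv_spec 1 u))

/-- Half of the coefficient of `u'` in the reduced equation. -/
def driftCoeff (α c : ℝ) (z : ℂ) : ℂ := c * (1 + 2 * α * z) / 2

/-- The spectral shift in the reduced equation. -/
def massCoeff (α : ℝ) (z : ℂ) : ℂ := z + α * z ^ 2

/-- The right-hand side of the reduced equation corresponding to `f` in the energy space. -/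
def sourceMap (α c : ℝ) (z : ℂ) : EnergySpace →ₗ[ℂ] Hul 0 :=
  (α : ℂ) • LinearMap.snd ℂ (Hul 1) (Hul 0)
    + (1 + α * z) • (incl 0 ∘ₗ LinearMap.fst ℂ (Hul 1) (Hul 0))
    - (2 * α * c : ℂ) • (wderiv 0 ∘ₗ LinearMap.fst ℂ (Hul 1) (Hul 0))

/-- The element of the domain with given components. -/
def mkY (u : Hul 2) (v : Hul 1) : domainY := ⟨(incl 1 u, incl 0 v), u.2, v.2⟩

theorem fstY_mkY (u : Hul 2) (v : Hul 1) : fstY (mkY u v) = u := rfl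

/-- The first component of the equation is v = zu + f₁. Inserting it into the second and multiplying
by α collects the u' terms into 2β = c(1 + 2αz) and the z-dependent u terms into q = z + αz²; the
terms in f make up the source. -/
theorem shift_eq_iff {α c : ℝ} (hα : 0 < α) {g : ℝ → ℝ} (hg : IsBUC g) (z : ℂ) (w : domainY)
    (f : EnergySpace) : shift (generator α c g hg) z w = f ↔
      sndY w = z • incl 1 (fstY w) + f.1 ∧
      reducedOp (driftCoeff α c z) (massCoeff α z) g hg (fstY w) = sourceMap α c z f := by
  have hα' : (α : ℂ) ≠ 0 := by exact_mod_cast hα.ne'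
  set u := fstY w with hu
  set v := sndY w with hv
  have e1 : (shift (generator α c g hg) z w).1 = v - z • incl 1 u := rfl
  have e2 : (shift (generator α c g hg) z w).2 = (α : ℂ)⁻¹ •
      (wderiv 0 (wderiv 1 u) + (c : ℂ) • incl 0 (wderiv 1 u) - mulCoeff g hg (incl 0 (incl 1 u))
        - incl 0 v + (2 * (α : ℂ) * (c : ℂ)) • wderiv 0 v) - z • incl 0 v := rfl
  rw [Prod.ext_iff, e1, sub_eq_iff_eq_add, add_comm f.1]
  refine and_congr_right fun h => ?_
  rw [e2, ← sub_eq_zero (a := reducedOp _ _ _ _ _), ← sub_eq_zero (b := f.2)]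
  have key : reducedOp (driftCoeff α c z) (massCoeff α z) g hg u - sourceMap α c z f =
      (α : ℂ) • ((α : ℂ)⁻¹ •
      (wderiv 0 (wderiv 1 u) + (c : ℂ) • incl 0 (wderiv 1 u) - mulCoeff g hg (incl 0 (incl 1 u))
        - incl 0 v + (2 * (α : ℂ) * (c : ℂ)) • wderiv 0 v) - z • incl 0 v - f.2) := by
    have r1 : reducedOp (driftCoeff α c z) (massCoeff α z) g hg u =
      wderiv 0 (wderiv 1 u) + (2 * driftCoeff α c z) • incl 0 (wderiv 1 u)
        - mulCoeff g hg (incl 0 (incl 1 u)) - massCoeff α z • incl 0 (incl 1 u) := rfl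
    have r2 : sourceMap α c z f = (α : ℂ) • f.2 + (1 + α * z) • incl 0 f.1
      - (2 * α * c : ℂ) • wderiv 0 f.1 := rfl
    rw [r1, r2, h, map_add, map_add, map_smul, map_smul, wderiv_incl, driftCoeff, massCoeff]
    match_scalars <;> field_simp <;> ring
  rw [key, smul_eq_zero, or_iff_right hα']

/-! ### Norm estimates -/

theorem ulNorm_coe_add_le (u v : Hul 0) :
    ulNorm ((u + v : Hul 0) : Fn) ≤ ulNorm (u : Fn) + ulNorm (v : Fn) := by
  have e : ((u + v : Hul 0) : Fn) = (u : Fn) + (v : Fn) := rfl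
  rw [e, ulNorm_congr (Fn.coeFn_add (u : Fn) (v : Fn))]
  exact ulNorm_add_le (u : Fn).aesm (v : Fn).aesm

theorem ulNorm_coe_smul (a : ℂ) (u : Hul 0) :
    ulNorm ((a • u : Hul 0) : Fn) = ‖a‖₊ * ulNorm (u : Fn) := by
  have e : ((a • u : Hul 0) : Fn) = a • (u : Fn) := rfl
  rw [e, ulNorm_congr (Fn.coeFn_smul a (u : Fn)), ulNorm_const_smul]
  rfl

theorem le_rpow_half_of_sq_le {a s : ℝ≥0∞} (h : a ^ 2 ≤ s) : a ≤ s ^ (1 / 2 : ℝ) := by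
  calc a = (a ^ 2) ^ (1 / 2 : ℝ) := by
        rw [← ENNReal.rpow_natCast, ← ENNReal.rpow_mul]; norm_num
    _ ≤ _ := ENNReal.rpow_le_rpow h (by norm_num)

theorem ulNorm_le_energyNorm (f : EnergySpace) : ulNorm (f.1 : Fn) ≤ energyNorm f ∧
    ulNorm (wderiv 0 f.1 : Fn) ≤ energyNorm f ∧ ulNorm (f.2 : Fn) ≤ energyNorm f := by
  refine ⟨le_rpow_half_of_sq_le ?_, le_rpow_half_of_sq_le ?_, le_rpow_half_of_sq_le ?_⟩
  · rw [add_assoc]; exact le_self_add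
  · exact le_add_right le_add_self
  · exact le_add_self

theorem energyNorm_le {f : EnergySpace} {a : ℝ≥0∞} (h1 : ulNorm (f.1 : Fn) ≤ a)
    (h2 : ulNorm (wderiv 0 f.1 : Fn) ≤ a) (h3 : ulNorm (f.2 : Fn) ≤ a) :
    energyNorm f ≤ 2 * a := by
  calc energyNorm f ≤ ((2 * a) ^ 2) ^ (1 / 2 : ℝ) := by
        refine ENNReal.rpow_le_rpow ?_ (by norm_num)
        calc _ ≤ a ^ 2 + a ^ 2 + a ^ 2 := by gcongr
          _ ≤ a ^ 2 + a ^ 2 + a ^ 2 + a ^ 2 := le_self_add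
          _ = (2 * a) ^ 2 := by ring
    _ = 2 * a := by
        rw [← ENNReal.rpow_natCast, ← ENNReal.rpow_mul]; norm_num

theorem ulNorm_sourceMap_le (α c : ℝ) (z : ℂ) : ∃ K : ℝ≥0, ∀ f,
    ulNorm (sourceMap α c z f : Fn) ≤ K * energyNorm f := by
  refine ⟨‖(α : ℂ)‖₊ + ‖1 + α * z‖₊ + ‖-(2 * α * c : ℂ)‖₊, fun f => ?_⟩
  obtain ⟨h1, h2, h3⟩ := ulNorm_le_energyNorm f
  have e : sourceMap α c z f = (α : ℂ) • f.2 + (1 + α * z) • incl 0 f.1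
      + (-(2 * α * c : ℂ)) • wderiv 0 f.1 := by
    rw [neg_smul, ← sub_eq_add_neg]; rfl
  rw [e]
  refine (ulNorm_coe_add_le _ _).trans ?_
  refine (add_le_add (ulNorm_coe_add_le _ _) le_rfl).trans ?_
  rw [ulNorm_coe_smul, ulNorm_coe_smul, ulNorm_coe_smul]
  push_cast
  rw [add_mul, add_mul]
  gcongr
  exact h1

/-! ### The resolvent set and the eigenvalues -/

/-- The potential of the reduced equation at spectral parameter `z`. -/
def spectralPotential (α c : ℝ) (g : ℝ → ℝ) (z : ℂ) : ℝ → ℂ :=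
  potential (driftCoeff α c z) (massCoeff α z) g

/-- `z` is in the resolvent set if there is no bound state. -/
theorem mem_opResolventSet {α c : ℝ} (hα : 0 < α) {g : ℝ → ℝ} (hg : IsBUC g) {z κ₁ κ₂ : ℂ}
    (h : Dichotomy (spectralPotential α c g z) (driftCoeff α c z).re κ₁ κ₂)
    (hno : ∀ w w', ¬ IsBoundState (spectralPotential α c g z) (driftCoeff α c z).re w w') :
    z ∈ opResolventSet (generator α c g hg) := by
  obtain ⟨K, hK⟩ := reducedOp_surjective hg h hno
  have hinj : ∀ u, reducedOp (driftCoeff α c z) (massCoeff α z) g hg u = 0 → u = 0 :=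
    fun u hu => reducedOp_injective hg hno hu
  refine ⟨⟨?_, fun f => ?_⟩, ?_⟩
  · refine (injective_iff_map_eq_zero _).2 fun w hw => ?_
    obtain ⟨h1, h2⟩ := (shift_eq_iff hα hg z w 0).1 hw
    rw [map_zero] at h2
    have h3 := hinj _ h2
    rw [h3, map_zero, smul_zero, Prod.fst_zero, zero_add] at h1
    have e : mkY (fstY w) (sndY w) = mkY 0 0 := by rw [h3, h1]
    exact e
  · obtain ⟨u, hu, -⟩ := hK (sourceMap α c z f)
    exact ⟨mkY u (z • incl 1 u + f.1), (shift_eq_iff hα hg z _ f).2 ⟨rfl, hu⟩⟩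
  · obtain ⟨K', hK'⟩ := ulNorm_sourceMap_le α c z
    refine ⟨2 * (K * K' + ‖z‖₊ * (K * K') + 1), fun w => ?_⟩
    set f := shift (generator α c g hg) z w with hf
    obtain ⟨h1, h2⟩ := (shift_eq_iff hα hg z w f).1 hf.symm
    obtain ⟨u, hu, hu1, hu2⟩ := hK (sourceMap α c z f)
    have hwu : fstY w = u := by
      rw [← sub_eq_zero]
      exact hinj _ (by rw [map_sub, h2, hu, sub_self])
    obtain ⟨n1, -, -⟩ := ulNorm_le_energyNorm f
    have hF : (K : ℝ≥0∞) * ulNorm (sourceMap α c z f : Fn) ≤ K * K' * energyNorm f := by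
      rw [mul_assoc]; gcongr; exact hK' f
    have hle : (K * K' : ℝ≥0∞) * energyNorm f ≤
        (K * K' + ‖z‖₊ * (K * K') + 1) * energyNorm f := by
      gcongr
      rw [add_assoc]
      exact le_self_add
    push_cast
    rw [mul_assoc]
    refine energyNorm_le ?_ ?_ ?_
    · have e : ((w : EnergySpace).1 : Fn) = (u : Fn) := by rw [← hwu]; rfl
      rw [e]
      exact hu1.trans (hF.trans hle)
    · have e : wderiv 0 (w : EnergySpace).1 = incl 0 (wderiv 1 u) := by
        rw [← wderiv_incl, ← hwu]; rfl
      rw [e]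
      exact hu2.trans (hF.trans hle)
    · have e : (w : EnergySpace).2 = z • incl 0 (incl 1 u) + incl 0 f.1 := by
        rw [← map_smul, ← map_add, ← hwu, ← h1]; rfl
      rw [e]
      refine (ulNorm_coe_add_le _ _).trans ?_
      rw [ulNorm_coe_smul]
      calc (‖z‖₊ : ℝ≥0∞) * ulNorm ((incl 0 (incl 1 u) : Hul 0) : Fn) + ulNorm (incl 0 f.1 : Fn)
          ≤ ‖z‖₊ * (K * K' * energyNorm f) + energyNorm f := by
            gcongr
            · exact hu1.trans hF
            · exact n1
        _ = (‖z‖₊ * (K * K') + 1) * energyNorm f := by ring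
        _ ≤ _ := by
          gcongr
          exact le_add_self

theorem integral_sq_ne_zero {r : ℝ → ℝ} (hr : Continuous r)
    (hi : Integrable fun y => (r y : ℂ) * r y) {y₀ : ℝ} (h0 : r y₀ ≠ 0) :
    ∫ y, (r y : ℂ) * r y ≠ 0 := by
  have e : ∀ y, (r y : ℂ) * r y = ((r y ^ 2 : ℝ) : ℂ) := fun y => by push_cast; ring
  simp only [e] at hi ⊢
  have hi' : Integrable fun y => r y ^ 2 := by
    have := hi.re
    simpa [← Complex.ofReal_pow] using this
  rw [integral_complex_ofReal]
  refine Complex.ofReal_ne_zero.2 (ne_of_gt ?_)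
  rw [integral_pos_iff_support_of_nonneg (fun y => sq_nonneg (r y)) hi']
  have ho : IsOpen (Function.support fun y => r y ^ 2) :=
    (hr.pow 2).isOpen_support
  exact ho.measure_pos volume ⟨y₀, by simpa using h0⟩

/-- A real bound state gives a simple eigenvalue. -/
theorem isSimpleEigenvalue_of_boundState {α c : ℝ} (hα : 0 < α) {g : ℝ → ℝ} (hg : IsBUC g)
    {z κ₁ κ₂ : ℂ}
    (h : Dichotomy (spectralPotential α c g z) (driftCoeff α c z).re κ₁ κ₂) {r r' : ℝ → ℝ}
    (hr : IsBoundState (spectralPotential α c g z) (driftCoeff α c z).re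
      (fun y => (r y : ℂ)) (fun y => (r' y : ℂ))) :
    z ∈ opSpectrum (generator α c g hg) ∧ IsSimpleEigenvalue (generator α c g hg) z := by
  obtain ⟨hsol, ⟨y₀, hy₀⟩, D, hD, hb⟩ := id hr
  beta_reduce at hsol hy₀ hb
  set β := driftCoeff α c z with hβ
  set q := massCoeff α z with hq
  have hgc := hg.uniformContinuous.continuous
  have hφc : Continuous fun y => (r y : ℂ) := hsol.continuous
  have hφ'c : Continuous fun y => (r' y : ℂ) := hsol.continuous'
  have hforced : ForcedSol (potential β q g) (fun y => Complex.exp (β * y) * (fun _ => 0) y)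
      (fun y => (r y : ℂ)) (fun y => (r' y : ℂ)) :=
    ⟨hsol.deriv_fst, fun y => (hsol.deriv_snd y).congr_deriv (by
      simp only [mul_zero, add_zero]; rfl)⟩
  obtain ⟨hU, hUb⟩ := hforced.toBoundedSol hb
  set U := fun y : ℝ => Complex.exp (-β * y) * (r y : ℂ) with hUdef
  set U' := fun y : ℝ => Complex.exp (-β * y) * ((r' y : ℂ) - β * r y) with hU'def
  have hUc : Continuous U := by fun_prop
  have hU'c : Continuous U' := by fun_prop
  obtain ⟨u₀, hu₀, hu₀U, hu₀U'⟩ := exists_hul_two (β := β) (q := q) hg (0 : Hul 0) hU.deriv_fst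
    (by
      refine (isPrimitive_of_hasDerivAt hU.deriv_snd (by fun_prop)).congr ?_
      filter_upwards [Fn.coeFn_zero] with x hx
      have e : ((0 : Hul 0) : Fn) = 0 := rfl
      rw [e, hx]
      ring) hU'c hU.bounded.choose_spec
  have hu₀0 : u₀ ≠ 0 := by
    intro h0
    have : U =ᵐ[volume] fun _ => 0 := by
      refine hu₀U.symm.trans ?_
      rw [h0]
      exact Fn.coeFn_zero
    have := congrFun ((hUc.ae_eq_iff_eq volume continuous_const).1 this) y₀
    exact mul_ne_zero (Complex.exp_ne_zero _) hy₀ this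
  set e₀ : domainY := mkY u₀ (z • incl 1 u₀) with he₀
  have he₀ker : shift (generator α c g hg) z e₀ = 0 := by
    refine (shift_eq_iff hα hg z e₀ 0).2 ⟨?_, ?_⟩
    · simp only [he₀, fstY_mkY, Prod.fst_zero, add_zero]
      rfl
    · rw [map_zero, he₀, fstY_mkY]; exact hu₀
  have he₀0 : (e₀ : EnergySpace) ≠ 0 := by
    intro h0
    refine hu₀0 (Subtype.ext ?_)
    have : ((e₀ : EnergySpace).1 : Fn) = 0 := by rw [h0]; rfl
    exact this
  -- An eigenvector is determined by its first component, whose conjugate by e^{βy} is a solution of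
  -- size e^{by}, hence a multiple of r.
  have hspan : eigenspace (generator α c g hg) z = ℂ ∙ (e₀ : EnergySpace) := by
    refine le_antisymm ?_ ?_
    · rintro _ ⟨w, hw, rfl⟩
      obtain ⟨h1, h2⟩ := (shift_eq_iff hα hg z w 0).1 (LinearMap.mem_ker.1 hw)
      rw [map_zero] at h2
      rw [Prod.fst_zero, add_zero] at h1
      obtain ⟨W, W', hW, hWu⟩ := exists_boundedSol hg (fstY w) (G := fun _ => 0)
        continuous_const (by rw [h2]; exact Fn.coeFn_zero)
      obtain ⟨s1, s2⟩ := hW.toForcedSol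
      obtain ⟨a, ha⟩ := h.boundState_unique hr
        ⟨s1.deriv_fst, fun y => (s1.deriv_snd y).congr_deriv (by
          simp only [mul_zero, add_zero]; rfl)⟩ s2
      have hwu : fstY w = a • u₀ := by
        refine Subtype.ext (Fn.ext ?_)
        filter_upwards [hWu, hu₀U, Fn.coeFn_smul a (u₀ : Fn)] with x x1 x2 x3
        have e : ((a • u₀ : Hul 2) : Fn) = a • (u₀ : Fn) := rfl
        rw [e, x1, x3, x2, hUdef, smul_eq_mul]
        have := (ha x).1
        beta_reduce at this
        calc W x = Complex.exp (-β * x) * (Complex.exp (β * x) * W x) := by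
              rw [← mul_assoc, ← Complex.exp_add]; simp
          _ = _ := by rw [this]; ring
      refine Submodule.mem_span_singleton.2 ⟨a, ?_⟩
      have e : mkY (fstY w) (sndY w) = mkY (a • u₀) (a • z • incl 1 u₀) := by
        rw [h1, hwu, map_smul, smul_comm]
      exact (congrArg Subtype.val e).symm
    · refine (Submodule.span_singleton_le_iff_mem _ _).2 ⟨e₀, LinearMap.mem_ker.2 he₀ker, rfl⟩
  -- This is the source generated by the eigenvector (u₀, z u₀). It equals minus the z-derivative of
  -- the reduced operator applied to u₀, so its pairing with r decides algebraic simplicity.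
  set n₀ : ℝ → ℂ := fun y => (1 + 2 * α * z) * U y - 2 * α * c * U' y with hn₀
  have hn₀c : Continuous n₀ := by fun_prop
  have hsrc : ((sourceMap α c z (e₀ : EnergySpace) : Fn) : ℝ → ℂ) =ᵐ[volume] n₀ := by
    have e : sourceMap α c z (e₀ : EnergySpace) =
        (1 + 2 * α * z) • incl 0 (incl 1 u₀) - (2 * α * c : ℂ) • incl 0 (wderiv 1 u₀) := by
      have e1 : sourceMap α c z (e₀ : EnergySpace) = (α : ℂ) • incl 0 (z • incl 1 u₀)
          + (1 + α * z) • incl 0 (incl 1 u₀) - (2 * α * c : ℂ) • wderiv 0 (incl 1 u₀) := rfl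
      rw [e1, wderiv_incl, map_smul]
      module
    have e' : (sourceMap α c z (e₀ : EnergySpace) : Fn) =
        (1 + 2 * α * z) • (u₀ : Fn) - (2 * α * c : ℂ) • (wderiv 1 u₀ : Fn) := by rw [e]; rfl
    rw [e']
    filter_upwards [hu₀U, hu₀U', Fn.coeFn_smul (1 + 2 * α * z) (u₀ : Fn),
      Fn.coeFn_smul (2 * α * c : ℂ) (wderiv 1 u₀ : Fn),
      Fn.coeFn_sub ((1 + 2 * α * z) • (u₀ : Fn)) ((2 * α * c : ℂ) • (wderiv 1 u₀ : Fn))]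
      with x x1 x2 x3 x4 x5
    rw [x5, x3, x4, x1, x2]
    rfl
  have hβ' : 1 + 2 * α * z ≠ 0 := by
    intro h0
    have hp := h.pos
    rw [hβ, driftCoeff, h0] at hp
    simp at hp
  -- Here U' = e^{−βy}(r' − βr), and the term 2αcβ = αc²(1 + 2αz) produces the factor 1 + αc².
  have hen : ∀ y : ℝ, Complex.exp (β * y) * n₀ y =
      (1 + 2 * α * z) * (1 + α * c ^ 2) * r y - 2 * α * c * r' y := by
    intro y
    have ee : Complex.exp (β * y) * Complex.exp (-β * y) = 1 := by
      rw [← Complex.exp_add]; simp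
    have hβe : β = c * (1 + 2 * α * z) / 2 := rfl
    simp only [hn₀, hUdef, hU'def]
    linear_combination ((1 + 2 * α * z) * r y - 2 * α * c * (r' y - β * r y)) * ee +
      2 * α * c * r y * hβe
  obtain ⟨N, hN⟩ : ∃ N, ∀ y, ‖n₀ y‖ ≤ N := by
    obtain ⟨C, hC⟩ := hU.bounded
    refine ⟨‖1 + 2 * α * z‖ * C + ‖(2 * α * c : ℂ)‖ * C, fun y => ?_⟩
    refine (norm_sub_le _ _).trans ?_
    rw [norm_mul, norm_mul (2 * α * c : ℂ)]
    exact add_le_add (mul_le_mul_of_nonneg_left (hC y).1 (norm_nonneg _))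
      (mul_le_mul_of_nonneg_left (hC y).2 (norm_nonneg _))
  have hexp : ∀ {G : ℝ → ℂ} {M : ℝ}, (∀ y, ‖G y‖ ≤ M) →
      ∀ y : ℝ, ‖Complex.exp (β * y) * G y‖ ≤ M * Real.exp (β.re * y) := by
    intro G M hG y
    rw [norm_mul, norm_cexp_mul_real, mul_comm]
    exact mul_le_mul_of_nonneg_right (hG y) (Real.exp_pos _).le
  have hpair : ∫ y : ℝ, (r y : ℂ) * (Complex.exp (β * y) * n₀ y) ≠ 0 := by
    have hb' : ∀ y, ‖(r y : ℂ)‖ ≤ D * Real.exp (β.re * y) := fun y => (hb y).1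
    have i1 := h.integrable_boundState_mul hr hφc hb'
    have i2 := h.integrable_boundState_mul hr hφ'c fun y => (hb y).2
    -- The integrand is the derivative of r²/2, which vanishes at both ends. Only the term in ∫r²
    -- survives in the pairing.
    have z2 : ∫ y, (r y : ℂ) * r' y = 0 := by
      obtain ⟨δ, hδ, C, hC, hd⟩ := h.boundState_decay_mul hr
      obtain ⟨C', hC'⟩ : ∃ C', ∀ y, ‖(r y : ℂ)‖ ≤ C' := ⟨C * 1, fun y => (hd y).2.2.1.trans
        (mul_le_mul_of_nonneg_left (Real.exp_le_one_iff.2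
          (by nlinarith [abs_nonneg y])) hC)⟩
      have hbd : ∀ y, ‖(1 / 2 : ℂ) * ((r y : ℂ) * r y)‖ ≤ C' * C * Real.exp (-δ * |y|) := by
        intro y
        rw [norm_mul, norm_mul]
        have t1 := mul_le_mul (hC' y) (hd y).2.2.1 (norm_nonneg _)
          ((norm_nonneg _).trans (hC' y))
        have t2 : ‖(1 / 2 : ℂ)‖ ≤ 1 := by norm_num
        have t3 := mul_le_mul_of_nonneg_right t2
          (mul_nonneg (norm_nonneg (r y : ℂ)) (norm_nonneg (r y : ℂ)))
        linarith
      have hz := tendsto_exp_neg_mul_abs hδ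
      rw [integral_of_hasDerivAt_of_tendsto (f := fun y => (1 / 2 : ℂ) * ((r y : ℂ) * r y))
        (fun y => (((hsol.deriv_fst y).fun_mul (hsol.deriv_fst y)).const_mul _).congr_deriv
          (by ring)) i2 (m := 0) (n := 0)
        (squeeze_zero_norm hbd (by simpa using hz.2.const_mul (C' * C)))
        (squeeze_zero_norm hbd (by simpa using hz.1.const_mul (C' * C))), sub_zero]
    have e : ∀ y : ℝ, (r y : ℂ) * (Complex.exp (β * y) * n₀ y) =
        (1 + 2 * α * z) * (1 + α * c ^ 2) * (r y * r y) - 2 * α * c * (r y * r' y) := by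
      intro y; rw [hen]; ring
    simp only [e]
    rw [integral_sub (i1.const_mul _) (i2.const_mul _), integral_const_mul, integral_const_mul,
      z2, mul_zero, sub_zero]
    refine mul_ne_zero (mul_ne_zero hβ' ?_) (integral_sq_ne_zero ?_ i1 ?_ (y₀ := y₀))
    · have : (1 + α * c ^ 2 : ℝ) ≠ 0 := by positivity
      exact_mod_cast this
    · exact Complex.continuous_re.comp hφc
    · simpa using hy₀
  refine ⟨fun hres => ?_, ?_, ?_⟩
  · have := hres.1.1 (he₀ker.trans (map_zero (shift (generator α c g hg) z)).symm)
    exact he₀0 (by rw [this]; rfl)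
  · rw [hspan]
    exact finrank_span_singleton he₀0
  · rw [hspan]
    refine ⟨?_, ?_⟩
    -- If a multiple a e₀ lies in the range, then a n₀ is a solvable forcing and so orthogonal to
    -- the bound state; the nonzero pairing gives a = 0.
    · rw [Submodule.disjoint_def]
      intro x hx hx'
      obtain ⟨a, rfl⟩ := Submodule.mem_span_singleton.1 hx
      obtain ⟨w, hw⟩ := hx'
      obtain ⟨-, h2⟩ := (shift_eq_iff hα hg z w _).1 hw
      rw [map_smul] at h2
      obtain ⟨W, W', hW, hWu⟩ := exists_boundedSol hg (fstY w) (G := fun y => a * n₀ y)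
        (by fun_prop) (by
          rw [h2]
          refine (Fn.coeFn_smul a (sourceMap α c z (e₀ : EnergySpace) : Fn)).trans ?_
          filter_upwards [hsrc] with x hx
          rw [hx, smul_eq_mul])
      obtain ⟨s1, s2⟩ := hW.toForcedSol
      have hint := h.integral_boundState_mul_eq_zero hr (by fun_prop)
        (hexp (M := ‖a‖ * N) fun y => by
          rw [norm_mul]; exact mul_le_mul_of_nonneg_left (hN y) (norm_nonneg _)) s1 s2
      have e : ∀ y : ℝ, (r y : ℂ) * (Complex.exp (β * y) * (a * n₀ y)) =
        a * (r y * (Complex.exp (β * y) * n₀ y)) := fun y => by ring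
      simp only [e] at hint
      rw [integral_const_mul] at hint
      rw [(mul_eq_zero.1 hint).resolve_right hpair, zero_smul]
    · rw [codisjoint_iff, eq_top_iff]
      intro f _
      set F := sourceMap α c z f with hF
      obtain ⟨B, hB⟩ := hg.bounded
      set M := (ulNorm (F : Fn)).toReal with hM
      have hM0 : 0 ≤ M := ENNReal.toReal_nonneg
      obtain ⟨u, u', ρ, hρ, hu, hu', hub⟩ := exists_regularization (locallyIntegrable_coe F)
        (M := M) fun a b hab => norm_integral_le_ulNorm' (F : Fn).aesm (ulNorm_lt_top F) hab
      have hu'c : Continuous u' :=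
        hu'.continuous ((locallyIntegrable_coe F).sub hρ.locallyIntegrable)
      have huc : Continuous u := continuous_iff_continuousAt.2 fun y => (hu y).continuousAt
      set G := fun y => ρ y - 2 * β * u' y + (g y + q) * u y with hG
      have hGc : Continuous G := by fun_prop
      have hGb := norm_residual_le (β := β) (q := q) hB hub
      -- The coefficient is chosen so that f − a e₀ produces a forcing orthogonal to r, hence
      -- solvable; this puts f in the sum of the kernel and the range.
      set a := (∫ y : ℝ, (r y : ℂ) * (Complex.exp (β * y) * G y)) /
        ∫ y : ℝ, (r y : ℂ) * (Complex.exp (β * y) * n₀ y) with ha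
      have i1 := h.integrable_boundState_mul hr (f := fun y => Complex.exp (β * y) * G y)
        (by fun_prop) (hexp hGb)
      have i2 := h.integrable_boundState_mul hr (f := fun y => Complex.exp (β * y) * n₀ y)
        (by fun_prop) (hexp hN)
      have horth : ∫ y : ℝ, (r y : ℂ) * (Complex.exp (β * y) * (G y - a * n₀ y)) = 0 := by
        have e : ∀ y : ℝ, (r y : ℂ) * (Complex.exp (β * y) * (G y - a * n₀ y)) =
          r y * (Complex.exp (β * y) * G y) - a * (r y * (Complex.exp (β * y) * n₀ y)) :=
          fun y => by ring
        simp only [e]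
        rw [integral_sub i1 (i2.const_mul a), integral_const_mul, ha,
          div_mul_cancel₀ _ hpair, sub_self]
      have hbd : ∀ y, ‖G y - a * n₀ y‖ ≤ (3 + 4 * ‖β‖ + B + ‖q‖) * M + ‖a‖ * N := fun y => by
        refine (norm_sub_le _ _).trans (add_le_add (hGb y) ?_)
        rw [norm_mul]; exact mul_le_mul_of_nonneg_left (hN y) (norm_nonneg _)
      obtain ⟨w, w', hw, D', hD', hwb⟩ := h.exists_forcedSol_of_orthogonal hr (by fun_prop)
        (hexp hbd) horth
      obtain ⟨v, hv, -⟩ := exists_reducedOp_eq hg F (a • sourceMap α c z (e₀ : EnergySpace))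
        (H := fun y => a * n₀ y) (by fun_prop) (by
          refine (Fn.coeFn_smul a (sourceMap α c z (e₀ : EnergySpace) : Fn)).trans ?_
          filter_upwards [hsrc] with x hx
          rw [hx, smul_eq_mul]) (M := 2 * M) hρ hu hu'
          (fun y => ⟨(hub y).1.trans (by linarith), (hub y).2.1⟩) hw hwb
      rw [hF, ← map_smul, ← map_sub] at hv
      refine Submodule.mem_sup.2 ⟨a • (e₀ : EnergySpace),
        Submodule.smul_mem _ _ (Submodule.mem_span_singleton_self _), f - a • (e₀ : EnergySpace),
        ⟨mkY v (z • incl 1 v + (f - a • (e₀ : EnergySpace)).1),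
          (shift_eq_iff hα hg z _ _).2 ⟨rfl, hv⟩⟩, by abel⟩

/-! ### The bistable potential -/

namespace IsBistable

variable {V : ℝ → ℝ}

theorem contDiff_deriv (hV : IsBistable V) : ContDiff ℝ 2 (deriv V) := by
  have : ContDiff ℝ (2 + 1) V := by
    simpa [show (2 : WithTop ℕ∞) + 1 = 3 by norm_num] using hV.contDiff
  exact (contDiff_succ_iff_deriv.1 this).2.2

theorem contDiff_deriv_deriv (hV : IsBistable V) : ContDiff ℝ 1 (deriv (deriv V)) := by
  have : ContDiff ℝ (1 + 1) (deriv V) := by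
    simpa [show (1 : WithTop ℕ∞) + 1 = 2 by norm_num] using hV.contDiff_deriv
  exact (contDiff_succ_iff_deriv.1 this).2.2

theorem hasDerivAt (hV : IsBistable V) (u : ℝ) : HasDerivAt V (deriv V u) u :=
  (hV.contDiff.differentiable (by norm_num) u).hasDerivAt

theorem hasDerivAt_deriv (hV : IsBistable V) (u : ℝ) :
    HasDerivAt (deriv V) (deriv (deriv V) u) u :=
  (hV.contDiff_deriv.differentiable (by norm_num) u).hasDerivAt

theorem deriv_ne_zero (hV : IsBistable V) {p : ℝ} (hp : p ∈ Set.Ioo (0 : ℝ) 1) (h : V p ≤ 0) :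
    deriv V p ≠ 0 := by
  intro h0
  have : p ∈ {u : ℝ | deriv V u = 0 ∧ V u ≤ 0} := ⟨h0, h⟩
  rw [hV.critical] at this
  rcases this with rfl | h1
  · exact lt_irrefl _ hp.1
  · exact hp.2.ne h1

/-- If V'(p) > 0, the minimum of V over [0, p] is attained away from p, with value below V(p) ≤ 0 =
V(0), hence also away from 0. It would be a critical point in (0, 1) with V ≤ 0, which bistability
excludes. -/
theorem deriv_neg (hV : IsBistable V) {p : ℝ} (hp : p ∈ Set.Ioo (0 : ℝ) 1) (h : V p ≤ 0) :
    deriv V p < 0 := by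
  by_contra! hc
  have hpos : 0 < deriv V p := lt_of_le_of_ne hc (hV.deriv_ne_zero hp h).symm
  have hnot : ¬ IsMinOn V (Set.Icc 0 p) p := by
    intro hmin
    have h1 := (hasDerivWithinAt_iff_tendsto_slope' (s := Set.Iio p) (by simp)).1
      (hV.hasDerivAt p).hasDerivWithinAt
    refine not_le.2 hpos (le_of_tendsto h1 ?_)
    filter_upwards [Ioo_mem_nhdsLT hp.1] with y hy
    rw [slope_def_field]
    exact div_nonpos_of_nonneg_of_nonpos (sub_nonneg.2 (hmin ⟨hy.1.le, hy.2.le⟩))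
      (sub_nonpos.2 hy.2.le)
  obtain ⟨x, hx, hmin⟩ := (isCompact_Icc (a := (0 : ℝ)) (b := p)).exists_isMinOn
    ⟨0, le_rfl, hp.1.le⟩ hV.contDiff.continuous.continuousOn
  have hlt : V x < V p := by
    refine lt_of_le_of_ne (hmin ⟨hp.1.le, le_rfl⟩) fun he => hnot fun y hy => ?_
    have := hmin hy
    simp only [Set.mem_ofPred_eq] at this ⊢
    rwa [← he]
  have hx0 : x ≠ 0 := by
    rintro rfl
    rw [hV.val_zero] at hlt
    linarith
  have hxp : x ≠ p := by
    rintro rfl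
    exact lt_irrefl _ hlt
  have hxI : x ∈ Set.Ioo 0 p := ⟨lt_of_le_of_ne hx.1 hx0.symm, lt_of_le_of_ne hx.2 hxp⟩
  have hloc : IsLocalMin V x := hmin.isLocalMin (Icc_mem_nhds hxI.1 hxI.2)
  exact hV.deriv_ne_zero ⟨hxI.1, hxI.2.trans hp.2⟩ (hlt.le.trans h) hloc.deriv_eq_zero

/-- First-order expansion of V' at the two nondegenerate minima, with half of the smaller second
derivative to absorb the error. -/
theorem exists_mul_le_deriv (hV : IsBistable V) :
    ∃ κ, 0 < κ ∧ (∀ᶠ u in 𝓝 0, 0 ≤ u → κ * u ≤ deriv V u) ∧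
      ∀ᶠ u in 𝓝 1, u ≤ 1 → κ * (1 - u) ≤ -deriv V u := by
  set m := min (deriv (deriv V) 0) (deriv (deriv V) 1) with hm
  have hm0 : 0 < m := lt_min hV.deriv2_zero hV.deriv2_one
  refine ⟨m / 2, by positivity, ?_, ?_⟩
  · have h1 := (hasDerivAt_iff_isLittleO.1 (hV.hasDerivAt_deriv 0)).bound
      (c := m / 2) (by positivity)
    filter_upwards [h1] with u hu h0
    rw [hV.deriv_zero, sub_zero, sub_zero, smul_eq_mul, Real.norm_eq_abs, Real.norm_eq_abs,
      abs_of_nonneg h0] at hu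
    have := neg_le_of_abs_le hu
    nlinarith [min_le_left (deriv (deriv V) 0) (deriv (deriv V) 1)]
  · have h1 := (hasDerivAt_iff_isLittleO.1 (hV.hasDerivAt_deriv 1)).bound
      (c := m / 2) (by positivity)
    filter_upwards [h1] with u hu h0
    rw [hV.deriv_one, sub_zero, smul_eq_mul, Real.norm_eq_abs, Real.norm_eq_abs,
      abs_of_nonpos (sub_nonpos.2 h0)] at hu
    have := le_of_abs_le hu
    nlinarith [min_le_right (deriv (deriv V) 0) (deriv (deriv V) 1)]

end IsBistable

theorem exists_lipschitz_Icc {f : ℝ → ℝ} (hf : ContDiff ℝ 1 f) :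
    ∃ L : ℝ, 0 ≤ L ∧ ∀ u ∈ Set.Icc (0 : ℝ) 1, ∀ v ∈ Set.Icc (0 : ℝ) 1,
      |f u - f v| ≤ L * |u - v| := by
  obtain ⟨K, hK⟩ := LocallyLipschitzOn.exists_lipschitzOnWith_of_compact
    (isCompact_Icc (a := (0 : ℝ)) (b := 1)) (hf.locallyLipschitz.locallyLipschitzOn)
  exact ⟨K, K.2, fun u hu v hv => by simpa [Real.dist_eq] using hK.dist_le_mul u hu v hv⟩

/-! ### Limits of derivatives and exponential decay -/

/-- The mean value theorem on [n, n + 1] gives points tending to infinity at which k' tends to 0.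
There the energy tends to U(p), and monotonicity extends that limit to all y; this forces k'² → 0.
-/
theorem tendsto_deriv_of_energy {k k' U : ℝ → ℝ} {p : ℝ} (hk : ∀ y, HasDerivAt k (k' y) y)
    (hlim : Tendsto k atTop (𝓝 p)) (hU : Continuous U)
    (hE : Monotone (fun y => U (k y) - k' y ^ 2 / 2) ∨
      Antitone (fun y => U (k y) - k' y ^ 2 / 2)) :
    Tendsto k' atTop (𝓝 0) := by
  have hξ : ∀ n : ℕ, ∃ ξ ∈ Set.Ioo (n : ℝ) (n + 1), k' ξ = k (n + 1) - k n := by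
    intro n
    obtain ⟨ξ, h1, h2⟩ := exists_hasDerivAt_eq_slope k k' (lt_add_one (n : ℝ))
      (fun y _ => (hk y).continuousAt.continuousWithinAt) fun y _ => hk y
    exact ⟨ξ, h1, by rw [h2, add_sub_cancel_left, div_one]⟩
  choose ξ hξ1 hξ2 using hξ
  have hξt : Tendsto ξ atTop atTop :=
    tendsto_atTop_mono (fun n => (hξ1 n).1.le) tendsto_natCast_atTop_atTop
  have t1 : Tendsto (fun n => k' (ξ n)) atTop (𝓝 0) := by
    simp only [hξ2]
    have a1 := hlim.comp (tendsto_natCast_atTop_atTop (R := ℝ))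
    have a2 := hlim.comp ((tendsto_natCast_atTop_atTop (R := ℝ)).atTop_add
      (tendsto_const_nhds (x := (1 : ℝ))))
    simpa using a2.sub a1
  have t2 : Tendsto ((fun y => U (k y) - k' y ^ 2 / 2) ∘ ξ) atTop (𝓝 (U p)) := by
    have a1 := (hU.tendsto p).comp (hlim.comp hξt)
    have a2 := (t1.pow 2).div_const 2
    simpa [Function.comp_def] using a1.sub a2
  have t3 : Tendsto (fun y => U (k y) - k' y ^ 2 / 2) atTop (𝓝 (U p)) := by
    rcases hE with hE | hE
    · exact (tendsto_iff_tendsto_subseq_of_monotone hE hξt).2 t2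
    · exact (tendsto_iff_tendsto_subseq_of_antitone hE hξt).2 t2
  have t4 : Tendsto (fun y => k' y ^ 2) atTop (𝓝 0) := by
    have := (((hU.tendsto p).comp hlim).sub t3).const_mul 2
    refine (this.congr fun y => ?_).trans (by simp)
    simp only [Function.comp]
    ring
  refine (tendsto_zero_iff_abs_tendsto_zero _).2 ?_
  have := (Real.continuous_sqrt.tendsto 0).comp t4
  rw [Real.sqrt_zero] at this
  exact this.congr fun y => Real.sqrt_sq_eq_abs _

/-- With r, t > 0 such that rt = κ and t − r = c, one factors ∂² + c∂ − κ = (∂ + t)(∂ − r). Hence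
e^{ty}(k' − rk) is nondecreasing on the half-line and starts from the limit 0 at −∞. -/
theorem exists_mul_le_of_convex {k k' k'' : ℝ → ℝ} {c κ a : ℝ} (hκ : 0 < κ)
    (hk : ∀ y, HasDerivAt k (k' y) y) (hk' : ∀ y, HasDerivAt k' (k'' y) y)
    (hineq : ∀ y ≤ a, κ * k y ≤ k'' y + c * k' y) (h0 : Tendsto k atBot (𝓝 0))
    (h0' : Tendsto k' atBot (𝓝 0)) : ∃ r, 0 < r ∧ ∀ y ≤ a, r * k y ≤ k' y := by
  set s := Real.sqrt (c ^ 2 + 4 * κ) with hs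
  have hs2 : s ^ 2 = c ^ 2 + 4 * κ := Real.sq_sqrt (by positivity)
  have hsc : |c| < s := by
    rw [← Real.sqrt_sq_eq_abs]
    exact Real.sqrt_lt_sqrt (sq_nonneg c) (by linarith)
  obtain ⟨hc1, hc2⟩ := abs_lt.1 hsc
  set r := (s - c) / 2 with hr
  set t := (s + c) / 2 with ht
  have ht0 : 0 < t := by rw [ht]; linarith
  have hrt : r * t = κ := by rw [hr, ht]; linear_combination hs2 / 4
  have htr : t = r + c := by rw [hr, ht]; ring
  refine ⟨r, by rw [hr]; linarith, ?_⟩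
  set F := fun y => Real.exp (t * y) * (k' y - r * k y) with hF
  have hFd : ∀ y, HasDerivAt F (Real.exp (t * y) * (k'' y + c * k' y - κ * k y)) y := by
    intro y
    have he : HasDerivAt (fun y => Real.exp (t * y)) (Real.exp (t * y) * t) y := by
      simpa using ((hasDerivAt_id y).const_mul t).exp
    refine (he.fun_mul ((hk' y).fun_sub ((hk y).const_mul r))).congr_deriv ?_
    rw [← hrt]
    rw [htr]
    ring
  have hmono : MonotoneOn F (Set.Iic a) :=
    monotoneOn_of_hasDerivWithinAt_nonneg (convex_Iic a)
      (fun y _ => (hFd y).continuousAt.continuousWithinAt) (fun y _ => (hFd y).hasDerivWithinAt)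
      fun y hy => mul_nonneg (Real.exp_pos _).le
        (by linarith [hineq y (Set.mem_Iic.1 (interior_subset hy))])
  have hlim : Tendsto F atBot (𝓝 0) := by
    have h1 : Tendsto (fun y => Real.exp (t * y)) atBot (𝓝 0) :=
      Real.tendsto_exp_atBot.comp (tendsto_id.const_mul_atBot ht0)
    simpa using h1.mul (h0'.sub (h0.const_mul r))
  intro y hy
  have hFy : 0 ≤ F y := by
    refine le_of_tendsto hlim ?_
    filter_upwards [eventually_le_atBot y] with x hx
    exact hmono (hx.trans hy) hy hx
  have := nonneg_of_mul_nonneg_right hFy (Real.exp_pos (t * y))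
  linarith

theorem le_exp_of_mul_le_deriv {k k' : ℝ → ℝ} {r a : ℝ} (hk : ∀ y, HasDerivAt k (k' y) y)
    (h : ∀ y ≤ a, r * k y ≤ k' y) : ∀ y ≤ a, k y ≤ k a * Real.exp (r * (y - a)) := by
  set F := fun y => Real.exp (-r * (y - a)) * k y with hF
  have hFd : ∀ y, HasDerivAt F (Real.exp (-r * (y - a)) * (k' y - r * k y)) y := by
    intro y
    have he : HasDerivAt (fun y => Real.exp (-r * (y - a))) (Real.exp (-r * (y - a)) * -r) y := by
      simpa using (((hasDerivAt_id y).sub_const a).const_mul (-r)).exp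
    exact (he.fun_mul (hk y)).congr_deriv (by ring)
  have hmono : MonotoneOn F (Set.Iic a) :=
    monotoneOn_of_hasDerivWithinAt_nonneg (convex_Iic a)
      (fun y _ => (hFd y).continuousAt.continuousWithinAt) (fun y _ => (hFd y).hasDerivWithinAt)
      fun y hy => mul_nonneg (Real.exp_pos _).le
        (by linarith [h y (Set.mem_Iic.1 (interior_subset hy))])
  intro y hy
  have h1 := hmono hy (Set.mem_Iic.2 le_rfl) hy
  simp only [hF, sub_self, mul_zero, Real.exp_zero, one_mul] at h1
  have h2 : Real.exp (r * (y - a)) * Real.exp (-r * (y - a)) = 1 := by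
    rw [← Real.exp_add]; simp
  calc k y = Real.exp (r * (y - a)) * (Real.exp (-r * (y - a)) * k y) := by
        rw [← mul_assoc, h2, one_mul]
    _ ≤ Real.exp (r * (y - a)) * k a := mul_le_mul_of_nonneg_left h1 (Real.exp_pos _).le
    _ = _ := mul_comm _ _

/-! ### Properties of fronts -/

namespace IsFront

variable {V h : ℝ → ℝ} {c : ℝ}

theorem hasDerivAt (hh : IsFront V c h) (y : ℝ) : HasDerivAt h (deriv h y) y :=
  (hh.contDiff.differentiable (by norm_num) y).hasDerivAt

theorem hasDerivAt_deriv (hh : IsFront V c h) (y : ℝ) :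
    HasDerivAt (deriv h) (deriv V (h y) - c * deriv h y) y := by
  have h1 : ContDiff ℝ (1 + 1) h := by
    simpa [show (1 : WithTop ℕ∞) + 1 = 2 by norm_num] using hh.contDiff
  have h2 := (contDiff_succ_iff_deriv.1 h1).2.2
  exact (h2.differentiable (by norm_num) y).hasDerivAt.congr_deriv (by linarith [hh.ode y])

theorem hasDerivAt_reflect (hh : IsFront V c h) (y : ℝ) :
    HasDerivAt (fun y => h (-y)) (-deriv h (-y)) y := by
  exact ((hh.hasDerivAt (-y)).scomp y (hasDerivAt_neg y)).congr_deriv (by simp)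

theorem hasDerivAt_deriv_reflect (hh : IsFront V c h) (y : ℝ) :
    HasDerivAt (fun y => -deriv h (-y)) (deriv V (h (-y)) - c * deriv h (-y)) y := by
  exact ((hh.hasDerivAt_deriv (-y)).scomp y (hasDerivAt_neg y)).neg.congr_deriv (by simp)

/-- Along the profile this energy has derivative c h'², by the front equation and c > 0. -/
theorem monotone_energy (hV : IsBistable V) (hh : IsFront V c h) :
    Monotone fun y => V (h y) - deriv h y ^ 2 / 2 := by
  refine monotone_of_hasDerivAt_nonneg (f' := fun y => c * deriv h y ^ 2) (fun y => ?_)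
    fun y => mul_nonneg hh.speed_pos.le (sq_nonneg _)
  have h1 := (hV.hasDerivAt (h y)).comp y (hh.hasDerivAt y)
  have h2 := ((hh.hasDerivAt_deriv y).fun_pow 2).div_const 2
  refine (h1.fun_sub h2).congr_deriv ?_
  norm_num
  ring

theorem tendsto_deriv_atTop (hV : IsBistable V) (hh : IsFront V c h) :
    Tendsto (deriv h) atTop (𝓝 0) :=
  tendsto_deriv_of_energy hh.hasDerivAt hh.tendsto_atTop hV.contDiff.continuous
    (Or.inl (monotone_energy hV hh))

theorem tendsto_deriv_atBot (hV : IsBistable V) (hh : IsFront V c h) :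
    Tendsto (deriv h) atBot (𝓝 0) := by
  have h1 : Tendsto (fun y => -deriv h (-y)) atTop (𝓝 0) := by
    refine tendsto_deriv_of_energy hh.hasDerivAt_reflect
      (hh.tendsto_atBot.comp tendsto_neg_atTop_atBot) hV.contDiff.continuous (Or.inr ?_)
    intro x y hxy
    simpa using monotone_energy hV hh (neg_le_neg hxy)
  have h2 := (h1.comp tendsto_neg_atBot_atTop).neg
  simpa [Function.comp_def] using h2

/-- The energy increases to its limit V(0) = 0, so V(h) ≤ 0 wherever h' = 0, and there h'' = V'(h) <
0. Thus h' cannot cross zero upwards, and the limits of h provide points arbitrarily far to the left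
with h' ≤ 0. A zero of h' would then be a maximum of h', contradicting h'' < 0. -/
theorem deriv_neg (hV : IsBistable V) (hh : IsFront V c h) (y : ℝ) : deriv h y < 0 := by
  have hE : ∀ y, V (h y) - deriv h y ^ 2 / 2 ≤ 0 := by
    intro y
    refine (monotone_energy hV hh).ge_of_tendsto ?_ y
    have h1 := (hV.contDiff.continuous.tendsto 0).comp hh.tendsto_atTop
    have h2 := ((tendsto_deriv_atTop hV hh).pow 2).div_const 2
    simpa [hV.val_zero] using h1.sub h2
  have hcrit : ∀ y, deriv h y = 0 → deriv V (h y) - c * deriv h y < 0 := by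
    intro y hy
    have := hE y
    rw [hy] at this ⊢
    have := hV.deriv_neg (hh.mem_Ioo y) (by linarith)
    linarith
  have hle : ∀ y, deriv h y ≤ 0 := by
    intro y
    obtain ⟨x, hxy, hx⟩ : ∃ x < y, h y < h x :=
      ((eventually_lt_atBot y).and
        (hh.tendsto_atBot.eventually (lt_mem_nhds (hh.mem_Ioo y).2))).exists
    obtain ⟨ξ, h1, h2⟩ := exists_hasDerivAt_eq_slope h (deriv h) hxy
      (fun y _ => (hh.hasDerivAt y).continuousAt.continuousWithinAt) fun y _ => hh.hasDerivAt y
    have hξ : deriv h ξ ≤ 0 := by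
      rw [h2]
      exact div_nonpos_of_nonpos_of_nonneg (by linarith) (by linarith)
    exact image_le_of_deriv_right_lt_deriv_boundary (f := deriv h) (a := ξ) (b := y)
      (B := fun _ => 0) (B' := fun _ => 0)
      (fun y _ => (hh.hasDerivAt_deriv y).continuousAt.continuousWithinAt)
      (fun y _ => (hh.hasDerivAt_deriv y).hasDerivWithinAt) hξ
      (fun _ => hasDerivAt_const _ _) (fun x _ hx => hcrit x hx) ⟨h1.2.le, le_rfl⟩
  refine lt_of_le_of_ne (hle y) fun h0 => ?_
  have hmax : IsLocalMax (deriv h) y := Eventually.of_forall fun x => by rw [h0]; exact hle x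
  have h1 := hmax.hasDerivAt_eq_zero (hh.hasDerivAt_deriv y)
  have h2 := hcrit y h0
  linarith

theorem strictAnti (hV : IsBistable V) (hh : IsFront V c h) : StrictAnti h :=
  strictAnti_of_deriv_neg fun y => hh.deriv_neg hV y

/-- The front approaches its limits at an exponential rate, controlled by its slope. -/
theorem exists_mul_le_slope (hV : IsBistable V) (hh : IsFront V c h) :
    ∃ r, 0 < r ∧ ∃ a, 0 ≤ a ∧ (∀ y, a ≤ y → r * h y ≤ -deriv h y) ∧
      ∀ y, y ≤ -a → r * (1 - h y) ≤ -deriv h y := by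
  obtain ⟨κ, hκ, hκ0, hκ1⟩ := hV.exists_mul_le_deriv
  obtain ⟨a₁, ha₁⟩ := eventually_atTop.1 (hh.tendsto_atTop.eventually hκ0)
  obtain ⟨a₂, ha₂⟩ := eventually_atBot.1 (hh.tendsto_atBot.eventually hκ1)
  obtain ⟨r₁, hr₁, h1⟩ := exists_mul_le_of_convex (c := -c) (a := -a₁) hκ hh.hasDerivAt_reflect
    hh.hasDerivAt_deriv_reflect (fun y hy => by
      have := ha₁ (-y) (by linarith) (hh.mem_Ioo _).1.le
      linarith) (hh.tendsto_atTop.comp tendsto_neg_atBot_atTop)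
    (by simpa [Function.comp_def] using
      ((tendsto_deriv_atTop hV hh).comp tendsto_neg_atBot_atTop).neg)
  obtain ⟨r₂, hr₂, h2⟩ := exists_mul_le_of_convex (c := c) (a := a₂) (k := fun y => 1 - h y)
    (k' := fun y => -deriv h y) hκ
    (fun y => (hh.hasDerivAt y).const_sub 1) (fun y => (hh.hasDerivAt_deriv y).fun_neg)
    (fun y hy => by
      have := ha₂ y hy (hh.mem_Ioo _).2.le
      linarith) (by simpa using hh.tendsto_atBot.const_sub 1)
    (by simpa using (tendsto_deriv_atBot hV hh).neg)
  refine ⟨min r₁ r₂, lt_min hr₁ hr₂, max (max a₁ (-a₂)) 0, le_max_right _ _, fun y hy => ?_,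
    fun y hy => ?_⟩
  · have h3 := h1 (-y) (neg_le_neg (((le_max_left _ _).trans (le_max_left _ _)).trans hy))
    rw [neg_neg] at h3
    exact (mul_le_mul_of_nonneg_right (min_le_left _ _) (hh.mem_Ioo y).1.le).trans h3
  · have h3 : -a₂ ≤ -y := ((le_max_right _ _).trans (le_max_left _ _)).trans (by linarith)
    exact (mul_le_mul_of_nonneg_right (min_le_right _ _)
      (by linarith [(hh.mem_Ioo y).2])).trans (h2 y (by linarith))

theorem exists_exp_bound (hV : IsBistable V) (hh : IsFront V c h) :
    ∃ r, 0 < r ∧ ∃ C, 0 ≤ C ∧ (∀ y, 0 ≤ y → h y ≤ C * Real.exp (-r * y)) ∧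
      ∀ y, y ≤ 0 → 1 - h y ≤ C * Real.exp (r * y) := by
  obtain ⟨r, hr, a, ha, h1, h2⟩ := hh.exists_mul_le_slope hV
  refine ⟨r, hr, Real.exp (r * a), (Real.exp_pos _).le, fun y hy => ?_, fun y hy => ?_⟩
  · rw [← Real.exp_add]
    rcases le_total a y with hay | hay
    · have h3 := le_exp_of_mul_le_deriv (a := -a) (r := r) hh.hasDerivAt_reflect
        (fun y hy => h1 (-y) (by linarith)) (-y) (by linarith)
      rw [neg_neg, neg_neg] at h3
      refine h3.trans ((mul_le_of_le_one_left (Real.exp_pos _).le (hh.mem_Ioo a).2.le).trans ?_)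
      exact Real.exp_le_exp.2 (by linarith)
    · exact (hh.mem_Ioo y).2.le.trans (Real.one_le_exp (by nlinarith))
  · rw [← Real.exp_add]
    rcases le_total y (-a) with hay | hay
    · have h3 := le_exp_of_mul_le_deriv (a := -a) (r := r) (k := fun y => 1 - h y)
        (k' := fun y => -deriv h y) (fun y => (hh.hasDerivAt y).const_sub 1)
        (fun y hy => h2 y hy) y hay
      beta_reduce at h3
      refine h3.trans ((mul_le_of_le_one_left (Real.exp_pos _).le
        (by linarith [(hh.mem_Ioo (-a)).1])).trans ?_)
      exact Real.exp_le_exp.2 (by linarith)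
    · exact (by linarith [(hh.mem_Ioo y).1] : 1 - h y ≤ 1).trans
        (Real.one_le_exp (by nlinarith))

/-- The coefficient of the linearization converges exponentially. -/
theorem coeff_decay (hV : IsBistable V) (hh : IsFront V c h) :
    ∃ r, 0 < r ∧ ∃ C, 0 ≤ C ∧
      (∀ y, 0 ≤ y → |deriv (deriv V) (h y) - deriv (deriv V) 0| ≤ C * Real.exp (-r * y)) ∧
      ∀ y, y ≤ 0 → |deriv (deriv V) (h y) - deriv (deriv V) 1| ≤ C * Real.exp (r * y) := by
  obtain ⟨r, hr, C, hC, h1, h2⟩ := hh.exists_exp_bound hV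
  obtain ⟨L, hL, hLip⟩ := exists_lipschitz_Icc hV.contDiff_deriv_deriv
  have hm : ∀ y, h y ∈ Set.Icc (0 : ℝ) 1 := fun y => Set.Ioo_subset_Icc_self (hh.mem_Ioo y)
  refine ⟨r, hr, L * C, by positivity, fun y hy => ?_, fun y hy => ?_⟩
  · refine (hLip _ (hm y) 0 (by simp)).trans ?_
    rw [sub_zero, abs_of_nonneg (hm y).1, mul_assoc]
    exact mul_le_mul_of_nonneg_left (h1 y hy) hL
  · refine (hLip _ (hm y) 1 (by simp)).trans ?_
    rw [abs_of_nonpos (sub_nonpos.2 (hm y).2), neg_sub, mul_assoc]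
    exact mul_le_mul_of_nonneg_left (h2 y hy) hL

/-- The reaction term is controlled by the slope of the front. -/
theorem exists_abs_le_slope (hV : IsBistable V) (hh : IsFront V c h) :
    ∃ C, 0 ≤ C ∧ ∀ y, |deriv V (h y)| ≤ C * -deriv h y := by
  obtain ⟨r, hr, a, ha, h1, h2⟩ := hh.exists_mul_le_slope hV
  obtain ⟨L, hL, hLip⟩ := exists_lipschitz_Icc (hV.contDiff_deriv.of_le (by norm_num))
  have hm : ∀ y, h y ∈ Set.Icc (0 : ℝ) 1 := fun y => Set.Ioo_subset_Icc_self (hh.mem_Ioo y)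
  have hcont : Continuous fun y => |deriv V (h y)| / -deriv h y := by
    have c1 : Continuous (deriv h) :=
      continuous_iff_continuousAt.2 fun y => (hh.hasDerivAt_deriv y).continuousAt
    exact ((hV.contDiff_deriv.continuous.comp hh.contDiff.continuous).abs).div c1.neg
      fun y => (neg_pos.2 (hh.deriv_neg hV y)).ne'
  -- On the compact middle part the quotient |V'(h)|/|h'| is continuous; near the ends V' is
  -- Lipschitz and the distance of h to its limit is at most |h'|/r.
  obtain ⟨B, hB⟩ := (isCompact_Icc (a := -a) (b := a)).exists_bound_of_continuousOn
    hcont.continuousOn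
  refine ⟨max B (L / r), le_max_of_le_right (by positivity), fun y => ?_⟩
  have hp : 0 < -deriv h y := neg_pos.2 (hh.deriv_neg hV y)
  by_cases hy : y ∈ Set.Icc (-a) a
  · have h3 := (le_abs_self _).trans (hB y hy)
    exact ((div_le_iff₀ hp).1 h3).trans (mul_le_mul_of_nonneg_right (le_max_left _ _) hp.le)
  · refine le_trans ?_ (mul_le_mul_of_nonneg_right (le_max_right _ _) hp.le)
    rw [div_mul_eq_mul_div, le_div_iff₀ hr]
    rcases le_total a y with hay | hay
    · have h3 := hLip _ (hm y) 0 (by simp)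
      rw [hV.deriv_zero, sub_zero, sub_zero, abs_of_nonneg (hm y).1] at h3
      nlinarith [h1 y hay]
    · have hay' : y ≤ -a := by
        by_contra! hc
        exact hy ⟨hc.le, hay⟩
      have h3 := hLip _ (hm y) 1 (by simp)
      rw [hV.deriv_one, sub_zero, abs_of_nonpos (sub_nonpos.2 (hm y).2), neg_sub] at h3
      nlinarith [h2 y hay']

end IsFront

/-! ### Uniqueness of the front up to translation -/

theorem hasDerivAt_of_comp_eq {f k T : ℝ → ℝ} {y f' k' : ℝ} (hT : ContinuousAt T y)
    (hf : HasDerivAt f f' (T y)) (hf0 : f' ≠ 0) (hk : HasDerivAt k k' y)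
    (h : ∀ x, f (T x) = k x) : HasDerivAt T (k' / f') y := by
  have hd : Tendsto (fun x => dslope f (T y) (T x)) (𝓝[≠] y) (𝓝 f') := by
    have h1 : ContinuousAt (dslope f (T y)) (T y) :=
      continuousAt_dslope_same.2 hf.differentiableAt
    have h2 := h1.tendsto.comp (hT.tendsto.mono_left (nhdsWithin_le_nhds (s := {y}ᶜ)))
    rwa [dslope_same, hf.deriv] at h2
  refine hasDerivAt_iff_tendsto_slope.2
    (((hasDerivAt_iff_tendsto_slope.1 hk).div hd hf0).congr' ?_)
  filter_upwards [hd.eventually_ne hf0, self_mem_nhdsWithin] with x hx hxy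
  have hxy' : x - y ≠ 0 := sub_ne_zero.2 hxy
  have h3 := sub_smul_dslope f (T y) (T x)
  rw [h, h, smul_eq_mul] at h3
  rw [Pi.div_apply, slope_def_field, slope_def_field, ← h3]
  field_simp

/-- Outside a compact interval, the primitive can only increase when moving away from the origin. -/
theorem bddBelow_integral_of_sign {a : ℝ → ℝ} (ha : Continuous a)
    (hp : ∀ᶠ y in atTop, 0 ≤ a y) (hn : ∀ᶠ y in atBot, a y ≤ 0) :
    ∃ B, ∀ y, B ≤ ∫ t in (0 : ℝ)..y, a t := by
  obtain ⟨p, hp⟩ := eventually_atTop.1 hp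
  obtain ⟨n, hn⟩ := eventually_atBot.1 hn
  set A := fun y => ∫ t in (0 : ℝ)..y, a t with hA
  have hAd : ∀ y, HasDerivAt A (a y) y := fun y =>
    intervalIntegral.integral_hasDerivAt_right (ha.intervalIntegrable _ _)
      ha.stronglyMeasurable.stronglyMeasurableAtFilter ha.continuousAt
  have hAc : Continuous A := continuous_iff_continuousAt.2 fun y => (hAd y).continuousAt
  have m1 : MonotoneOn A (Set.Ici p) :=
    monotoneOn_of_hasDerivWithinAt_nonneg (convex_Ici p) hAc.continuousOn
      (fun y _ => (hAd y).hasDerivWithinAt) fun y hy => hp y (Set.mem_Ici.1 (interior_subset hy))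
  have m2 : AntitoneOn A (Set.Iic n) :=
    antitoneOn_of_hasDerivWithinAt_nonpos (convex_Iic n) hAc.continuousOn
      (fun y _ => (hAd y).hasDerivWithinAt) fun y hy => hn y (Set.mem_Iic.1 (interior_subset hy))
  obtain ⟨B, hB⟩ := (isCompact_Icc (a := min n p) (b := max n p)).exists_bound_of_continuousOn
    hAc.continuousOn
  have hB' : ∀ y ∈ Set.Icc (min n p) (max n p), -B ≤ A y := fun y hy => neg_le_of_abs_le (hB y hy)
  refine ⟨-B, fun y => ?_⟩
  by_cases hy : y ∈ Set.Icc (min n p) (max n p)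
  · exact hB' y hy
  · rcases le_total p y with h1 | h1
    · exact (hB' p ⟨min_le_right _ _, le_max_right _ _⟩).trans (m1 (Set.mem_Ici.2 le_rfl) h1 h1)
    · have h2 : y ≤ n := by
        by_contra! hc
        exact hy ⟨(min_le_left _ _).trans hc.le, h1.trans (le_max_right _ _)⟩
      exact (hB' n ⟨min_le_left _ _, le_max_left _ _⟩).trans (m2 h2 (Set.mem_Iic.2 le_rfl) h2)

namespace IsFront

variable {V : ℝ → ℝ}

theorem exists_eq {h : ℝ → ℝ} {c : ℝ} (hh : IsFront V c h) {u : ℝ}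
    (hu : u ∈ Set.Ioo (0 : ℝ) 1) : ∃ y, h y = u :=
  mem_range_of_exists_le_of_exists_ge hh.contDiff.continuous
    ((hh.tendsto_atTop.eventually (gt_mem_nhds hu.1)).exists.imp fun _ h => h.le)
    ((hh.tendsto_atBot.eventually (lt_mem_nhds hu.2)).exists.imp fun _ h => h.le)

/-- The slopes P and Q of the two fronts are compared at equal heights. Their difference satisfies
(Q − P)' = a(Q − P) − (c₂ − c₁)P with a = V'(h₁)/Q. After an integrating factor this is monotone and
tends to 0 at both ends, so it vanishes; then c₁ = c₂, and equal slopes at equal heights mean a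
translation. -/
theorem exists_translate_of_le (hV : IsBistable V) {h₁ h₂ : ℝ → ℝ} {c₁ c₂ : ℝ}
    (hh₁ : IsFront V c₁ h₁) (hh₂ : IsFront V c₂ h₂) (hc : c₁ ≤ c₂) :
    c₁ = c₂ ∧ ∃ s, ∀ y, h₂ (y + s) = h₁ y := by
  -- T(y) is the place where the second front has the height h₁(y). It is an increasing
  -- homeomorphism with T' = P/Q.
  choose T hT using fun y => hh₂.exists_eq (hh₁.mem_Ioo y)
  have hTm : StrictMono T := fun x y hxy => by
    have := hh₁.strictAnti hV hxy
    rw [← hT, ← hT] at this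
    exact (hh₂.strictAnti hV).lt_iff_gt.1 this
  have hTs : Function.Surjective T := fun x => by
    obtain ⟨y, hy⟩ := hh₁.exists_eq (hh₂.mem_Ioo x)
    exact ⟨y, (hh₂.strictAnti hV).injective (by rw [hT, hy])⟩
  have hTc : Continuous T := hTm.monotone.continuous_of_surjective hTs
  have hTtop : Tendsto T atTop atTop :=
    tendsto_atTop_atTop_of_monotone hTm.monotone fun b => (hTs b).imp fun _ h => h.ge
  have hTbot : Tendsto T atBot atBot :=
    tendsto_atBot_atBot_of_monotone hTm.monotone fun b => (hTs b).imp fun _ h => h.le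
  set P := fun y => -deriv h₁ y with hP
  set Q := fun y => -deriv h₂ (T y) with hQ
  have hP0 : ∀ y, 0 < P y := fun y => neg_pos.2 (hh₁.deriv_neg hV y)
  have hQ0 : ∀ y, 0 < Q y := fun y => neg_pos.2 (hh₂.deriv_neg hV (T y))
  have hTd : ∀ y, HasDerivAt T (P y / Q y) y := fun y => by
    have := hasDerivAt_of_comp_eq hTc.continuousAt (hh₂.hasDerivAt (T y))
      (hh₂.deriv_neg hV (T y)).ne (hh₁.hasDerivAt y) hT
    exact this.congr_deriv (by simp only [hP, hQ]; rw [neg_div_neg_eq])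
  have hPd : ∀ y, HasDerivAt P (-(deriv V (h₁ y) + c₁ * P y)) y := fun y =>
    (hh₁.hasDerivAt_deriv y).fun_neg.congr_deriv (by simp only [hP]; ring)
  have hQd : ∀ y, HasDerivAt Q (-(deriv V (h₁ y) + c₂ * Q y) * (P y / Q y)) y := fun y =>
    ((hh₂.hasDerivAt_deriv (T y)).comp y (hTd y)).fun_neg.congr_deriv
      (by simp only [hQ, hT]; ring)
  have hQc : Continuous Q := continuous_iff_continuousAt.2 fun y => (hQd y).continuousAt
  set a := fun y => deriv V (h₁ y) / Q y with ha
  have hac : Continuous a := (hV.contDiff_deriv.continuous.comp hh₁.contDiff.continuous).div hQc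
    fun y => (hQ0 y).ne'
  obtain ⟨κ, hκ, hκ0, hκ1⟩ := hV.exists_mul_le_deriv
  -- V' is positive just above 0 and negative just below 1, so a has the favourable sign at each
  -- end. The integrating factor M = e^{−∫a} is therefore bounded above.
  obtain ⟨B, hB⟩ := bddBelow_integral_of_sign hac
    (by
      filter_upwards [hh₁.tendsto_atTop.eventually hκ0] with y hy
      have h0 := (hh₁.mem_Ioo y).1.le
      exact div_nonneg ((mul_nonneg hκ.le h0).trans (hy h0)) (hQ0 y).le)
    (by
      filter_upwards [hh₁.tendsto_atBot.eventually hκ1] with y hy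
      have h0 := (hh₁.mem_Ioo y).2.le
      have h3 := (mul_nonneg hκ.le (sub_nonneg.2 h0)).trans (hy h0)
      exact div_nonpos_of_nonpos_of_nonneg (by linarith) (hQ0 y).le)
  set M := fun y => Real.exp (-∫ t in (0 : ℝ)..y, a t) with hM
  have hMd : ∀ y, HasDerivAt M (M y * -a y) y := fun y =>
    (intervalIntegral.integral_hasDerivAt_right (hac.intervalIntegrable _ _)
      hac.stronglyMeasurable.stronglyMeasurableAtFilter hac.continuousAt).fun_neg.exp
  have hM0 : ∀ y, 0 < M y := fun y => Real.exp_pos _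
  have hMB : ∀ y, M y ≤ Real.exp (-B) := fun y => Real.exp_le_exp.2 (neg_le_neg (hB y))
  set F := fun y => M y * (Q y - P y) with hF
  have hFd : ∀ y, HasDerivAt F (-(M y * ((c₂ - c₁) * P y))) y := fun y =>
    ((hMd y).fun_mul ((hQd y).fun_sub (hPd y))).congr_deriv (by
      have := (hQ0 y).ne'
      simp only [ha]
      field_simp
      ring)
  have hFm : Antitone F := antitone_of_hasDerivAt_nonpos hFd fun y =>
    neg_nonpos.2 (mul_nonneg (hM0 y).le (mul_nonneg (sub_nonneg.2 hc) (hP0 y).le))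
  have hlim : ∀ l : Filter ℝ, Tendsto (fun y => Q y - P y) l (𝓝 0) → Tendsto F l (𝓝 0) := by
    intro l hl
    refine squeeze_zero_norm (a := fun y => Real.exp (-B) * |Q y - P y|) (fun y => ?_)
      (by simpa using hl.abs.const_mul (Real.exp (-B)))
    rw [Real.norm_eq_abs, abs_mul, abs_of_pos (hM0 y)]
    exact mul_le_mul_of_nonneg_right (hMB y) (abs_nonneg _)
  have l1 : Tendsto F atTop (𝓝 0) := hlim _ (by
    simpa [hP, hQ, Function.comp_def] using
      (((hh₂.tendsto_deriv_atTop hV).comp hTtop).neg).sub (hh₁.tendsto_deriv_atTop hV).neg)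
  have l2 : Tendsto F atBot (𝓝 0) := hlim _ (by
    simpa [hP, hQ, Function.comp_def] using
      (((hh₂.tendsto_deriv_atBot hV).comp hTbot).neg).sub (hh₁.tendsto_deriv_atBot hV).neg)
  have hF0 : F = fun _ => 0 := funext fun y =>
    le_antisymm (hFm.ge_of_tendsto l2 y) (hFm.le_of_tendsto l1 y)
  have hPQ : ∀ y, Q y = P y := fun y => by
    have := congrFun hF0 y
    exact sub_eq_zero.1 ((mul_eq_zero.1 this).resolve_left (hM0 y).ne')
  refine ⟨?_, T 0, fun y => ?_⟩
  · have h1 := hFd 0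
    rw [hF0] at h1
    have h2 := h1.unique (hasDerivAt_const 0 0)
    have h3 := (mul_eq_zero.1 (neg_eq_zero.1 h2)).resolve_left (hM0 0).ne'
    linarith [(mul_eq_zero.1 h3).resolve_right (hP0 0).ne']
  · have h1 : ∀ y, HasDerivAt (fun y => T y - y) 0 y := fun y =>
      ((hTd y).fun_sub (hasDerivAt_id y)).congr_deriv (by
        rw [hPQ, div_self (hP0 y).ne', sub_self])
    have h2 := eq_const_of_hasDerivAt_zero h1 y 0
    beta_reduce at h2
    rw [← hT y]
    congr 1
    linarith

theorem exists_translate (hV : IsBistable V) {h₁ h₂ : ℝ → ℝ} {c₁ c₂ : ℝ}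
    (hh₁ : IsFront V c₁ h₁) (hh₂ : IsFront V c₂ h₂) :
    c₁ = c₂ ∧ ∃ s, ∀ y, h₂ (y + s) = h₁ y := by
  rcases le_total c₁ c₂ with hc | hc
  · exact exists_translate_of_le hV hh₁ hh₂ hc
  · obtain ⟨e, s, hs⟩ := exists_translate_of_le hV hh₂ hh₁ hc
    exact ⟨e.symm, -s, fun y => by rw [← hs, neg_add_cancel_right]⟩

end IsFront

/-! ### Dichotomy to the right of the essential spectrum -/

theorem re_cpow_half_nonneg (x : ℂ) : 0 ≤ (x ^ (1 / 2 : ℂ)).re := by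
  rcases eq_or_ne x 0 with rfl | hx
  · simp
  · rw [Complex.cpow_def_of_ne_zero hx, Complex.exp_re]
    refine mul_nonneg (Real.exp_pos _).le (Real.cos_nonneg_of_mem_Icc ?_)
    have e : (Complex.log x * (1 / 2 : ℂ)).im = x.arg / 2 := by
      have : Complex.log x * (1 / 2 : ℂ) = ((1 / 2 : ℝ) : ℂ) * Complex.log x := by
        push_cast; ring
      rw [this, Complex.im_ofReal_mul, Complex.log_im]; ring
    rw [e]
    exact ⟨by linarith [Complex.neg_pi_lt_arg x], by linarith [Complex.arg_le_pi x]⟩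

theorem mConst_pos {V : ℝ → ℝ} (hV : IsBistable V) : 0 < mConst V :=
  lt_min hV.deriv2_zero hV.deriv2_one

/-- Here ρ is the real part of s = √(1 − 4αm), and ρ² − (Im s)² = 1 − 4αm gives the lower bound for
ρ². If ρ ≥ 1, then Im s = 0 because s² is real, and ρ² = 1 − 4αm < 1 is a contradiction. -/
theorem muConst_spec {α : ℝ} (hα : 0 < α) {V : ℝ → ℝ} (hV : IsBistable V) :
    ∃ ρ, 0 ≤ ρ ∧ ρ < 1 ∧ 1 - 4 * α * mConst V ≤ ρ ^ 2 ∧ 1 + 2 * α * muConst α V = ρ := by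
  set s : ℂ := ((1 - 4 * α * mConst V : ℝ) : ℂ) ^ (1 / 2 : ℂ) with hs
  have hs2 : s ^ 2 = ((1 - 4 * α * mConst V : ℝ) : ℂ) := by
    have := Complex.cpow_nat_inv_pow ((1 - 4 * α * mConst V : ℝ) : ℂ) (n := 2) (by norm_num)
    rw [← this, hs]
    norm_num
  have hre := congrArg Complex.re hs2
  have him := congrArg Complex.im hs2
  rw [sq, Complex.mul_re, Complex.ofReal_re] at hre
  rw [sq, Complex.mul_im, Complex.ofReal_im] at him
  have hm := mConst_pos hV
  have h0 : 0 ≤ s.re := re_cpow_half_nonneg _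
  refine ⟨s.re, h0, ?_, by nlinarith [sq_nonneg s.im], ?_⟩
  · by_contra! h1
    have h2 : s.im = 0 := by
      have : s.re * s.im = 0 := by linarith
      exact (mul_eq_zero.1 this).resolve_left (by linarith)
    rw [h2] at hre
    nlinarith [mul_pos hα hm]
  · rw [muConst, ← hs]
    field_simp
    ring

theorem muConst_neg {α : ℝ} (hα : 0 < α) {V : ℝ → ℝ} (hV : IsBistable V) : muConst α V < 0 := by
  obtain ⟨ρ, -, h1, -, h2⟩ := muConst_spec hα hV
  by_contra! hc
  nlinarith [mul_nonneg hα.le hc]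

theorem driftCoeff_re (α c : ℝ) (z : ℂ) : (driftCoeff α c z).re = c * (1 + 2 * α * z.re) / 2 := by
  have : driftCoeff α c z = ((c / 2 : ℝ) : ℂ) * (1 + ((2 * α : ℝ) : ℂ) * z) := by
    rw [driftCoeff]; push_cast; ring
  rw [this, Complex.re_ofReal_mul, Complex.add_re, Complex.re_ofReal_mul, Complex.one_re]
  ring

theorem spectralShift_eq {α c : ℝ} (hα : 0 < α) (z : ℂ) :
    massCoeff α z + driftCoeff α c z ^ 2 =
      (((1 + α * c ^ 2) / (4 * α) : ℝ) : ℂ) * (1 + 2 * α * z) ^ 2 - ((1 / (4 * α) : ℝ) : ℂ) := by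
  have hα' : (α : ℂ) ≠ 0 := by exact_mod_cast hα.ne'
  rw [massCoeff, driftCoeff]
  push_cast
  field_simp
  ring

/-- Put κ = x + iy, p = 1 + 2α Re z, t = 2α Im z and k = 1/(4α) + c²/4. Then xy = kpt, and the
hypothesis on G says x² − y² > c²p²/4 − kt². If x ≤ cp/2 with x > 0, multiplying by x² gives k²p²t²
< (c²/4)kp²t², which contradicts k > c²/4. The case x = 0 forces t = 0 and is excluded directly. -/
theorem exists_sqrt_re_gt {α c G : ℝ} (hα : 0 < α) (hc : 0 < c) {z : ℂ}
    (hp : 0 < 1 + 2 * α * z.re) (hG : 1 - 4 * α * G < (1 + 2 * α * z.re) ^ 2) :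
    ∃ κ : ℂ, κ ^ 2 = G + massCoeff α z + driftCoeff α c z ^ 2 ∧
      (driftCoeff α c z).re < κ.re := by
  obtain ⟨κ, hκ, hκ0⟩ : ∃ κ : ℂ, κ ^ 2 = G + massCoeff α z + driftCoeff α c z ^ 2 ∧
      0 ≤ κ.re := by
    refine ⟨(G + massCoeff α z + driftCoeff α c z ^ 2) ^ (1 / 2 : ℂ), ?_,
      re_cpow_half_nonneg _⟩
    have := Complex.cpow_nat_inv_pow (G + massCoeff α z + driftCoeff α c z ^ 2) (n := 2)
      (by norm_num)
    norm_num at this ⊢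
    exact this
  refine ⟨κ, hκ, ?_⟩
  set p := 1 + 2 * α * z.re with hpdef
  set t := 2 * α * z.im with ht
  set k := (1 + α * c ^ 2) / (4 * α) with hk
  have e1 : (1 + 2 * α * z : ℂ) = (p : ℂ) + t * Complex.I := by
    apply Complex.ext <;> simp [hpdef, ht]
  have e2 : κ ^ 2 = ((G - 1 / (4 * α) + k * (p ^ 2 - t ^ 2) : ℝ) : ℂ) +
      ((2 * k * p * t : ℝ) : ℂ) * Complex.I := by
    rw [hκ, add_assoc, spectralShift_eq hα, e1, ← hk]
    push_cast
    linear_combination (k * t ^ 2 : ℂ) * Complex.I_sq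
  have hre := congrArg Complex.re e2
  have him := congrArg Complex.im e2
  simp only [sq κ, Complex.mul_re, Complex.mul_im, Complex.add_re, Complex.add_im,
    Complex.ofReal_re, Complex.ofReal_im, Complex.I_re, Complex.I_im] at hre him
  set x := κ.re
  set y := κ.im
  have hk1 : c ^ 2 / 4 < k := by
    rw [hk, lt_div_iff₀ (by positivity)]; nlinarith
  have hkk : k = 1 / (4 * α) + c ^ 2 / 4 := by
    rw [hk]; field_simp
  have hG' : -(p ^ 2 / (4 * α)) < G - 1 / (4 * α) := by
    rw [neg_div', ← sub_pos]
    have : G - 1 / (4 * α) - -p ^ 2 / (4 * α) = (p ^ 2 - (1 - 4 * α * G)) / (4 * α) := by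
      field_simp
      ring
    rw [this]
    exact div_pos (by linarith) (by positivity)
  have hlow : c ^ 2 * p ^ 2 / 4 - k * t ^ 2 < x ^ 2 - y ^ 2 := by
    have : k * p ^ 2 = p ^ 2 / (4 * α) + c ^ 2 * p ^ 2 / 4 := by rw [hkk]; ring
    nlinarith
  have hxy : x * y = k * p * t := by linarith
  have hb0 : 0 < c * p / 2 := by positivity
  rw [driftCoeff_re, ← hpdef]
  by_contra! hxb
  have hk0 : 0 < k := lt_of_le_of_lt (by positivity) hk1
  have hx2 : x ^ 2 ≤ c ^ 2 * p ^ 2 / 4 := by nlinarith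
  rcases hκ0.eq_or_lt with hx0 | hx0
  · have ht0 : t = 0 := by
      rw [← hx0, zero_mul] at hxy
      exact (mul_eq_zero.1 hxy.symm).resolve_left (mul_pos hk0 hp).ne'
    rw [ht0, ← hx0] at hlow
    nlinarith [sq_nonneg y, sq_nonneg (c * p)]
  · have h1 : x ^ 2 * (c ^ 2 * p ^ 2 / 4 - x ^ 2 + y ^ 2) < x ^ 2 * (k * t ^ 2) :=
      mul_lt_mul_of_pos_left (by linarith) (by positivity)
    have h2 : x ^ 2 * y ^ 2 = k ^ 2 * p ^ 2 * t ^ 2 := by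
      calc x ^ 2 * y ^ 2 = (x * y) ^ 2 := by ring
        _ = _ := by rw [hxy]; ring
    have h3 : x ^ 2 * (k * t ^ 2) ≤ c ^ 2 * p ^ 2 / 4 * (k * t ^ 2) :=
      mul_le_mul_of_nonneg_right hx2 (by positivity)
    have h4 : 0 ≤ x ^ 2 * (c ^ 2 * p ^ 2 / 4 - x ^ 2) :=
      mul_nonneg (sq_nonneg _) (by linarith)
    have h5 : 0 ≤ k * (p ^ 2 * t ^ 2) * (k - c ^ 2 / 4) :=
      mul_nonneg (by positivity) (by linarith)
    nlinarith

/-- The linearization of the damped wave equation at the front. -/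
abbrev linearizedCoeff (V h : ℝ → ℝ) : ℝ → ℝ := fun y => deriv (deriv V) (h y)

theorem IsFront.exists_dichotomy {α : ℝ} (hα : 0 < α) {V : ℝ → ℝ} (hV : IsBistable V) {c : ℝ}
    {h : ℝ → ℝ} (hh : IsFront V c h) {z : ℂ} (hz : muConst α V < z.re) :
    ∃ κ₁ κ₂, Dichotomy (spectralPotential α c (linearizedCoeff V h) z)
      (driftCoeff α c z).re κ₁ κ₂ := by
  obtain ⟨ρ, hρ0, -, hρ2, hρ⟩ := muConst_spec hα hV
  have hpρ : ρ < 1 + 2 * α * z.re := by rw [← hρ]; nlinarith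
  have hp : 0 < 1 + 2 * α * z.re := hρ0.trans_lt hpρ
  have hG : ∀ G, mConst V ≤ G → 1 - 4 * α * G < (1 + 2 * α * z.re) ^ 2 := by
    intro G hG
    have h1 := mul_le_mul_of_nonneg_left hG hα.le
    have h2 : ρ ^ 2 < (1 + 2 * α * z.re) ^ 2 := pow_lt_pow_left₀ hpρ hρ0 (by norm_num)
    linarith
  obtain ⟨κ₁, h1, h1'⟩ := exists_sqrt_re_gt hα hh.speed_pos hp (hG _ (min_le_left _ _))
  obtain ⟨κ₂, h2, h2'⟩ := exists_sqrt_re_gt hα hh.speed_pos hp (hG _ (min_le_right _ _))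
  have hg := isBUC_linearized hV hh
  have hgc := hg.uniformContinuous.continuous
  have hPc : Continuous (spectralPotential α c (linearizedCoeff V h) z) := by
    unfold spectralPotential potential
    fun_prop
  obtain ⟨r, hr, C, hC, d1, d2⟩ := hh.coeff_decay hV
  refine ⟨κ₁, κ₂, hPc, ?_, ?_, h1', h2', ?_, ?_⟩
  · obtain ⟨B, hB⟩ := hg.bounded
    refine ⟨B + ‖massCoeff α z‖ + ‖driftCoeff α c z ^ 2‖, fun y => ?_⟩
    refine (norm_add_le _ _).trans (add_le_add ((norm_add_le _ _).trans (add_le_add ?_ le_rfl))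
      le_rfl)
    rw [Complex.norm_real]
    exact hB y
  · rw [driftCoeff_re]
    have := hh.speed_pos
    positivity
  · refine Integrable.mono' (((integrableOn_exp_mul_Ioi (neg_lt_zero.2 hr) 0).const_mul C))
      (hPc.sub continuous_const).aestronglyMeasurable
      ((ae_restrict_mem measurableSet_Ioi).mono fun y hy => ?_)
    have e : spectralPotential α c (linearizedCoeff V h) z y - κ₁ ^ 2 =
        ((deriv (deriv V) (h y) - deriv (deriv V) 0 : ℝ) : ℂ) := by
      rw [h1, spectralPotential, potential]; push_cast; ring
    rw [e, Complex.norm_real]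
    exact d1 y (le_of_lt hy)
  · refine Integrable.mono' (((integrableOn_exp_mul_Ioi (neg_lt_zero.2 hr) 0).const_mul C))
      ((hPc.comp continuous_neg).sub continuous_const).aestronglyMeasurable
      ((ae_restrict_mem measurableSet_Ioi).mono fun y hy => ?_)
    have e : spectralPotential α c (linearizedCoeff V h) z (-y) - κ₂ ^ 2 =
        ((deriv (deriv V) (h (-y)) - deriv (deriv V) 1 : ℝ) : ℂ) := by
      rw [h2, spectralPotential, potential]; push_cast; ring
    rw [e, Complex.norm_real]
    refine (d2 (-y) (by linarith [Set.mem_Ioi.1 hy])).trans (le_of_eq ?_)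
    ring_nf

/-! ### Real bound states -/

/-- `r` is a nontrivial real solution of `r'' = (G + e) r` decaying exponentially at both ends,
together with its derivative. -/
structure RealState (G : ℝ → ℝ) (e : ℝ) (r r' : ℝ → ℝ) : Prop where
  deriv_fst : ∀ y, HasDerivAt r (r' y) y
  deriv_snd : ∀ y, HasDerivAt r' ((G y + e) * r y) y
  nonzero : ∃ y, r y ≠ 0
  decay : ∃ δ, 0 < δ ∧ ∃ C, 0 ≤ C ∧ ∀ y,
    |r y| ≤ C * Real.exp (-δ * |y|) ∧ |r' y| ≤ C * Real.exp (-δ * |y|)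

theorem eq_zero_of_monotone_of_tendsto {F f : ℝ → ℝ} (hF : ∀ y, HasDerivAt F (f y) y)
    (hf : ∀ y, 0 ≤ f y) (h1 : Tendsto F atTop (𝓝 0)) (h2 : Tendsto F atBot (𝓝 0)) (y : ℝ) :
    f y = 0 := by
  have hm : Monotone F := monotone_of_hasDerivAt_nonneg hF hf
  have h0 : F = fun _ => 0 := funext fun y =>
    le_antisymm (hm.ge_of_tendsto h1 y) (hm.le_of_tendsto h2 y)
  have h3 := hF y
  rw [h0] at h3
  exact h3.unique (hasDerivAt_const y 0)

theorem hasDerivAt_re {f : ℝ → ℂ} {f' : ℂ} {y : ℝ} (h : HasDerivAt f f' y) :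
    HasDerivAt (fun y => (f y).re) f'.re y :=
  Complex.reCLM.hasFDerivAt.comp_hasDerivAt y h

theorem hasDerivAt_im {f : ℝ → ℂ} {f' : ℂ} {y : ℝ} (h : HasDerivAt f f' y) :
    HasDerivAt (fun y => (f y).im) f'.im y :=
  Complex.imCLM.hasFDerivAt.comp_hasDerivAt y h

namespace Dichotomy

variable {P : ℝ → ℂ} {b : ℝ} {κ₁ κ₂ : ℂ}

theorem tendsto_boundState (h : Dichotomy P b κ₁ κ₂) {w w' : ℝ → ℂ}
    (hw : IsBoundState P b w w') : (Tendsto w atTop (𝓝 0) ∧ Tendsto w' atTop (𝓝 0)) ∧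
      Tendsto w atBot (𝓝 0) ∧ Tendsto w' atBot (𝓝 0) := by
  obtain ⟨δ, hδ, C, hC, hb⟩ := h.boundState_decay_mul hw
  obtain ⟨h1, h2⟩ := tendsto_exp_neg_mul_abs hδ
  have h1' := h1.const_mul C
  have h2' := h2.const_mul C
  rw [mul_zero] at h1' h2'
  exact ⟨⟨squeeze_zero_norm (fun y => (hb y).2.2.1) h1',
    squeeze_zero_norm (fun y => (hb y).2.2.2) h1'⟩,
    squeeze_zero_norm (fun y => (hb y).2.2.1) h2', squeeze_zero_norm (fun y => (hb y).2.2.2) h2'⟩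

/-- There are bound states only if the potential is real. -/
theorem im_eq_zero_of_boundState (h : Dichotomy P b κ₁ κ₂) {w w' : ℝ → ℂ}
    (hw : IsBoundState P b w w') {e : ℝ} (he : ∀ y, (P y).im = e) : e = 0 := by
  obtain ⟨⟨t1, t2⟩, t3, t4⟩ := h.tendsto_boundState hw
  obtain ⟨hs, ⟨y₀, hy₀⟩, -⟩ := hw
  -- This is e Im(w̄w'). The extra factor e makes its derivative e²|w|² nonnegative whatever the
  -- sign of e, while the function vanishes at both ends.
  set F := fun y => e * ((w y).re * (w' y).im - (w y).im * (w' y).re) with hF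
  have hFd : ∀ y, HasDerivAt F (e ^ 2 * ((w y).re ^ 2 + (w y).im ^ 2)) y := by
    intro y
    have d1 := hs.deriv_fst y
    have d2 := hs.deriv_snd y
    refine ((((hasDerivAt_re d1).fun_mul (hasDerivAt_im d2)).fun_sub
      ((hasDerivAt_im d1).fun_mul (hasDerivAt_re d2))).const_mul e).congr_deriv ?_
    rw [Complex.mul_re, Complex.mul_im, he]
    ring
  have hlim : ∀ l : Filter ℝ, Tendsto w l (𝓝 0) → Tendsto w' l (𝓝 0) → Tendsto F l (𝓝 0) := by
    intro l h1 h2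
    have a1 := (Complex.continuous_re.tendsto 0).comp h1
    have a2 := (Complex.continuous_im.tendsto 0).comp h1
    have a3 := (Complex.continuous_re.tendsto 0).comp h2
    have a4 := (Complex.continuous_im.tendsto 0).comp h2
    simpa [Function.comp_def] using ((a1.mul a4).sub (a2.mul a3)).const_mul e
  have h0 := eq_zero_of_monotone_of_tendsto hFd (fun y => by positivity) (hlim _ t1 t2)
    (hlim _ t3 t4) y₀
  rcases mul_eq_zero.1 h0 with h1 | h1
  · exact pow_eq_zero_iff (two_ne_zero) |>.1 h1
  · exact absurd (Complex.ext (by simp; nlinarith [sq_nonneg (w y₀).re, sq_nonneg (w y₀).im])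
      (by simp; nlinarith [sq_nonneg (w y₀).re, sq_nonneg (w y₀).im])) hy₀

end Dichotomy

/-- If the potential is real, there is a real bound state. -/
theorem IsBoundState.exists_real {P : ℝ → ℂ} {b : ℝ} {w w' : ℝ → ℂ}
    (hw : IsBoundState P b w w') (hP : ∀ y, (P y).im = 0) :
    ∃ r r' : ℝ → ℝ, IsBoundState P b (fun y => (r y : ℂ)) (fun y => (r' y : ℂ)) := by
  obtain ⟨hs, ⟨y₀, hy₀⟩, C, hC, hb⟩ := hw
  have hPr : ∀ y, P y = ((P y).re : ℂ) := fun y => Complex.ext (by simp) (by simp [hP])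
  by_cases h0 : (w y₀).re = 0
  · refine ⟨fun y => (w y).im, fun y => (w' y).im, ⟨fun y => ?_, fun y => ?_⟩, ⟨y₀, fun h1 => ?_⟩,
      C, hC, fun y => ⟨?_, ?_⟩⟩
    · exact (hasDerivAt_im (hs.deriv_fst y)).ofReal_comp
    · refine (hasDerivAt_im (hs.deriv_snd y)).ofReal_comp.congr_deriv ?_
      rw [hPr, Complex.im_ofReal_mul]
      push_cast
      rfl
    · exact hy₀ (Complex.ext h0 (Complex.ofReal_eq_zero.1 h1))
    · rw [Complex.norm_real]
      exact (Complex.abs_im_le_norm _).trans (hb y).1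
    · rw [Complex.norm_real]
      exact (Complex.abs_im_le_norm _).trans (hb y).2
  · refine ⟨fun y => (w y).re, fun y => (w' y).re, ⟨fun y => ?_, fun y => ?_⟩, ⟨y₀, fun h1 => ?_⟩,
      C, hC, fun y => ⟨?_, ?_⟩⟩
    · exact (hasDerivAt_re (hs.deriv_fst y)).ofReal_comp
    · refine (hasDerivAt_re (hs.deriv_snd y)).ofReal_comp.congr_deriv ?_
      rw [hPr, Complex.re_ofReal_mul]
      push_cast
      rfl
    · exact h0 (Complex.ofReal_eq_zero.1 h1)
    · rw [Complex.norm_real]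
      exact (Complex.abs_re_le_norm _).trans (hb y).1
    · rw [Complex.norm_real]
      exact (Complex.abs_re_le_norm _).trans (hb y).2

theorem Dichotomy.realState {P : ℝ → ℂ} {b : ℝ} {κ₁ κ₂ : ℂ} (h : Dichotomy P b κ₁ κ₂)
    {r r' : ℝ → ℝ} (hr : IsBoundState P b (fun y => (r y : ℂ)) (fun y => (r' y : ℂ)))
    {G : ℝ → ℝ} {e : ℝ} (hP : ∀ y, P y = ((G y + e : ℝ) : ℂ)) : RealState G e r r' := by
  obtain ⟨δ, hδ, C, hC, hb⟩ := h.boundState_decay_mul hr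
  obtain ⟨hs, ⟨y₀, hy₀⟩, -⟩ := hr
  refine ⟨fun y => (hasDerivAt_re (hs.deriv_fst y)), fun y => ?_, ⟨y₀, by simpa using hy₀⟩, δ, hδ, C, hC,
    fun y => ?_⟩
  · refine (hasDerivAt_re (hs.deriv_snd y)).congr_deriv ?_
    rw [hP, ← Complex.ofReal_mul, Complex.ofReal_re]
  · have := hb y
    rw [Complex.norm_real, Complex.norm_real] at this
    exact this.2.2

namespace RealState

variable {G : ℝ → ℝ} {e : ℝ} {r r' : ℝ → ℝ}

theorem continuous (h : RealState G e r r') : Continuous r :=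
  continuous_iff_continuousAt.2 fun y => (h.deriv_fst y).continuousAt

theorem tendsto (h : RealState G e r r') : (Tendsto r atTop (𝓝 0) ∧ Tendsto r' atTop (𝓝 0)) ∧
      Tendsto r atBot (𝓝 0) ∧ Tendsto r' atBot (𝓝 0) := by
  obtain ⟨δ, hδ, C, hC, hb⟩ := h.decay
  obtain ⟨h1, h2⟩ := tendsto_exp_neg_mul_abs hδ
  have h1' := h1.const_mul C
  have h2' := h2.const_mul C
  rw [mul_zero] at h1' h2'
  exact ⟨⟨squeeze_zero_norm (fun y => (hb y).1) h1',
    squeeze_zero_norm (fun y => (hb y).2) h1'⟩,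
    squeeze_zero_norm (fun y => (hb y).1) h2', squeeze_zero_norm (fun y => (hb y).2) h2'⟩

theorem integrable_mul (h : RealState G e r r') {d : ℝ} {s s' : ℝ → ℝ}
    (hs : RealState G d s s') : Integrable fun y => r y * s y := by
  obtain ⟨δ, hδ, C, hC, hb⟩ := h.decay
  obtain ⟨δ', hδ', C', hC', hb'⟩ := hs.decay
  refine Integrable.mono' ((integrable_exp_neg_mul_abs hδ).const_mul (C' * C))
    (h.continuous.mul hs.continuous).aestronglyMeasurable (Eventually.of_forall fun y => ?_)
  have h1 : |s y| ≤ C' := (hb' y).1.trans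
    (mul_le_of_le_one_right hC' (Real.exp_le_one_iff.2 (by nlinarith [abs_nonneg y])))
  rw [norm_mul, Real.norm_eq_abs, Real.norm_eq_abs, mul_comm, mul_assoc]
  exact mul_le_mul h1 (hb y).1 (abs_nonneg _) hC'

/-- States with different energies are orthogonal. -/
theorem integral_mul_eq_zero (h : RealState G e r r') {d : ℝ} {s s' : ℝ → ℝ}
    (hs : RealState G d s s') (hed : e ≠ d) : ∫ y, r y * s y = 0 := by
  obtain ⟨⟨t1, t2⟩, t3, t4⟩ := h.tendsto
  obtain ⟨⟨u1, u2⟩, u3, u4⟩ := hs.tendsto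
  have hd : ∀ y, HasDerivAt (fun y => r y * s' y - r' y * s y) ((d - e) * (r y * s y)) y :=
    fun y => (((h.deriv_fst y).fun_mul (hs.deriv_snd y)).fun_sub
      ((h.deriv_snd y).fun_mul (hs.deriv_fst y))).congr_deriv (by ring)
  have h1 := integral_of_hasDerivAt_of_tendsto hd ((h.integrable_mul hs).const_mul _)
    (m := 0) (n := 0) (by simpa using (t3.mul u4).sub (t4.mul u3))
    (by simpa using (t1.mul u2).sub (t2.mul u1))
  rw [integral_const_mul, sub_zero] at h1
  exact (mul_eq_zero.1 h1).resolve_left (sub_ne_zero.2 hed.symm)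

theorem integral_mul_self_pos (h : RealState G e r r') : 0 < ∫ y, r y * r y := by
  obtain ⟨y₀, hy₀⟩ := h.nonzero
  rw [integral_pos_iff_support_of_nonneg (fun y => mul_self_nonneg (r y)) (h.integrable_mul h)]
  exact (h.continuous.mul h.continuous).isOpen_support.measure_pos volume ⟨y₀, by simpa using hy₀⟩

end RealState

/-- A bounded solution of the Riccati equation excludes states of larger energy. -/
theorem not_realState_of_riccati {G ψ : ℝ → ℝ} {e₀ e B : ℝ} (he : e₀ < e)
    (hψ : ∀ y, HasDerivAt ψ (G y + e₀ - ψ y ^ 2) y) (hB : ∀ y, |ψ y| ≤ B) (r r' : ℝ → ℝ) :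
    ¬ RealState G e r r' := by
  intro h
  obtain ⟨⟨t1, t2⟩, t3, t4⟩ := h.tendsto
  obtain ⟨y₀, hy₀⟩ := h.nonzero
  -- Completing the square with the Riccati equation gives F' = (r' − ψr)² + (e − e₀)r². As F
  -- vanishes at ±∞, both squares must vanish.
  set F := fun y => r y * r' y - ψ y * r y ^ 2 with hF
  have hFd : ∀ y, HasDerivAt F ((r' y - ψ y * r y) ^ 2 + (e - e₀) * r y ^ 2) y := fun y =>
    (((h.deriv_fst y).fun_mul (h.deriv_snd y)).fun_sub
      ((hψ y).fun_mul ((h.deriv_fst y).fun_pow 2))).congr_deriv (by norm_num; ring)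
  have hlim : ∀ l : Filter ℝ, Tendsto r l (𝓝 0) → Tendsto r' l (𝓝 0) → Tendsto F l (𝓝 0) := by
    intro l h1 h2
    have h3 : Tendsto (fun y => ψ y * r y ^ 2) l (𝓝 0) := by
      refine squeeze_zero_norm (a := fun y => B * r y ^ 2) (fun y => ?_)
        (by simpa using (h1.pow 2).const_mul B)
      rw [Real.norm_eq_abs, abs_mul, abs_of_nonneg (sq_nonneg (r y))]
      exact mul_le_mul_of_nonneg_right (hB y) (sq_nonneg _)
    simpa using (h1.mul h2).sub h3
  have h0 := eq_zero_of_monotone_of_tendsto hFd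
    (fun y => add_nonneg (sq_nonneg _) (mul_nonneg (by linarith) (sq_nonneg _)))
    (hlim _ t1 t2) (hlim _ t3 t4) y₀
  have h1 : 0 < (e - e₀) * r y₀ ^ 2 := mul_pos (by linarith) (by positivity)
  linarith [sq_nonneg (r' y₀ - ψ y₀ * r y₀)]

/-! ### Finiteness of the number of states -/

/-- Comparison with a Riccati subsolution. -/
theorem monotoneOn_of_riccati {φ φ' D G S ψ ψ' : ℝ → ℝ} {m : ℝ} {s : Set ℝ} (hs : Convex ℝ s)
    (hφ : ∀ y, HasDerivAt φ (φ' y) y) (hφ' : ∀ y, HasDerivAt φ' ((G y - m) * φ y + D y) y)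
    (hS : ∀ y, HasDerivAt S (φ y * D y) y) (hψ : ∀ y, HasDerivAt ψ (ψ' y) y)
    (hle : ∀ y ∈ s, ψ' y + ψ y ^ 2 ≤ G y - m) :
    MonotoneOn (fun y => φ y * φ' y - ψ y * φ y ^ 2 - S y) s := by
  have hd : ∀ y, HasDerivAt (fun y => φ y * φ' y - ψ y * φ y ^ 2 - S y)
      ((φ' y - ψ y * φ y) ^ 2 + (G y - m - (ψ' y + ψ y ^ 2)) * φ y ^ 2) y := fun y =>
    ((((hφ y).fun_mul (hφ' y)).fun_sub ((hψ y).fun_mul ((hφ y).fun_pow 2))).fun_sub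
      (hS y)).congr_deriv (by norm_num; ring)
  exact monotoneOn_of_hasDerivWithinAt_nonneg hs
    (fun y _ => (hd y).continuousAt.continuousWithinAt) (fun y _ => (hd y).hasDerivWithinAt)
    fun y hy => add_nonneg (sq_nonneg _)
      (mul_nonneg (sub_nonneg.2 (hle y (interior_subset hy))) (sq_nonneg _))

theorem hasDerivAt_exp_mul (a y : ℝ) :
    HasDerivAt (fun y => Real.exp (a * y)) (Real.exp (a * y) * a) y := by
  simpa using ((hasDerivAt_id y).const_mul a).exp

/-- A Schrödinger operator with a potential converging exponentially to limits at least `m` has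
only finitely many states of energy less than `m`: the form is nonnegative on functions vanishing
at sufficiently many points. -/
theorem exists_forall_not_realStates {G : ℝ → ℝ} {m C δ : ℝ} (hC : 0 ≤ C) (hδ : 0 < δ)
    (h1 : ∀ y, 0 ≤ y → m - G y ≤ C * Real.exp (-δ * y))
    (h2 : ∀ y, y ≤ 0 → m - G y ≤ C * Real.exp (δ * y)) :
    ∃ N : ℕ, ∀ (e : Fin N → ℝ) (r r' : Fin N → ℝ → ℝ), Function.Injective e →
      (∀ i, -m < e i) → ¬ ∀ i, RealState G (e i) (r i) (r' i) := by
  -- C is divided by below; it may be enlarged to 1 when it is zero.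
  wlog hCp : 0 < C generalizing C
  · exact this (C := 1) zero_le_one
      (fun y hy => (h1 y hy).trans (mul_le_mul_of_nonneg_right (by linarith) (Real.exp_pos _).le))
      (fun y hy => (h2 y hy).trans (mul_le_mul_of_nonneg_right (by linarith) (Real.exp_pos _).le))
      one_pos
  have hm : ∀ y, m - G y ≤ C := by
    intro y
    rcases le_total 0 y with hy | hy
    · exact (h1 y hy).trans (mul_le_of_le_one_right hC (Real.exp_le_one_iff.2 (by nlinarith)))
    · exact (h2 y hy).trans (mul_le_of_le_one_right hC (Real.exp_le_one_iff.2 (by nlinarith)))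
  obtain ⟨R, hR0, hR⟩ : ∃ R, 0 < R ∧ ∀ y, R ≤ y → Real.exp (-δ * y) ≤ δ ^ 2 / (4 * C) := by
    have ht : Tendsto (fun y => Real.exp (-δ * y)) atTop (𝓝 0) :=
      Real.tendsto_exp_atBot.comp (tendsto_id.const_mul_atTop_of_neg (by linarith))
    obtain ⟨R, hR⟩ := eventually_atTop.1 (ht.eventually (gt_mem_nhds
      (show 0 < δ ^ 2 / (4 * C) by positivity)))
    exact ⟨max R 1, by positivity, fun y hy => (hR y ((le_max_left _ _).trans hy)).le⟩
  obtain ⟨n, hn⟩ := exists_nat_gt (16 * C * R ^ 2 + 1)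
  have hn1 : (1 : ℝ) < n := lt_of_le_of_lt (by nlinarith [mul_pos hCp (sq_pos_of_pos hR0)]) hn
  -- The interval [−R, R] is cut into n pieces so short that 4C²ℓ² ≤ C, the smallness needed for a
  -- linear Riccati subsolution on each piece.
  set ℓ := 2 * R / n with hℓ
  have hℓ0 : 0 < ℓ := by positivity
  have hℓC : 4 * C ^ 2 * ℓ ^ 2 ≤ C := by
    have : 4 * C ^ 2 * ℓ ^ 2 = C * (16 * C * R ^ 2 / n ^ 2) := by rw [hℓ]; field_simp; ring
    rw [this]
    refine mul_le_of_le_one_right hC ((div_le_one (by positivity)).2 ?_)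
    nlinarith
  set x : ℕ → ℝ := fun i => -R + i * ℓ with hx
  refine ⟨n + 2, fun e r r' he hem hst => ?_⟩
  -- A nontrivial combination of n + 2 states can be made to vanish at the n + 1 division points.
  obtain ⟨a, ha, ha0⟩ : ∃ a : Fin (n + 2) → ℝ, (∀ i : Fin (n + 1), ∑ j, a j * r j (x i) = 0) ∧
      a ≠ 0 := by
    let T : (Fin (n + 2) → ℝ) →ₗ[ℝ] (Fin (n + 1) → ℝ) :=
      LinearMap.pi fun i => ∑ j, (r j (x i)) • LinearMap.proj j
    have hker := LinearMap.ker_ne_bot_of_finrank_lt (f := T) (by simp)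
    obtain ⟨a, ha, ha0⟩ := Submodule.exists_mem_ne_zero_of_ne_bot hker
    refine ⟨a, fun i => ?_, ha0⟩
    have := congrFun (LinearMap.mem_ker.1 ha) i
    simpa [T, mul_comm] using this
  set φ := fun y => ∑ j, a j * r j y with hφ
  set φ' := fun y => ∑ j, a j * r' j y with hφ'
  set D := fun y => ∑ j, a j * (m + e j) * r j y with hD
  have hφd : ∀ y, HasDerivAt φ (φ' y) y := fun y =>
    HasDerivAt.fun_sum fun j _ => ((hst j).deriv_fst y).const_mul (a j)
  have hφ'd : ∀ y, HasDerivAt φ' ((G y - m) * φ y + D y) y := fun y =>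
    (HasDerivAt.fun_sum fun j _ => ((hst j).deriv_snd y).const_mul (a j)).congr_deriv (by
      simp only [hφ, hD, Finset.mul_sum, ← Finset.sum_add_distrib]
      exact Finset.sum_congr rfl fun j _ => by ring)
  have hφc : Continuous φ := continuous_iff_continuousAt.2 fun y => (hφd y).continuousAt
  have hDc : Continuous D := continuous_finsetSum _ fun j _ =>
    continuous_const.mul (hst j).continuous
  have hexpand : ∀ y, φ y * D y = ∑ i, ∑ j, a i * (a j * (m + e j)) * (r i y * r j y) := by
    intro y
    simp only [hφ, hD, Finset.sum_mul_sum]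
    exact Finset.sum_congr rfl fun i _ => Finset.sum_congr rfl fun j _ => by ring
  have hint : Integrable fun y => φ y * D y := by
    simp only [hexpand]
    exact integrable_finsetSum _ fun i _ => integrable_finsetSum _ fun j _ =>
      ((hst i).integrable_mul (hst j)).const_mul _
  -- Distinct energies make the states orthogonal, so the integral is Σ aᵢ²(m + eᵢ)∫rᵢ². The rest of
  -- the argument bounds the same integral above by 0.
  have hpos : 0 < ∫ y, φ y * D y := by
    have e1 : ∫ y, φ y * D y = ∑ i, a i ^ 2 * (m + e i) * ∫ y, r i y * r i y := by
      simp only [hexpand]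
      rw [integral_finsetSum _ fun i _ => integrable_finsetSum _ fun j _ =>
        ((hst i).integrable_mul (hst j)).const_mul _]
      refine Finset.sum_congr rfl fun i _ => ?_
      rw [integral_finsetSum _ fun j _ => ((hst i).integrable_mul (hst j)).const_mul _]
      rw [Finset.sum_eq_single i]
      · rw [integral_const_mul]; ring
      · intro j _ hji
        rw [integral_const_mul, (hst i).integral_mul_eq_zero (hst j) (he.ne hji.symm), mul_zero]
      · simp
    rw [e1]
    obtain ⟨i, hi⟩ := Function.ne_iff.1 ha0
    have hterm : ∀ i, 0 ≤ a i ^ 2 * (m + e i) * ∫ y, r i y * r i y := fun i =>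
      mul_nonneg (mul_nonneg (sq_nonneg _) (by linarith [hem i]))
        (hst i).integral_mul_self_pos.le
    refine Finset.sum_pos' (fun i _ => hterm i) ⟨i, Finset.mem_univ _, ?_⟩
    have : a i ≠ 0 := hi
    exact mul_pos (mul_pos (by positivity) (by linarith [hem i])) (hst i).integral_mul_self_pos
  set S := fun y => ∫ t in (0 : ℝ)..y, φ t * D t with hS
  have hSd : ∀ y, HasDerivAt S (φ y * D y) y := fun y =>
    intervalIntegral.integral_hasDerivAt_right ((hφc.mul hDc).intervalIntegrable _ _)
      (hφc.mul hDc).stronglyMeasurable.stronglyMeasurableAtFilter (hφc.mul hDc).continuousAt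
  have hxn : x n = R := by
    simp only [hx, hℓ]
    field_simp
    ring
  have hx0 : x 0 = -R := by simp [hx]
  have hφx : ∀ i, i ≤ n → φ (x i) = 0 := fun i hi => ha ⟨i, Nat.lt_succ_of_le hi⟩
  have hmid : ∀ i, i ≤ n → S (x i) ≤ S (-R) := by
    intro i
    induction i with
    | zero => intro _; rw [hx0]
    | succ i ih =>
      intro hi
      refine le_trans ?_ (ih (by omega))
      have hxs : x (i + 1) = x i + ℓ := by simp only [hx]; push_cast; ring
      -- For ψ = −2C(y − xᵢ), one has ψ' + ψ² ≤ −2C + 4C²ℓ² ≤ −C ≤ G − m. As φ vanishes at both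
      -- division points, monotonicity reduces to S(xᵢ₊₁) ≤ S(xᵢ).
      have hmono := monotoneOn_of_riccati (convex_Icc (x i) (x (i + 1))) hφd hφ'd hSd
        (ψ := fun y => -2 * C * (y - x i)) (ψ' := fun _ => -2 * C)
        (fun y => (((hasDerivAt_id y).sub_const (x i)).const_mul (-2 * C)).congr_deriv (by simp))
        (fun y hy => by
          have h3 : (y - x i) ^ 2 ≤ ℓ ^ 2 :=
            pow_le_pow_left₀ (by linarith [hy.1]) (by linarith [hy.2]) 2
          nlinarith [hm y, mul_le_mul_of_nonneg_left h3 (sq_nonneg C)])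
      have h4 := hmono (Set.left_mem_Icc.2 (by linarith)) (Set.right_mem_Icc.2 (by linarith))
        (by linarith)
      simp only [hφx i (by omega), hφx (i + 1) hi] at h4
      linarith
  have hRR : S R ≤ S (-R) := hxn ▸ hmid n le_rfl
  have hφR : φ R = 0 := hxn ▸ hφx n le_rfl
  have hφR' : φ (-R) = 0 := hx0 ▸ hφx 0 (Nat.zero_le _)
  have hq : ∀ E, 0 ≤ E → E ≤ δ ^ 2 / (4 * C) → (2 * C / δ * E) ^ 2 ≤ C * E := by
    intro E hE0 hE
    have : (2 * C / δ * E) ^ 2 = C * E * (E / (δ ^ 2 / (4 * C))) := by field_simp; ring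
    rw [this]
    exact mul_le_of_le_one_right (by positivity) ((div_le_one (by positivity)).2 hE)
  -- On the tail, ψ = (2C/δ)e^{−δy} has ψ' = −2Ce^{−δy}. The choice of R makes ψ² ≤ Ce^{−δy}, so ψ'
  -- + ψ² ≤ −Ce^{−δy} ≤ G − m.
  have hright := monotoneOn_of_riccati (convex_Ici R) hφd hφ'd hSd
    (ψ := fun y => 2 * C / δ * Real.exp (-δ * y)) (ψ' := fun y => -2 * C * Real.exp (-δ * y))
    (fun y => ((hasDerivAt_exp_mul (-δ) y).const_mul (2 * C / δ)).congr_deriv (by field_simp))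
    (fun y hy => by
      have h3 := hq _ (Real.exp_pos _).le (hR y hy)
      have h4 := h1 y (hR0.le.trans hy)
      linarith)
  have hleft := monotoneOn_of_riccati (convex_Iic (-R)) hφd hφ'd hSd
    (ψ := fun y => -(2 * C / δ * Real.exp (δ * y))) (ψ' := fun y => -2 * C * Real.exp (δ * y))
    (fun y => ((hasDerivAt_exp_mul δ y).const_mul (2 * C / δ)).fun_neg.congr_deriv
      (by field_simp))
    (fun y hy => by
      have hy' : R ≤ -y := by linarith [Set.mem_Iic.1 hy]
      have h5 := hR (-y) hy'
      rw [neg_mul_neg] at h5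
      have h3 := hq _ (Real.exp_pos _).le h5
      have h4 := h2 y (by linarith)
      rw [neg_sq]
      linarith)
  have hsum : ∀ l : Filter ℝ, (∀ j, Tendsto (r j) l (𝓝 0)) → Tendsto φ l (𝓝 0) := fun l hl => by
    have := tendsto_finsetSum Finset.univ fun j _ => (hl j).const_mul (a j)
    simpa using this
  have hsum' : ∀ l : Filter ℝ, (∀ j, Tendsto (r' j) l (𝓝 0)) → Tendsto φ' l (𝓝 0) := fun l hl => by
    have := tendsto_finsetSum Finset.univ fun j _ => (hl j).const_mul (a j)
    simpa using this
  have f1 := hsum atTop fun j => (hst j).tendsto.1.1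
  have f2 := hsum' atTop fun j => (hst j).tendsto.1.2
  have f3 := hsum atBot fun j => (hst j).tendsto.2.1
  have f4 := hsum' atBot fun j => (hst j).tendsto.2.2
  have hE1 : Tendsto (fun y => Real.exp (-δ * y)) atTop (𝓝 0) :=
    Real.tendsto_exp_atBot.comp (tendsto_id.const_mul_atTop_of_neg (by linarith))
  have hE2 : Tendsto (fun y => Real.exp (δ * y)) atBot (𝓝 0) :=
    Real.tendsto_exp_atBot.comp (tendsto_id.const_mul_atBot hδ)
  have g1 : Tendsto (fun y => φ y * φ' y - 2 * C / δ * Real.exp (-δ * y) * φ y ^ 2)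
      atTop (𝓝 0) := by
    simpa using (f1.mul f2).sub ((hE1.const_mul (2 * C / δ)).mul (f1.pow 2))
  have g2 : Tendsto (fun y => φ y * φ' y - -(2 * C / δ * Real.exp (δ * y)) * φ y ^ 2)
      atBot (𝓝 0) := by
    simpa using (f3.mul f4).sub (((hE2.const_mul (2 * C / δ)).neg).mul (f3.pow 2))
  have hlim := (g1.sub (g2.comp tendsto_neg_atTop_atBot))
  rw [sub_zero] at hlim
  have hlim' := intervalIntegral_tendsto_integral hint tendsto_neg_atTop_atBot tendsto_id
  refine not_lt.2 (le_of_tendsto_of_tendsto hlim' hlim ?_) hpos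
  filter_upwards [eventually_ge_atTop R] with y hy
  have k1 := hright (Set.mem_Ici.2 le_rfl) (Set.mem_Ici.2 hy) hy
  have k2 := hleft (a := -y) (b := -R) (Set.mem_Iic.2 (by linarith)) (Set.mem_Iic.2 le_rfl)
    (by linarith)
  simp only [hφR, hφR'] at k1 k2
  have k3 : ∫ t in (-y)..(id y), φ t * D t = S y - S (-y) := by
    simp only [hS, id]
    rw [intervalIntegral.integral_interval_sub_left] <;>
      exact (hφc.mul hDc).intervalIntegrable _ _
  simp only [Function.comp]
  rw [k3]
  linarith

/-! ### Eigenvalues of the linearization -/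

/-- The energy of the Schrödinger equation at real spectral parameter `l`. -/
def stateEnergy (α c l : ℝ) : ℝ :=
  (1 + α * c ^ 2) / (4 * α) * (1 + 2 * α * l) ^ 2 - 1 / (4 * α)

theorem spectralPotential_ofReal {α c : ℝ} (hα : 0 < α) (g : ℝ → ℝ) (l y : ℝ) :
    spectralPotential α c g l y = ((g y + stateEnergy α c l : ℝ) : ℂ) := by
  rw [spectralPotential, potential, add_assoc, spectralShift_eq hα, stateEnergy]
  push_cast
  ring

/-- The imaginary part does not depend on y, so a bound state forces it to vanish; to the right of
μ_α its first two factors are positive. -/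
theorem spectralPotential_im {α c : ℝ} (hα : 0 < α) (g : ℝ → ℝ) (z : ℂ) (y : ℝ) :
    (spectralPotential α c g z y).im = (1 + α * c ^ 2) * (1 + 2 * α * z.re) * z.im := by
  have e1 : (1 + 2 * α * z : ℂ) = ((1 + 2 * α * z.re : ℝ) : ℂ) +
      ((2 * α * z.im : ℝ) : ℂ) * Complex.I := by
    apply Complex.ext <;> simp
  have e2 : spectralPotential α c g z y = ((g y + (1 + α * c ^ 2) / (4 * α) *
      ((1 + 2 * α * z.re) ^ 2 - (2 * α * z.im) ^ 2) - 1 / (4 * α) : ℝ) : ℂ) +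
      (((1 + α * c ^ 2) * (1 + 2 * α * z.re) * z.im : ℝ) : ℂ) * Complex.I := by
    have hα' : (α : ℂ) ≠ 0 := by exact_mod_cast hα.ne'
    rw [spectralPotential, potential, add_assoc, spectralShift_eq hα, e1]
    push_cast
    field_simp
    linear_combination 4 * α ^ 2 * z.im ^ 2 * (1 + α * c ^ 2 : ℂ) * Complex.I_sq
  rw [e2, Complex.add_im, Complex.ofReal_im, Complex.im_ofReal_mul, Complex.I_im]
  ring

theorem IsBoundState.translate {P : ℝ → ℂ} {b : ℝ} {w w' : ℝ → ℂ} (h : IsBoundState P b w w')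
    (s : ℝ) : IsBoundState (fun y => P (y + s)) b (fun y => w (y + s)) fun y => w' (y + s) := by
  obtain ⟨hs, ⟨y₀, hy₀⟩, C, hC, hb⟩ := h
  refine ⟨⟨fun y => (hs.deriv_fst (y + s)).comp_add_const y s,
    fun y => (hs.deriv_snd (y + s)).comp_add_const y s⟩, ⟨y₀ - s, by simpa using hy₀⟩,
    C * Real.exp (b * s), by positivity, fun y => ?_⟩
  have e : C * Real.exp (b * (y + s)) = C * Real.exp (b * s) * Real.exp (b * y) := by
    rw [mul_add, Real.exp_add]; ring
  rw [← e]
  exact hb (y + s)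

/-- The real eigenvalues of the linearization at a front to the right of `μ_α`. -/
def frontEigenvalues (α : ℝ) (V : ℝ → ℝ) (c : ℝ) (h : ℝ → ℝ) : Set ℝ :=
  {l | muConst α V < l ∧ ∃ w w', IsBoundState (spectralPotential α c (linearizedCoeff V h) l)
    (driftCoeff α c l).re w w'}

theorem lt_one_add_of_muConst_lt {α : ℝ} (hα : 0 < α) {V : ℝ → ℝ} (hV : IsBistable V) {x : ℝ}
    (hx : muConst α V < x) : 0 < 1 + 2 * α * x ∧
      1 - 4 * α * mConst V < (1 + 2 * α * x) ^ 2 := by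
  obtain ⟨ρ, hρ0, -, hρ2, hρ⟩ := muConst_spec hα hV
  have hpρ : ρ < 1 + 2 * α * x := by rw [← hρ]; nlinarith
  exact ⟨hρ0.trans_lt hpρ, hρ2.trans_lt (pow_lt_pow_left₀ hpρ hρ0 (by norm_num))⟩

namespace IsFront

variable {α : ℝ} {V h : ℝ → ℝ} {c : ℝ}

theorem im_eq_zero_of_boundState (hα : 0 < α) (hV : IsBistable V) (hh : IsFront V c h) {z : ℂ}
    (hz : muConst α V < z.re) {w w' : ℝ → ℂ}
    (hw : IsBoundState (spectralPotential α c (linearizedCoeff V h) z) (driftCoeff α c z).re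
      w w') : z.im = 0 := by
  obtain ⟨κ₁, κ₂, hd⟩ := hh.exists_dichotomy hα hV hz
  have h0 := hd.im_eq_zero_of_boundState hw (spectralPotential_im hα _ z)
  have h1 := (lt_one_add_of_muConst_lt hα hV hz).1
  have h2 : 0 < 1 + α * c ^ 2 := by positivity
  exact (mul_eq_zero.1 h0).resolve_left (mul_pos h2 h1).ne'

theorem exists_realState (hα : 0 < α) (hV : IsBistable V) (hh : IsFront V c h) {l : ℝ}
    (hl : l ∈ frontEigenvalues α V c h) :
    ∃ r r' : ℝ → ℝ, IsBoundState (spectralPotential α c (linearizedCoeff V h) l)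
      (driftCoeff α c l).re (fun y => (r y : ℂ)) (fun y => (r' y : ℂ)) ∧
      RealState (linearizedCoeff V h) (stateEnergy α c l) r r' := by
  obtain ⟨h1, w, w', hw⟩ := hl
  obtain ⟨κ₁, κ₂, hd⟩ := hh.exists_dichotomy hα hV (z := l) (by simpa using h1)
  have hP := spectralPotential_ofReal (c := c) hα (linearizedCoeff V h) l
  obtain ⟨r, r', hr⟩ := hw.exists_real fun y => by rw [hP, Complex.ofReal_im]
  exact ⟨r, r', hr, hd.realState hr hP⟩

theorem stateEnergy_zero (hα : 0 < α) : stateEnergy α c 0 = c ^ 2 / 4 := by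
  rw [stateEnergy]
  field_simp
  ring

/-- The Riccati function V'(h)/h' − c/2 is the logarithmic derivative of e^{cy/2}h', the state at l
= 0 with energy c²/4. It is bounded because |V'(h)| ≤ C|h'|, and l > 0 would give a strictly larger
energy. -/
theorem nonpos_of_mem (hα : 0 < α) (hV : IsBistable V) (hh : IsFront V c h) {l : ℝ}
    (hl : l ∈ frontEigenvalues α V c h) : l ≤ 0 := by
  obtain ⟨r, r', -, hr⟩ := hh.exists_realState hα hV hl
  obtain ⟨C, hC, hb⟩ := hh.exists_abs_le_slope hV
  by_contra! hc
  have he : c ^ 2 / 4 < stateEnergy α c l := by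
    rw [← stateEnergy_zero (c := c) hα, stateEnergy, stateEnergy]
    have h1 : (1 + 2 * α * 0) ^ 2 < (1 + 2 * α * l) ^ 2 :=
      pow_lt_pow_left₀ (by nlinarith) (by norm_num) (by norm_num)
    have h2 := mul_lt_mul_of_pos_left h1 (show 0 < (1 + α * c ^ 2) / (4 * α) by positivity)
    linarith
  refine not_realState_of_riccati (G := linearizedCoeff V h) (e₀ := c ^ 2 / 4)
    (ψ := fun y => deriv V (h y) / deriv h y - c / 2) (B := C + |c / 2|) he (fun y => ?_)
    (fun y => ?_) r r' hr
  · have h0 := (hh.deriv_neg hV y).ne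
    refine ((((hV.hasDerivAt_deriv (h y)).comp y (hh.hasDerivAt y)).fun_div
      (hh.hasDerivAt_deriv y) h0).sub_const (c / 2)).congr_deriv ?_
    simp only [linearizedCoeff, Function.comp]
    field_simp
    ring
  · refine (abs_sub _ _).trans (add_le_add ?_ le_rfl)
    have h0 := hh.deriv_neg hV y
    rw [abs_div, abs_of_neg h0, div_le_iff₀ (neg_pos.2 h0)]
    exact hb y

/-- Differentiating the front equation shows that h' is annihilated by the linearization. The factor
e^{cy/2} is the conjugation at z = 0, where β = c/2, and the sign makes the state positive. -/
theorem zero_mem (hα : 0 < α) (hV : IsBistable V) (hh : IsFront V c h) :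
    (0 : ℝ) ∈ frontEigenvalues α V c h := by
  refine ⟨muConst_neg hα hV, fun y => ((Real.exp (c / 2 * y) * -deriv h y : ℝ) : ℂ),
    fun y => ((Real.exp (c / 2 * y) * (c / 2 * deriv h y - deriv V (h y)) : ℝ) : ℂ),
    ⟨fun y => ?_, fun y => ?_⟩, ⟨0, ?_⟩, ?_⟩
  · refine (((hasDerivAt_exp_mul (c / 2) y).fun_mul
      (hh.hasDerivAt_deriv y).fun_neg).congr_deriv ?_).ofReal_comp
    ring
  · rw [spectralPotential_ofReal hα, stateEnergy_zero hα, ← Complex.ofReal_mul]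
    refine (((hasDerivAt_exp_mul (c / 2) y).fun_mul
      (((hh.hasDerivAt_deriv y).const_mul (c / 2)).fun_sub
        ((hV.hasDerivAt_deriv (h y)).comp y (hh.hasDerivAt y)))).congr_deriv ?_).ofReal_comp
    simp only [linearizedCoeff, Function.comp]
    ring
  · simpa using (hh.deriv_neg hV 0).ne
  · obtain ⟨C, hC, hb⟩ := hh.exists_abs_le_slope hV
    obtain ⟨D, hD⟩ : ∃ D, ∀ y, |deriv h y| ≤ D := by
      have hc : Continuous (deriv h) :=
        continuous_iff_continuousAt.2 fun y => (hh.hasDerivAt_deriv y).continuousAt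
      obtain ⟨p, hp⟩ := eventually_atTop.1
        ((hh.tendsto_deriv_atTop hV).abs.eventually (gt_mem_nhds (show |(0 : ℝ)| < 1 by simp)))
      obtain ⟨n, hn⟩ := eventually_atBot.1
        ((hh.tendsto_deriv_atBot hV).abs.eventually (gt_mem_nhds (show |(0 : ℝ)| < 1 by simp)))
      obtain ⟨D, hD⟩ := (isCompact_Icc (a := n) (b := p)).exists_bound_of_continuousOn
        hc.continuousOn
      refine ⟨max D 1, fun y => ?_⟩
      rcases le_total y n with h1 | h1
      · exact (hn y h1).le.trans (le_max_right _ _)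
      · rcases le_total p y with h2 | h2
        · exact (hp y h2).le.trans (le_max_right _ _)
        · exact (hD y ⟨h1, h2⟩).trans (le_max_left _ _)
    have hD0 : 0 ≤ D := (abs_nonneg _).trans (hD 0)
    have hc := hh.speed_pos
    refine ⟨(1 + c / 2 + C) * D, by positivity, fun y => ?_⟩
    have hre : (driftCoeff α c ((0 : ℝ) : ℂ)).re = c / 2 := by
      rw [driftCoeff_re]; simp
    rw [hre, Complex.norm_real, Complex.norm_real, norm_mul, norm_mul,
      Real.norm_of_nonneg (Real.exp_pos _).le, mul_comm _ (Real.exp _)]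
    have h1 : |deriv V (h y)| ≤ C * |deriv h y| := by
      rw [abs_of_neg (hh.deriv_neg hV y)]; exact hb y
    have h2 := mul_le_mul_of_nonneg_left (hD y) hC
    have h3 := mul_le_mul_of_nonneg_left (hD y) (show 0 ≤ c / 2 by positivity)
    have h4 : 0 ≤ c / 2 * D := by positivity
    have h5 : 0 ≤ C * D := by positivity
    refine ⟨mul_le_mul_of_nonneg_left ?_ (Real.exp_pos _).le,
      mul_le_mul_of_nonneg_left ?_ (Real.exp_pos _).le⟩
    · rw [norm_neg, Real.norm_eq_abs]
      linarith [hD y]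
    · refine (norm_sub_le _ _).trans ?_
      rw [norm_mul, Real.norm_eq_abs, Real.norm_eq_abs, Real.norm_eq_abs,
        abs_of_pos (show 0 < c / 2 by positivity)]
      linarith

/-- To the right of μ_α one has 1 + 2αl > 0 and (1 + 2αl)² > 1 − 4αm. So distinct eigenvalues have
distinct energies, all greater than −m, and the bound on the number of such states applies. -/
theorem finite_frontEigenvalues (hα : 0 < α) (hV : IsBistable V) (hh : IsFront V c h) :
    (frontEigenvalues α V c h).Finite := by
  obtain ⟨δ, hδ, C, hC, h1, h2⟩ := hh.coeff_decay hV
  obtain ⟨N, hN⟩ := exists_forall_not_realStates (G := linearizedCoeff V h) (m := mConst V) hC hδ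
    (fun y hy => by
      have := neg_le_of_abs_le (h1 y hy)
      have := min_le_left (deriv (deriv V) 0) (deriv (deriv V) 1)
      simp only [linearizedCoeff, mConst]
      linarith)
    (fun y hy => by
      have := neg_le_of_abs_le (h2 y hy)
      have := min_le_right (deriv (deriv V) 0) (deriv (deriv V) 1)
      simp only [linearizedCoeff, mConst]
      linarith)
  by_contra hinf
  let l := Set.Infinite.natEmbedding _ hinf
  choose r r' _ hr using fun i : Fin N => hh.exists_realState hα hV (l i).2
  have hp : ∀ i : Fin N, 0 < 1 + 2 * α * (l i : ℝ) ∧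
      1 - 4 * α * mConst V < (1 + 2 * α * (l i : ℝ)) ^ 2 :=
    fun i => lt_one_add_of_muConst_lt hα hV (l i).2.1
  have hk : 0 < (1 + α * c ^ 2) / (4 * α) := by positivity
  refine hN (fun i => stateEnergy α c (l i)) r r' (fun i j hij => ?_) (fun i => ?_) hr
  · have h3 : (1 + 2 * α * (l i : ℝ)) ^ 2 = (1 + 2 * α * (l j : ℝ)) ^ 2 := by
      simp only [stateEnergy] at hij
      exact mul_left_cancel₀ hk.ne' (by linarith)
    have h4 := (pow_left_inj₀ (hp i).1.le (hp j).1.le two_ne_zero).1 h3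
    have h5 : (l i : ℝ) = l j :=
      mul_left_cancel₀ (show 2 * α ≠ 0 by positivity) (by linarith)
    exact Fin.ext (l.injective (Subtype.ext h5))
  · have h3 := (hp i).2
    have h4 : 0 ≤ α * c ^ 2 * (1 + 2 * α * (l i : ℝ)) ^ 2 := by positivity
    have h5 : stateEnergy α c (l i) + mConst V = (α * c ^ 2 * (1 + 2 * α * (l i : ℝ)) ^ 2 +
        ((1 + 2 * α * (l i : ℝ)) ^ 2 - (1 - 4 * α * mConst V))) / (4 * α) := by
      rw [stateEnergy]
      field_simp
      ring
    have h6 : 0 < stateEnergy α c (l i) + mConst V := by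
      rw [h5]
      exact div_pos (by linarith) (by positivity)
    linarith

/-- Two fronts differ by a translation, which carries bound states to bound states; the weight
e^{by} only changes by a constant factor. -/
theorem frontEigenvalues_subset (hV : IsBistable V) (hh : IsFront V c h) {c₂ : ℝ} {h₂ : ℝ → ℝ}
    (hh₂ : IsFront V c₂ h₂) : frontEigenvalues α V c₂ h₂ ⊆ frontEigenvalues α V c h := by
  obtain ⟨rfl, s, hs⟩ := exists_translate hV hh hh₂
  rintro l ⟨h1, w, w', hw⟩
  have h3 := hw.translate s
  have e : (fun y => spectralPotential α c (linearizedCoeff V h₂) l (y + s)) =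
      spectralPotential α c (linearizedCoeff V h) l := by
    funext y
    simp only [spectralPotential, potential, linearizedCoeff, hs]
  rw [e] at h3
  exact ⟨h1, _, _, h3⟩

/-- The spectrum of the linearization to the right of `μ_α`. -/
theorem spectrum_eq (hα : 0 < α) (hV : IsBistable V) (hh : IsFront V c h) :
    {z : ℂ | z ∈ opSpectrum (generator α c (fun y => deriv (deriv V) (h y))
      (isBUC_linearized hV hh)) ∧ muConst α V < z.re} =
      (fun l : ℝ => (l : ℂ)) '' frontEigenvalues α V c h := by
  ext z
  constructor
  · rintro ⟨h1, h2⟩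
    obtain ⟨κ₁, κ₂, hd⟩ := hh.exists_dichotomy hα hV h2
    obtain ⟨w, w', hw⟩ : ∃ w w', IsBoundState (spectralPotential α c (linearizedCoeff V h) z)
        (driftCoeff α c z).re w w' := by
      by_contra! hno
      exact h1 (mem_opResolventSet hα (isBUC_linearized hV hh) hd hno)
    have him := hh.im_eq_zero_of_boundState hα hV h2 hw
    have hz : (z.re : ℂ) = z := Complex.ext (by simp) (by simp [him])
    exact ⟨z.re, ⟨h2, w, w', by rw [hz]; exact hw⟩, hz⟩
  · rintro ⟨l, hl, rfl⟩
    have h2 : muConst α V < (l : ℂ).re := by simpa using hl.1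
    obtain ⟨κ₁, κ₂, hd⟩ := hh.exists_dichotomy hα hV h2
    obtain ⟨r, r', hr, -⟩ := hh.exists_realState hα hV hl
    exact ⟨(isSimpleEigenvalue_of_boundState hα (isBUC_linearized hV hh) hd hr).1, h2⟩

theorem isSimpleEigenvalue (hα : 0 < α) (hV : IsBistable V) (hh : IsFront V c h) {l : ℝ}
    (hl : l ∈ frontEigenvalues α V c h) :
    IsSimpleEigenvalue (generator α c (fun y => deriv (deriv V) (h y))
      (isBUC_linearized hV hh)) (l : ℂ) := by
  obtain ⟨κ₁, κ₂, hd⟩ := hh.exists_dichotomy hα hV (z := l) (by simpa using hl.1)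
  obtain ⟨r, r', hr, -⟩ := hh.exists_realState hα hV hl
  exact (isSimpleEigenvalue_of_boundState hα (isBUC_linearized hV hh) hd hr).2

end IsFront

theorem exists_strictAnti_range {S : Set ℝ} (hS : S.Finite) (h0 : (0 : ℝ) ∈ S)
    (hle : ∀ l ∈ S, l ≤ 0) :
    ∃ (k : ℕ) (lam : Fin (k + 1) → ℝ), lam 0 = 0 ∧ StrictAnti lam ∧ Set.range lam = S := by
  obtain ⟨k, hk⟩ : ∃ k, hS.toFinset.card = k + 1 :=
    Nat.exists_eq_succ_of_ne_zero (Finset.card_ne_zero_of_mem (hS.mem_toFinset.2 h0))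
  set f := hS.toFinset.orderEmbOfFin hk
  have hr : Set.range (fun i => f (Fin.rev i)) = S := by
    have h1 : Set.range (fun i => f (Fin.rev i)) = Set.range f :=
      Fin.rev_surjective.range_comp f
    rw [h1, Finset.range_orderEmbOfFin, hS.coe_toFinset]
  have ha : StrictAnti fun i => f (Fin.rev i) := fun i j hij =>
    f.strictMono (Fin.rev_lt_rev.2 hij)
  -- The increasing enumeration is reversed, so that index 0 carries the largest element, which is
  -- 0.
  refine ⟨k, fun i => f (Fin.rev i), ?_, ha, hr⟩
  obtain ⟨i, hi⟩ := hr.symm ▸ h0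
  refine le_antisymm (hle _ (hr ▸ Set.mem_range_self 0)) ?_
  rw [← hi]
  exact ha.antitone (Fin.zero_le i)

end

end DampedWave

theorem proposition9p3 (α : ℝ) (hα : 0 < α) (V : ℝ → ℝ) (hV : DampedWave.IsBistable V) :
    ∃ (k : ℕ) (lam : Fin (k + 1) → ℝ),
      lam 0 = 0 ∧ StrictAnti lam ∧ (∀ i, DampedWave.muConst α V < lam i) ∧
      ∀ (c : ℝ) (h : ℝ → ℝ) (hh : DampedWave.IsFront V c h),
        {z : ℂ | z ∈ DampedWave.opSpectrum (DampedWave.generator α c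
            (fun y => deriv (deriv V) (h y)) (DampedWave.isBUC_linearized hV hh)) ∧
          DampedWave.muConst α V < z.re} = Set.range (fun i => (lam i : ℂ)) ∧
        ∀ i, DampedWave.IsSimpleEigenvalue (DampedWave.generator α c
            (fun y => deriv (deriv V) (h y)) (DampedWave.isBUC_linearized hV hh)) (lam i : ℂ) := by
  by_cases hex : ∃ (c : ℝ) (h : ℝ → ℝ), DampedWave.IsFront V c h
  · obtain ⟨c₀, h₀, hh₀⟩ := hex
    obtain ⟨k, lam, h1, h2, h3⟩ := DampedWave.exists_strictAnti_range
      (hh₀.finite_frontEigenvalues hα hV) (hh₀.zero_mem hα hV)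
      fun l hl => hh₀.nonpos_of_mem hα hV hl
    have hmem : ∀ i, lam i ∈ DampedWave.frontEigenvalues α V c₀ h₀ := fun i =>
      h3 ▸ Set.mem_range_self i
    refine ⟨k, lam, h1, h2, fun i => (hmem i).1, fun c h hh => ?_⟩
    -- The list was built from one chosen front; here it is transferred to an arbitrary one.
    have he : DampedWave.frontEigenvalues α V c₀ h₀ = DampedWave.frontEigenvalues α V c h :=
      (hh.frontEigenvalues_subset hV hh₀).antisymm (hh₀.frontEigenvalues_subset hV hh)
    refine ⟨?_, fun i => hh.isSimpleEigenvalue hα hV (he ▸ hmem i)⟩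
    rw [hh.spectrum_eq hα hV, ← he, ← h3]
    exact (Set.range_comp (fun l : ℝ => (l : ℂ)) lam).symm
  -- If V admits no front, the spectral clause is vacuous and the single value 0 serves, since μ_α <
  -- 0.
  · exact ⟨0, fun _ => 0, rfl, fun i j hij => absurd hij (by omega),
      fun _ => DampedWave.muConst_neg hα hV, fun c h hh => absurd ⟨c, h, hh⟩ hex⟩
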